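/- Notation. Let $n\ge 2$, let $\mathbb S^{n-1}$ be the unit sphere of $\mathbb R^n$ with surface measure $d\mathbf u$, and let $\mathbb Y^{n+1}=\{(\mathbf u,b,a):\mathbf u\in\mathbb S^{n-1},\ b\in\mathbb R,\ a>0\}$. For $d\geq 1$, $\mathcal S_0(\mathbb R^d)$ is the subspace of the Schwartz space $\mathcal S(\mathbb R^d)$ consisting of the complex-valued functions all of whose moments vanish, i.e. $\int \mathbf x^m\phi(\mathbf x)\,d\mathbf x=0$ for all multi-indices $m$, with the topology inherited from $\mathcal S(\mathbb R^d)$. The space $\mathcal S(\mathbb Y^{n+1})$ consists of all $\Phi\in C^\infty(\mathbb Y^{n+1})$ such that, for all $l,m,k,s,r\in\mathbb N_0$, $$\sup_{(\mathbf u,b,a)}\Big(a^s+\frac1{a^s}\Big)(1+b^2)^{r/2}\big|\partial_a^l\,\partial_b^m\,\Delta_{\mathbf u}^k\Phi(\mathbf u,b,a)\big|<\infty ,$$ where $\Delta_{\mathbf u}$ is the Laplace–Beltrami operator of $\mathbb S^{n-1}$; its topology is given by these seminorms. The duals $\mathcal S_0'(\mathbb R^n)$ (the Lizorkin distributions) and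 $\mathcal S'(\mathbb Y^{n+1})$ carry the strong dual topologies. For $\psi\in\mathcal S(\mathbb R)$ put $\psi_{\mathbf u,b,a}(\mathbf x)=\frac1a\psi\big(\frac{\mathbf x\cdot\mathbf u-b}{a}\big)$ and, for $\phi\in\mathcal S_0(\mathbb R^n)$ and $\Phi\in\mathcal S(\mathbb Y^{n+1})$, $$\mathcal R_\psi\phi(\mathbf u,b,a)=\int_{\mathbb R^n}\phi(\mathbf x)\,\overline{\psi_{\mathbf u,b,a}(\mathbf x)}\,d\mathbf x,\qquad \mathcal R^t_\psi\Phi(\mathbf x)=\int_{\mathbb S^{n-1}}\int_0^\infty\int_{-\infty}^\infty\Phi(\mathbf u,b,a)\,\psi_{\mathbf u,b,a}(\mathbf x)\,\frac{db\,da\,d\mathbf u}{a^n}.$$ For $\psi\in\mathcal S_0(\mathbb R)$, the ridgelet transform $\mathcal R_\psi:\mathcal S_0'(\mathbb R^n)\to\mathcal S'(\mathbb Y^{n+1})$ and the ridgelet synthesis operator $\mathcal R^t_\psi:\mathcal S'(\mathbb Y^{n+1})\to\mathcal S'_0(\mathbb R^n)$ are defined by duality: $$\langle\mathcal R_\psi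 f,\Phi\rangle=\langle f,\mathcal R^t_{\overline\psi}\Phi\rangle,\qquad \langle\mathcal R^t_\psi F,\phi\rangle=\langle F,\mathcal R_{\overline\psi}\phi\rangle .$$ For $\psi,\eta\in\mathcal S(\mathbb R)$ let $$K_{\psi,\eta}=(2\pi)^{n-1}\int_{-\infty}^\infty\overline{\widehat\psi(\omega)}\,\widehat\eta(\omega)\,\frac{d\omega}{|\omega|^n},\qquad \widehat\psi(\omega)=\int_{-\infty}^\infty\psi(x)e^{-ix\omega}\,dx .$$ If $\psi$ is not the zero function, $\eta$ is called a reconstruction function for $\psi$ if $K_{\psi,\eta}$ is finite (the integral converges absolutely) and non-zero. Theorem (Inversion formula). Let $\psi\in\mathcal S_0(\mathbb R)$ be non-trivial and let $\eta\in\mathcal S_0(\mathbb R)$ be a reconstruction function for $\psi$. Then the two transforms $\mathcal R_\psi:\mathcal S_0'(\mathbb R^n)\to\mathcal S'(\mathbb Y^{n+1})$ and $\mathcal R^t_\eta:\mathcal S'(\mathbb Y^{n+1})\to\mathcal S_0'(\mathbb R^n)$ are well defined by duality, i.e. the integrals defining $\mathcal R^t_{\overline\psi}\Phi$ and $\mathcal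 R_{\overline\eta}\phi$ converge absolutely and give continuous linear operators $\mathcal R^t_{\overline\psi}:\mathcal S(\mathbb Y^{n+1})\to\mathcal S_0(\mathbb R^n)$ and $\mathcal R_{\overline\eta}:\mathcal S_0(\mathbb R^n)\to\mathcal S(\mathbb Y^{n+1})$, and $$\operatorname{id}_{\mathcal S_0'(\mathbb R^n)}=\frac1{K_{\psi,\eta}}\,\big(\mathcal R^t_\eta\circ\mathcal R_\psi\big).$$ -/

import Mathlib

open scoped ContDiff ComplexConjugate SchwartzMap
open MeasureTheory

noncomputable section

namespace Ridgelet

/-- The Euclidean space `ℝⁿ`. -/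
abbrev E (n : ℕ) : Type := EuclideanSpace ℝ (Fin n)

/-- The unit sphere of `ℝⁿ`. -/
abbrev Sph (n : ℕ) : Type := Metric.sphere (0 : E n) 1

/-- `Y n` is the product of the unit sphere of `ℝⁿ` with `ℝ` and `(0, ∞)`; its points are
written `(u, b, a)`. -/
abbrev Y (n : ℕ) : Type := Sph n × ℝ × Set.Ioi (0 : ℝ)

/-! ### Lizorkin test functions and distributions -/

/-- The monomial `x ^ m` for a multi-index `m`. -/
def monomial {n : ℕ} (m : Fin n → ℕ) (x : E n) : ℂ := ∏ i, ((x i : ℝ) : ℂ) ^ m i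

theorem integrable_monomial_mul {n : ℕ} (m : Fin n → ℕ) (φ : 𝓢(E n, ℂ)) :
    Integrable (fun x => monomial m x * φ x) := by
  have hc : Continuous (monomial m) := by unfold monomial; fun_prop
  refine (φ.integrable_pow_mul volume (∑ i, m i)).mono'
    (hc.mul φ.continuous).aestronglyMeasurable (Filter.Eventually.of_forall fun x => ?_)
  rw [norm_mul]
  gcongr
  unfold monomial
  rw [norm_prod, ← Finset.prod_pow_eq_pow_sum]
  refine Finset.prod_le_prod (fun _ _ => norm_nonneg _) fun i _ => ?_
  rw [norm_pow, Complex.norm_real]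
  gcongr
  exact PiLp.norm_apply_le x i

/-- The Lizorkin test function space on `ℝⁿ`: the Schwartz functions all of whose moments vanish,
with the topology of a subspace of the Schwartz space. -/
def Lizorkin (n : ℕ) : Submodule ℂ 𝓢(E n, ℂ) where
  carrier := {φ | ∀ m : Fin n → ℕ, ∫ x, monomial m x * φ x = 0}
  zero_mem' := by intro m; simp
  add_mem' := by
    intro φ χ hφ hχ m
    have h := integral_add (integrable_monomial_mul m φ) (integrable_monomial_mul m χ)
    simp only [Set.mem_ofPred_eq] at hφ hχ
    simpa [mul_add, hφ m, hχ m] using h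
  smul_mem' := by
    intro c φ hφ m
    have h := integral_const_mul (μ := volume) c (fun x => monomial m x * φ x)
    simp only [Set.mem_ofPred_eq] at hφ
    rw [hφ m, mul_zero] at h
    rw [← h]
    refine integral_congr_ae (Filter.Eventually.of_forall fun x => ?_)
    simp only [smul_apply, smul_eq_mul]
    ring

theorem integrable_pow_mul_real (m : ℕ) (φ : 𝓢(ℝ, ℂ)) :
    Integrable (fun x : ℝ => (x : ℂ) ^ m * φ x) := by
  refine (φ.integrable_pow_mul volume m).mono'
    (by fun_prop : Continuous _).aestronglyMeasurable (Filter.Eventually.of_forall fun x => ?_)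
  rw [norm_mul, norm_pow, Complex.norm_real]

/-- The Lizorkin test function space on the real line. -/
def LizorkinLine : Submodule ℂ 𝓢(ℝ, ℂ) where
  carrier := {φ | ∀ m : ℕ, ∫ x : ℝ, (x : ℂ) ^ m * φ x = 0}
  zero_mem' := by intro m; simp
  add_mem' := by
    intro φ χ hφ hχ m
    have h := integral_add (integrable_pow_mul_real m φ) (integrable_pow_mul_real m χ)
    simp only [Set.mem_ofPred_eq] at hφ hχ
    simpa [mul_add, hφ m, hχ m] using h
  smul_mem' := by
    intro c φ hφ m
    have h := integral_const_mul (μ := volume) c (fun x : ℝ => (x : ℂ) ^ m * φ x)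
    simp only [Set.mem_ofPred_eq] at hφ
    rw [hφ m, mul_zero] at h
    rw [← h]
    refine integral_congr_ae (Filter.Eventually.of_forall fun x => ?_)
    simp only [smul_apply, smul_eq_mul]
    ring

/-- The space of Lizorkin distributions on `ℝⁿ`: the dual of `Lizorkin n`. Mathlib's topology on
continuous linear functionals is uniform convergence on bounded sets, i.e. the strong dual
topology. -/
abbrev LizorkinDist (n : ℕ) : Type := Lizorkin n →L[ℂ] ℂ

/-! ### Smooth functions on `Y n` and their derivatives -/

/-- The open set of all `(x, b, a)` with `x ≠ 0` and `a > 0`. -/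
def dom (n : ℕ) : Set (E n × ℝ × ℝ) := {p | p.1 ≠ 0 ∧ 0 < p.2.2}

/-- The radial projection of `dom n` onto `Y n`. -/
def proj {n : ℕ} (p : E n × ℝ × ℝ) (hp : p ∈ dom n) : Y n :=
  (⟨‖p.1‖⁻¹ • p.1, by
      have h : ‖p.1‖ ≠ 0 := norm_ne_zero_iff.mpr hp.1
      rw [mem_sphere_zero_iff_norm, norm_smul, norm_inv, norm_norm, inv_mul_cancel₀ h]⟩,
    p.2.1, ⟨p.2.2, hp.2⟩)

/-- The point `(u, b, a)` of `Y n`, viewed in `ℝⁿ × ℝ × ℝ`. -/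
def coeY {n : ℕ} (y : Y n) : E n × ℝ × ℝ := ((y.1 : E n), y.2.1, (y.2.2 : ℝ))

open scoped Classical in
/-- The extension of a function on `Y n` that is homogeneous of degree `0` in the variable of
the sphere: `(x, b, a) ↦ F (x / |x|, b, a)` on `dom n` (and `0`, never used, elsewhere). -/
def ext {n : ℕ} (F : Y n → ℂ) (p : E n × ℝ × ℝ) : ℂ :=
  if hp : p ∈ dom n then F (proj p hp) else 0

/-- Smoothness of a function on the manifold `Y n`. As `(x, b, a) ↦ (x / |x|, b, a)` is a smooth
retraction of the open set `dom n` onto the submanifold `Y n`, a function on `Y n` is smooth if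
and only if its composition with this retraction is. -/
def SmoothY {n : ℕ} (F : Y n → ℂ) : Prop := ContDiffOn ℝ ∞ (ext F) (dom n)

/-- The partial derivative with respect to the scale `a`. -/
def dA {n : ℕ} (F : Y n → ℂ) (y : Y n) : ℂ :=
  deriv (fun t : ℝ => ext F ((y.1 : E n), y.2.1, t)) y.2.2

/-- The partial derivative with respect to the position `b`. -/
def dB {n : ℕ} (F : Y n → ℂ) (y : Y n) : ℂ :=
  deriv (fun t : ℝ => F (y.1, t, y.2.2)) y.2.1

/-- The Laplace-Beltrami operator of the unit sphere, in the variable `u`: the restriction to the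
sphere of the Euclidean Laplacian of the extension that is homogeneous of degree `0`. -/
def lapU {n : ℕ} (F : Y n → ℂ) (y : Y n) : ℂ :=
  Laplacian.laplacian (fun x : E n => ext F (x, y.2.1, (y.2.2 : ℝ))) (y.1 : E n)

section smooth

variable {n : ℕ}

theorem isOpen_dom : IsOpen (dom n) :=
  (isOpen_ne_fun continuous_fst continuous_const).inter
    (isOpen_lt continuous_const (continuous_snd.comp continuous_snd))

theorem coeY_mem (y : Y n) : coeY y ∈ dom n :=
  ⟨by
    have h : ‖(y.1 : E n)‖ = 1 := mem_sphere_zero_iff_norm.mp y.1.2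
    intro h0
    simp only [coeY] at h0
    rw [h0] at h
    simp at h, y.2.2.2⟩

theorem proj_coeY (y : Y n) : proj (coeY y) (coeY_mem y) = y := by
  have h : ‖(y.1 : E n)‖ = 1 := mem_sphere_zero_iff_norm.mp y.1.2
  refine Prod.ext (Subtype.ext ?_) rfl
  simp [proj, coeY, h]

theorem ext_coeY (F : Y n → ℂ) (y : Y n) : ext F (coeY y) = F y := by
  unfold ext
  rw [dif_pos (coeY_mem y), proj_coeY]

theorem ext_of_mem (F : Y n → ℂ) {p : E n × ℝ × ℝ} (hp : p ∈ dom n) :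
    ext F p = F (proj p hp) := dif_pos hp

theorem ext_add (F G : Y n → ℂ) : ext (F + G) = ext F + ext G := by
  funext p
  by_cases hp : p ∈ dom n <;> simp [ext, hp]

theorem ext_smul (c : ℂ) (F : Y n → ℂ) : ext (c • F) = c • ext F := by
  funext p
  by_cases hp : p ∈ dom n <;> simp [ext, hp]

theorem ext_zero : ext (0 : Y n → ℂ) = 0 := by
  funext p
  by_cases hp : p ∈ dom n <;> simp [ext, hp]

theorem SmoothY.contDiffAt {F : Y n → ℂ} (hF : SmoothY F) {p : E n × ℝ × ℝ} (hp : p ∈ dom n) :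
    ContDiffAt ℝ ∞ (ext F) p := ContDiffOn.contDiffAt hF (isOpen_dom.mem_nhds hp)

theorem SmoothY.differentiableAt {F : Y n → ℂ} (hF : SmoothY F) {p : E n × ℝ × ℝ}
    (hp : p ∈ dom n) : DifferentiableAt ℝ (ext F) p :=
  (hF.contDiffAt hp).differentiableAt (by simp)

theorem dA_eq {F : Y n → ℂ} (hF : SmoothY F) (y : Y n) :
    dA F y = fderiv ℝ (ext F) (coeY y) ((0 : E n), (0 : ℝ), (1 : ℝ)) := by
  have h1 : HasDerivAt (fun t : ℝ => ((y.1 : E n), y.2.1, t)) ((0 : E n), (0 : ℝ), (1 : ℝ))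
      (y.2.2 : ℝ) :=
    (hasDerivAt_const _ _).prodMk ((hasDerivAt_const _ _).prodMk (hasDerivAt_id _))
  exact ((hF.differentiableAt (coeY_mem y)).hasFDerivAt.comp_hasDerivAt _ h1).deriv

theorem dB_eq {F : Y n → ℂ} (hF : SmoothY F) (y : Y n) :
    dB F y = fderiv ℝ (ext F) (coeY y) ((0 : E n), (1 : ℝ), (0 : ℝ)) := by
  have h1 : HasDerivAt (fun t : ℝ => ((y.1 : E n), t, (y.2.2 : ℝ)))
      ((0 : E n), (1 : ℝ), (0 : ℝ)) y.2.1 :=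
    (hasDerivAt_const _ _).prodMk ((hasDerivAt_id _).prodMk (hasDerivAt_const _ _))
  have h2 : (fun t : ℝ => F (y.1, t, y.2.2)) =
      fun t : ℝ => ext F ((y.1 : E n), t, (y.2.2 : ℝ)) := by
    funext t
    exact (ext_coeY F (y.1, t, y.2.2)).symm
  unfold dB
  rw [h2]
  exact ((hF.differentiableAt (coeY_mem y)).hasFDerivAt.comp_hasDerivAt _ h1).deriv

theorem contDiffOn_fderiv {F : Y n → ℂ} (hF : SmoothY F) :
    ContDiffOn ℝ ∞ (fderiv ℝ (ext F)) (dom n) :=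
  ContDiffOn.fderiv_of_isOpen hF isOpen_dom (by simp)

theorem lapU_eq {F : Y n → ℂ} (hF : SmoothY F) (y : Y n) :
    lapU F y = ∑ i, fderiv ℝ (fderiv ℝ (ext F)) (coeY y)
      (stdOrthonormalBasis ℝ (E n) i, (0 : ℝ), (0 : ℝ))
      (stdOrthonormalBasis ℝ (E n) i, (0 : ℝ), (0 : ℝ)) := by
  have key : ∀ x : E n, HasFDerivAt (fun x : E n => (x, y.2.1, (y.2.2 : ℝ)))
      (ContinuousLinearMap.inl ℝ (E n) (ℝ × ℝ)) x := fun x =>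
    hasFDerivAt_prodMk_left x (y.2.1, (y.2.2 : ℝ))
  have hev : fderiv ℝ (fun x : E n => ext F (x, y.2.1, (y.2.2 : ℝ))) =ᶠ[nhds (y.1 : E n)]
      fun x => (fderiv ℝ (ext F) (x, y.2.1, (y.2.2 : ℝ))).comp
        (ContinuousLinearMap.inl ℝ (E n) (ℝ × ℝ)) := by
    have hne : ∀ᶠ x in nhds (y.1 : E n), x ≠ 0 := 
      isOpen_ne.mem_nhds (coeY_mem y).1
    filter_upwards [hne] with x hx
    exact ((hF.differentiableAt (p := (x, y.2.1, (y.2.2 : ℝ))) ⟨hx, y.2.2.2⟩).hasFDerivAt.comp x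
      (key x)).fderiv
  have hd : HasFDerivAt (fderiv ℝ (ext F)) (fderiv ℝ (fderiv ℝ (ext F)) (coeY y))
      ((y.1 : E n), y.2.1, (y.2.2 : ℝ)) :=
    (((contDiffOn_fderiv hF).contDiffAt (isOpen_dom.mem_nhds (coeY_mem y))).differentiableAt
      (by simp)).hasFDerivAt
  have h2 := (hd.comp (y.1 : E n) (key _)).clm_comp
    (hasFDerivAt_const (ContinuousLinearMap.inl ℝ (E n) (ℝ × ℝ)) (y.1 : E n))
  unfold lapU
  rw [InnerProductSpace.laplacian_eq_iteratedFDeriv_stdOrthonormalBasis]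
  refine Finset.sum_congr rfl fun i _ => ?_
  rw [iteratedFDeriv_two_apply, hev.fderiv_eq]
  have h3 := h2.fderiv
  simp only [Function.comp_def] at h3
  rw [h3]
  simp
  rfl

theorem contDiffOn_retract :
    ContDiffOn ℝ ∞ (fun p : E n × ℝ × ℝ => (‖p.1‖⁻¹ • p.1, p.2.1, p.2.2)) (dom n) := by
  intro p hp
  have h1 : ContDiffAt ℝ ∞ (fun p : E n × ℝ × ℝ => ‖p.1‖) p :=
    (contDiffAt_norm ℝ hp.1).comp p contDiffAt_fst
  refine ContDiffAt.contDiffWithinAt ?_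
  exact ((h1.inv (norm_ne_zero_iff.mpr hp.1)).smul contDiffAt_fst).prodMk (by fun_prop)

theorem coeY_proj {p : E n × ℝ × ℝ} (hp : p ∈ dom n) :
    coeY (proj p hp) = (‖p.1‖⁻¹ • p.1, p.2.1, p.2.2) := rfl

/-- A function on `Y n` with a smooth extension to `dom n` is smooth. -/
theorem smoothY_of {F : Y n → ℂ} {g : E n × ℝ × ℝ → ℂ} (hg : ContDiffOn ℝ ∞ g (dom n))
    (h : ∀ y, F y = g (coeY y)) : SmoothY F := by
  have h1 : ContDiffOn ℝ ∞ (g ∘ fun p : E n × ℝ × ℝ => (‖p.1‖⁻¹ • p.1, p.2.1, p.2.2)) (dom n) :=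
    hg.comp contDiffOn_retract fun p hp => by
      have := coeY_mem (proj p hp)
      rwa [coeY_proj] at this
  refine h1.congr fun p hp => ?_
  rw [ext_of_mem F hp, h, coeY_proj]
  rfl

theorem SmoothY.add {F G : Y n → ℂ} (hF : SmoothY F) (hG : SmoothY G) : SmoothY (F + G) := by
  unfold SmoothY
  rw [ext_add]
  exact ContDiffOn.add hF hG

theorem SmoothY.smul {F : Y n → ℂ} (c : ℂ) (hF : SmoothY F) : SmoothY (c • F) := by
  unfold SmoothY
  rw [ext_smul]
  exact ContDiffOn.const_smul c hF

theorem SmoothY.zero : SmoothY (0 : Y n → ℂ) := by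
  unfold SmoothY
  rw [ext_zero]
  exact contDiffOn_const

theorem SmoothY.dA {F : Y n → ℂ} (hF : SmoothY F) : SmoothY (dA F) :=
  smoothY_of ((contDiffOn_fderiv hF).clm_apply contDiffOn_const) (dA_eq hF)

theorem SmoothY.dB {F : Y n → ℂ} (hF : SmoothY F) : SmoothY (dB F) :=
  smoothY_of ((contDiffOn_fderiv hF).clm_apply contDiffOn_const) (dB_eq hF)

theorem SmoothY.lapU {F : Y n → ℂ} (hF : SmoothY F) : SmoothY (lapU F) :=
  smoothY_of (ContDiffOn.sum fun _ _ =>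
    (((contDiffOn_fderiv hF).fderiv_of_isOpen isOpen_dom (by simp)).clm_apply
      contDiffOn_const).clm_apply contDiffOn_const) (lapU_eq hF)

end smooth

/-- The vector space of smooth functions on `Y n`. -/
def smoothFun (n : ℕ) : Submodule ℂ (Y n → ℂ) where
  carrier := {F | SmoothY F}
  zero_mem' := SmoothY.zero
  add_mem' := SmoothY.add
  smul_mem' := fun c _ h => SmoothY.smul c h

/-- `dA` as a linear operator on smooth functions. -/
def opA (n : ℕ) : Module.End ℂ (smoothFun n) where
  toFun F := ⟨dA F.1, SmoothY.dA F.2⟩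
  map_add' F G := by
    refine Subtype.ext (funext fun y => ?_)
    change dA (F.1 + G.1) y = dA F.1 y + dA G.1 y
    rw [dA_eq F.2, dA_eq G.2, dA_eq (F.2.add G.2), ext_add,
      fderiv_add (F.2.differentiableAt (coeY_mem y)) (G.2.differentiableAt (coeY_mem y))]
    rfl
  map_smul' c F := by
    refine Subtype.ext (funext fun y => ?_)
    change dA (c • F.1) y = c • dA F.1 y
    rw [dA_eq F.2, dA_eq (F.2.smul c), ext_smul,
      fderiv_const_smul (F.2.differentiableAt (coeY_mem y))]
    rfl

/-- `dB` as a linear operator on smooth functions. -/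
def opB (n : ℕ) : Module.End ℂ (smoothFun n) where
  toFun F := ⟨dB F.1, SmoothY.dB F.2⟩
  map_add' F G := by
    refine Subtype.ext (funext fun y => ?_)
    change dB (F.1 + G.1) y = dB F.1 y + dB G.1 y
    rw [dB_eq F.2, dB_eq G.2, dB_eq (F.2.add G.2), ext_add,
      fderiv_add (F.2.differentiableAt (coeY_mem y)) (G.2.differentiableAt (coeY_mem y))]
    rfl
  map_smul' c F := by
    refine Subtype.ext (funext fun y => ?_)
    change dB (c • F.1) y = c • dB F.1 y
    rw [dB_eq F.2, dB_eq (F.2.smul c), ext_smul,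
      fderiv_const_smul (F.2.differentiableAt (coeY_mem y))]
    rfl

theorem contDiffAt_slice {n : ℕ} {F : Y n → ℂ} (hF : SmoothY F) (y : Y n) :
    ContDiffAt ℝ 2 (fun x : E n => ext F (x, y.2.1, (y.2.2 : ℝ))) (y.1 : E n) :=
  ((hF.contDiffAt (coeY_mem y)).of_le (WithTop.coe_le_coe.2 (le_top : (2 : ℕ∞) ≤ ⊤))).comp (y.1 : E n)
    (f := fun x : E n => (x, y.2.1, (y.2.2 : ℝ))) (by fun_prop)

/-- `lapU` as a linear operator on smooth functions. -/
def opL (n : ℕ) : Module.End ℂ (smoothFun n) where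
  toFun F := ⟨lapU F.1, SmoothY.lapU F.2⟩
  map_add' F G := by
    refine Subtype.ext (funext fun y => ?_)
    change lapU (F.1 + G.1) y = lapU F.1 y + lapU G.1 y
    unfold lapU
    rw [ext_add]
    exact (contDiffAt_slice F.2 y).laplacian_add (contDiffAt_slice G.2 y)
  map_smul' c F := by
    refine Subtype.ext (funext fun y => ?_)
    change lapU (c • F.1) y = c • lapU F.1 y
    unfold lapU
    rw [ext_smul]
    exact InnerProductSpace.laplacian_smul c (contDiffAt_slice F.2 y)

/-! ### The space of highly localized test functions on `Y n` and its dual -/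

/-- Indices `l, m, k, s, r` of the seminorms. -/
structure Idx where
  l : ℕ
  m : ℕ
  k : ℕ
  s : ℕ
  r : ℕ

/-- The weight `(a ^ s + 1 / a ^ s) (1 + b ^ 2) ^ (r / 2)`. -/
def weight {n : ℕ} (i : Idx) (y : Y n) : ℝ :=
  ((y.2.2 : ℝ) ^ i.s + 1 / (y.2.2 : ℝ) ^ i.s) * (1 + y.2.1 ^ 2) ^ ((i.r : ℝ) / 2)

/-- `∂_a ^ l ∂_b ^ m Δ_u ^ k F`. -/
def derivY {n : ℕ} (i : Idx) (F : smoothFun n) : Y n → ℂ :=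
  ((opA n ^ i.l) ((opB n ^ i.m) ((opL n ^ i.k) F))).1

/-- The function whose supremum is the seminorm with index `i`. -/
def weighted {n : ℕ} (i : Idx) (F : smoothFun n) (y : Y n) : ℝ :=
  weight i y * ‖derivY i F y‖

theorem weight_nonneg {n : ℕ} (i : Idx) (y : Y n) : 0 ≤ weight i y := by
  have : (0 : ℝ) < y.2.2 := y.2.2.2
  unfold weight
  positivity

theorem weighted_nonneg {n : ℕ} (i : Idx) (F : smoothFun n) (y : Y n) : 0 ≤ weighted i F y :=
  mul_nonneg (weight_nonneg i y) (norm_nonneg _)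

theorem weighted_add {n : ℕ} (i : Idx) (F G : smoothFun n) (y : Y n) :
    weighted i (F + G) y ≤ weighted i F y + weighted i G y := by
  unfold weighted
  rw [← mul_add]
  refine mul_le_mul_of_nonneg_left ?_ (weight_nonneg i y)
  have : derivY i (F + G) y = derivY i F y + derivY i G y := by
    simp only [derivY, map_add]; rfl
  rw [this]
  exact norm_add_le _ _

theorem weighted_smul {n : ℕ} (i : Idx) (c : ℂ) (F : smoothFun n) (y : Y n) :
    weighted i (c • F) y = ‖c‖ * weighted i F y := by
  unfold weighted
  have : derivY i (c • F) y = c • derivY i F y := by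
    simp only [derivY, map_smul]; rfl
  rw [this, norm_smul]
  ring

theorem weighted_zero {n : ℕ} (i : Idx) (y : Y n) : weighted i (0 : smoothFun n) y = 0 := by
  simpa using weighted_smul i 0 (0 : smoothFun n) y

/-- The smooth functions on `Y n` all of whose seminorms are finite. -/
def schwartzYSubmodule (n : ℕ) : Submodule ℂ (smoothFun n) where
  carrier := {F | ∀ i : Idx, BddAbove (Set.range (weighted i F))}
  zero_mem' := fun i => ⟨0, by rintro _ ⟨y, rfl⟩; exact (weighted_zero i y).le⟩
  add_mem' := by
    intro F G hF hG i
    obtain ⟨A, hA⟩ := hF i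
    obtain ⟨B, hB⟩ := hG i
    refine ⟨A + B, ?_⟩
    rintro _ ⟨y, rfl⟩
    exact (weighted_add i F G y).trans (add_le_add (hA ⟨y, rfl⟩) (hB ⟨y, rfl⟩))
  smul_mem' := by
    intro c F hF i
    obtain ⟨A, hA⟩ := hF i
    refine ⟨‖c‖ * A, ?_⟩
    rintro _ ⟨y, rfl⟩
    rw [weighted_smul]
    exact mul_le_mul_of_nonneg_left (hA ⟨y, rfl⟩) (norm_nonneg c)

/-- The test function space `𝓢(Y n)`. It is a type of its own, so that its topology is the one
given by the seminorms below and not a subspace topology. -/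
def SchwartzY (n : ℕ) : Type := schwartzYSubmodule n

instance (n : ℕ) : AddCommGroup (SchwartzY n) :=
  inferInstanceAs (AddCommGroup (schwartzYSubmodule n))

instance (n : ℕ) : Module ℂ (SchwartzY n) := inferInstanceAs (Module ℂ (schwartzYSubmodule n))

/-- The function underlying a test function. -/
def SchwartzY.fn {n : ℕ} (Φ : SchwartzY n) : Y n → ℂ := Φ.1.1

/-- The seminorms
`sup_{(u, b, a)} (a ^ s + 1 / a ^ s) (1 + b ^ 2) ^ (r / 2) |∂_a ^ l ∂_b ^ m Δ_u ^ k Φ|`. -/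
def seminormY (n : ℕ) (i : Idx) : Seminorm ℂ (SchwartzY n) :=
  Seminorm.of (fun Φ => ⨆ y, weighted i Φ.1 y)
    (fun Φ Ψ => by
      have h0 : 0 ≤ (⨆ y, weighted i Φ.1 y) + ⨆ y, weighted i Ψ.1 y :=
        add_nonneg (Real.iSup_nonneg (weighted_nonneg i _)) (Real.iSup_nonneg (weighted_nonneg i _))
      refine Real.iSup_le (fun y => ?_) h0
      exact (weighted_add i Φ.1 Ψ.1 y).trans
        (add_le_add (le_ciSup (Φ.2 i) y) (le_ciSup (Ψ.2 i) y)))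
    (fun c Φ => by
      rw [Real.mul_iSup_of_nonneg (norm_nonneg c)]
      exact congrArg iSup (funext fun y => weighted_smul i c Φ.1 y))

instance : Nonempty Idx := ⟨⟨0, 0, 0, 0, 0⟩⟩

/-- The locally convex topology generated by all the seminorms. -/
instance (n : ℕ) : TopologicalSpace (SchwartzY n) :=
  SeminormFamily.moduleFilterBasis (𝕜 := ℂ) (fun i : Idx => seminormY n i) |>.topology'

theorem withSeminorms_schwartzY (n : ℕ) : WithSeminorms (fun i : Idx => seminormY n i) := ⟨rfl⟩

/-- The dual of `𝓢(Y n)`, with its strong dual topology. -/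
abbrev SchwartzYDist (n : ℕ) : Type := SchwartzY n →L[ℂ] ℂ

/-! ### The transforms -/

/-- The standard measure `a ^ (-n) du db da` on `Y n`, where `du` is the surface measure of the
unit sphere. -/
def stdMeasure (n : ℕ) : Measure (Y n) :=
  ((volume : Measure (E n)).toSphere.prod
    ((volume : Measure ℝ).prod ((volume : Measure ℝ).comap Subtype.val))).withDensity
    fun y => ENNReal.ofReal (1 / (y.2.2 : ℝ) ^ n)

/-- The ridgelet `ψ_{u,b,a}(x) = a⁻¹ ψ((x · u - b) / a)`. -/
def ridge {n : ℕ} (ψ : ℝ → ℂ) (y : Y n) (x : E n) : ℂ :=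
  (1 / ((y.2.2 : ℝ) : ℂ)) * ψ ((inner ℝ x (y.1 : E n) - y.2.1) / (y.2.2 : ℝ))

/-- The ridgelet transform of a function on `ℝⁿ`. -/
def ridgelet {n : ℕ} (ψ : ℝ → ℂ) (f : E n → ℂ) (y : Y n) : ℂ :=
  ∫ x, f x * conj (ridge ψ y x)

/-- The ridgelet synthesis operator on functions on `Y n`. -/
def synthesis {n : ℕ} (ψ : ℝ → ℂ) (F : Y n → ℂ) (x : E n) : ℂ :=
  ∫ y, F y * ridge ψ y x ∂stdMeasure n

/-- The pointwise complex conjugate of `ψ`. -/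
def conjFn (ψ : ℝ → ℂ) : ℝ → ℂ := fun t => conj (ψ t)

/-- `T` is the ridgelet transform with respect to `ψ`, as a continuous linear operator from the
Lizorkin test functions to `𝓢(Y n)`. -/
def IsRidgeletOperator (n : ℕ) (ψ : ℝ → ℂ) (T : Lizorkin n →L[ℂ] SchwartzY n) : Prop :=
  ∀ (φ : Lizorkin n) (y : Y n),
    Integrable (fun x : E n => φ.1 x * conj (ridge ψ y x)) ∧
    (T φ).fn y = ridgelet ψ (fun x => φ.1 x) y

/-- `T` is the ridgelet synthesis operator with respect to `ψ`, as a continuous linear operator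
from `𝓢(Y n)` to the Lizorkin test functions. -/
def IsSynthesisOperator (n : ℕ) (ψ : ℝ → ℂ) (T : SchwartzY n →L[ℂ] Lizorkin n) : Prop :=
  ∀ (Φ : SchwartzY n) (x : E n),
    Integrable (fun y : Y n => Φ.fn y * ridge ψ y x) (stdMeasure n) ∧
    (T Φ).1 x = synthesis ψ Φ.fn x

open scoped Classical in
/-- The ridgelet transform as a continuous operator on test functions (`0` if there is none;
there is at most one). -/
def ridgeletCLM (n : ℕ) (ψ : ℝ → ℂ) : Lizorkin n →L[ℂ] SchwartzY n :=
  if h : ∃ T, IsRidgeletOperator n ψ T then h.choose else 0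

open scoped Classical in
/-- The synthesis operator as a continuous operator on test functions (`0` if there is none;
there is at most one). -/
def synthesisCLM (n : ℕ) (ψ : ℝ → ℂ) : SchwartzY n →L[ℂ] Lizorkin n :=
  if h : ∃ T, IsSynthesisOperator n ψ T then h.choose else 0

/-- The ridgelet transform of Lizorkin distributions,
`⟨R_ψ f, Φ⟩ = ⟨f, Rᵗ_{conj ψ} Φ⟩`. -/
def ridgeletDist (n : ℕ) (ψ : LizorkinLine) : LizorkinDist n →L[ℂ] SchwartzYDist n :=
  ContinuousLinearMap.precomp ℂ (synthesisCLM n (conjFn fun t => ψ.1 t))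

/-- The synthesis operator on distributions, `⟨Rᵗ_ψ F, φ⟩ = ⟨F, R_{conj ψ} φ⟩`. -/
def synthesisDist (n : ℕ) (ψ : LizorkinLine) : SchwartzYDist n →L[ℂ] LizorkinDist n :=
  ContinuousLinearMap.precomp ℂ (ridgeletCLM n (conjFn fun t => ψ.1 t))

/-! ### Reconstruction functions -/

/-- The Fourier transform on the line, without `2π` in the exponent. -/
def hat (ψ : ℝ → ℂ) (w : ℝ) : ℂ := ∫ x : ℝ, ψ x * Complex.exp (-Complex.I * x * w)

/-- The integrand `conj (ψ^(w)) η^(w) / |w| ^ n`. -/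
def kernelK (n : ℕ) (ψ η : ℝ → ℂ) (w : ℝ) : ℂ :=
  conj (hat ψ w) * hat η w / ((|w| ^ n : ℝ) : ℂ)

/-- The constant `K_{ψ,η}`. -/
def K (n : ℕ) (ψ η : ℝ → ℂ) : ℂ :=
  (((2 * Real.pi) ^ (n - 1) : ℝ) : ℂ) * ∫ w, kernelK n ψ η w

/-- `η` is a reconstruction function for `ψ`: the constant `K_{ψ,η}` is finite (the integral
converges absolutely) and non-zero. -/
def IsReconstruction (n : ℕ) (ψ η : ℝ → ℂ) : Prop :=
  Integrable (kernelK n ψ η) ∧ K n ψ η ≠ 0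

end Ridgelet

end

noncomputable section

namespace Ridgelet

/-! ### Operations on the Lizorkin space of the line -/

/-! Both transforms on distributions are transposes, so the composite sends `f` to `f` composed with
R^t_{conj ψ} ∘ R_{conj η} on test functions. Hence it suffices that these two operators map
continuously between the test spaces and that their composite is multiplication by `K`
(`synthesis_comp_ridgelet`).

Continuity of the ridgelet transform. One has R_{conj η} φ(u, b, a) = a⁻¹ W(u/a, b/a), where W(w, s)
= ∫ φ(x) η(x·w − s) dx is `wave`. All powers of |w|, positive or negative, and all powers of s times
W are bounded by continuous seminorms of φ (`dominated_norm_zpow_mul_pow_mul_wave`): large |w| by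
integration by parts, since η has primitives of every order in the Lizorkin space; small |w| because
the vanishing moments of φ make W vanish to infinite order at w = 0; and s because s = x·w − t at t
= x·w − s. As |u/a| = 1/a, this is decay at a → 0, at a → ∞ and in b. The functions a^(−i) b^j
W(u/a, b/a) span a family stable under ∂_a, ∂_b and Δ_u (`RidgeFamily`), so the derivatives obey the
same bounds.

Continuity of the synthesis operator. Integrals of Φ against a^i b^j P(u) ψ((x·u − b)/a) form a
family (`synInt`) stable under differentiation in x. For decay in x, Δ_u applied to such a kernel
produces |x|² ψ'' plus terms that are at most linear in x, apart from powers of x·u, and x·u = b + a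
t can be traded for powers of a and b. Green's identity moves Δ_u to Φ, which gains a power of |x|
at each step (`dominated_pow_mul_synInt`). Writing ψ = χ' presents the integral as a divergence of
Schwartz functions, because |u| = 1; integration by parts then kills all moments
(`integral_monomial_mul_synInt`).

Inversion. With r = 1/a and ξ = r u, the integral over the sphere and the scales becomes ∫ dξ over
ℝⁿ of the correlation in s of W(ξ, s) with conj ψ (`synInt_eq_integral_waveCorr`). On the Fourier
side this correlation is ∫ conj ψ^(v) η^(v) G(−v ξ) dv, where G(ξ) = e^(2πi x·ξ) φ^(ξ). Absolute
convergence of `K` permits Fubini; scaling ξ contributes |v|^(−n), and ∫ G = φ(x) by Fourier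
inversion (`integral_waveCorr`). -/

theorem moment_line (ψ : LizorkinLine) (m : ℕ) : ∫ x : ℝ, (x : ℂ) ^ m * ψ.1 x = 0 := ψ.2 m

/-- Integration by parts against a power of the variable. -/
theorem integral_pow_mul_of_hasDerivAt (m : ℕ) (φ χ : 𝓢(ℝ, ℂ))
    (h : ∀ x, HasDerivAt φ (χ x) x) :
    ∫ x : ℝ, (x : ℂ) ^ m * χ x = -(m : ℂ) * ∫ x : ℝ, (x : ℂ) ^ (m - 1) * φ x := by
  have hu : ∀ x : ℝ, HasDerivAt (fun x : ℝ => (x : ℂ) ^ m) ((m : ℂ) * (x : ℂ) ^ (m - 1)) x := by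
    intro x
    have h1 := (Complex.ofRealCLM.hasDerivAt (x := x)).pow m
    simp only [Complex.ofRealCLM_apply, Complex.ofReal_one, mul_one] at h1
    exact h1
  have h1 : Integrable ((fun x : ℝ => (m : ℂ) * (x : ℂ) ^ (m - 1)) * ⇑φ) := by
    simpa [Pi.mul_def, mul_assoc] using (integrable_pow_mul_real (m - 1) φ).const_mul (m : ℂ)
  have h2 := integral_mul_deriv_eq_deriv_mul_of_integrable (u := fun x : ℝ => (x : ℂ) ^ m)
    (v := φ) (v' := χ) (fun x _ => hu x) (fun x _ => h x) (integrable_pow_mul_real m χ) h1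
    (integrable_pow_mul_real m φ)
  rw [h2, ← integral_const_mul, ← integral_neg]
  congr 1
  ext x
  ring

/-- The derivative of a Lizorkin function on the line. -/
def dLine (ψ : LizorkinLine) : LizorkinLine :=
  ⟨SchwartzMap.derivCLM ℂ ℂ ψ.1, fun m => by
    rw [integral_pow_mul_of_hasDerivAt m ψ.1 _ (fun x => ψ.1.hasDerivAt x), moment_line ψ, mul_zero]⟩

theorem hasDerivAt_line (ψ : LizorkinLine) (x : ℝ) : HasDerivAt ψ.1 ((dLine ψ).1 x) x :=
  ψ.1.hasDerivAt x

/-- The product of a Lizorkin function on the line with the variable. -/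
def mulLine (ψ : LizorkinLine) : LizorkinLine :=
  ⟨SchwartzMap.smulLeftCLM ℂ (fun x : ℝ => (x : ℂ)) ψ.1, fun m => by
    rw [← moment_line ψ (m + 1)]
    refine integral_congr_ae (.of_forall fun x => ?_)
    simp only [SchwartzMap.smulLeftCLM_apply_apply
      (show Function.HasTemperateGrowth (fun x : ℝ => (x : ℂ)) by fun_prop), smul_eq_mul]
    ring⟩

@[simp] theorem mulLine_apply (ψ : LizorkinLine) (x : ℝ) : (mulLine ψ).1 x = x * ψ.1 x :=
  SchwartzMap.smulLeftCLM_apply_apply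
    (show Function.HasTemperateGrowth (fun x : ℝ => (x : ℂ)) by fun_prop) _ _

/-- The complex conjugate of a Lizorkin function on the line. -/
def conjLine (ψ : LizorkinLine) : LizorkinLine :=
  ⟨{ toFun := fun x => starRingEnd ℂ (ψ.1 x)
     smooth' := Complex.conjCLE.contDiff.comp (ψ.1.smooth ⊤)
     decay' := fun k m => by
      obtain ⟨C, hC⟩ := ψ.1.decay' k m
      refine ⟨C, fun x => le_trans (le_of_eq ?_) (hC x)⟩
      congr 1
      exact Complex.conjLIE.norm_iteratedFDeriv_comp_left ψ.1 x m }, fun m => by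
    have h := congrArg (starRingEnd ℂ) (moment_line ψ m)
    rw [← integral_conj] at h
    have h2 : ∫ x : ℝ, (x : ℂ) ^ m * starRingEnd ℂ (ψ.1 x) = 0 := by simpa using h
    exact h2⟩

@[simp] theorem conjLine_apply (ψ : LizorkinLine) (x : ℝ) : (conjLine ψ).1 x = starRingEnd ℂ (ψ.1 x) := rfl

/-- Since φ has mean zero, the integral over (−∞, x] is minus the one over (x, ∞). Choosing the
half-line on the side of x away from the origin gives |x| ≤ |t| throughout. This is the decay of the
primitive. -/
theorem pow_mul_norm_integral_Iic_le (φ : 𝓢(ℝ, ℂ)) (h0 : ∫ x, φ x = 0) (k : ℕ) (x : ℝ) :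
    ‖x‖ ^ k * ‖∫ t in Set.Iic x, φ t‖ ≤ ∫ t, ‖t‖ ^ k * ‖φ t‖ := by
  have hint := φ.integrable_pow_mul volume k
  have key : ∀ s : Set ℝ, MeasurableSet s → (∀ t ∈ s, ‖x‖ ≤ ‖t‖) →
      ‖x‖ ^ k * ‖∫ t in s, φ t‖ ≤ ∫ t, ‖t‖ ^ k * ‖φ t‖ := by
    intro s hs hle
    calc ‖x‖ ^ k * ‖∫ t in s, φ t‖ ≤ ‖x‖ ^ k * ∫ t in s, ‖φ t‖ := by
          gcongr; exact norm_integral_le_integral_norm _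
      _ = ∫ t in s, ‖x‖ ^ k * ‖φ t‖ := (integral_const_mul _ _).symm
      _ ≤ ∫ t in s, ‖t‖ ^ k * ‖φ t‖ := by
          refine setIntegral_mono_on (φ.integrable.norm.const_mul _).integrableOn
            hint.integrableOn hs fun t ht => ?_
          gcongr
          exact hle t ht
      _ ≤ ∫ t, ‖t‖ ^ k * ‖φ t‖ :=
          setIntegral_le_integral hint (.of_forall fun t => by positivity)
  rcases le_total x 0 with hx | hx
  · refine key _ measurableSet_Iic fun t ht => ?_
    rw [Real.norm_of_nonpos hx, Real.norm_of_nonpos (le_trans ht hx)]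
    exact neg_le_neg ht
  · have h1 : ∫ t in Set.Iic x, φ t = -∫ t in Set.Ioi x, φ t := by
      have h2 := integral_add_compl (measurableSet_Iic (a := x)) (φ.integrable (μ := volume))
      rw [h0, Set.compl_Iic] at h2
      exact eq_neg_of_add_eq_zero_left h2
    rw [h1, norm_neg]
    refine key _ measurableSet_Ioi fun t ht => ?_
    rw [Real.norm_of_nonneg hx, Real.norm_of_nonneg (hx.trans (le_of_lt ht))]
    exact le_of_lt ht

/-- Every Lizorkin function on the line has a primitive in the same space. -/
theorem exists_dLine_eq (ψ : LizorkinLine) : ∃ χ : LizorkinLine, dLine χ = ψ := by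
  set f : ℝ → ℂ := fun x => ∫ t in Set.Iic x, ψ.1 t with hf
  have hder : ∀ x, HasDerivAt f (ψ.1 x) x := by
    intro x
    have hc : f = fun y => (∫ t in Set.Iic x, ψ.1 t) + ∫ t in x..y, ψ.1 t := by
      funext y
      rw [← intervalIntegral.integral_Iic_sub_Iic ψ.1.integrable.integrableOn
        ψ.1.integrable.integrableOn]
      ring
    rw [hc]
    exact (intervalIntegral.integral_hasDerivAt_right
      (ψ.1.continuous.intervalIntegrable _ _)
      (ψ.1.continuous.stronglyMeasurableAtFilter _ _) ψ.1.continuous.continuousAt).const_add _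
  have hderiv : deriv f = ψ.1 := funext fun x => (hder x).deriv
  have hsm : ContDiff ℝ ∞ f := by
    rw [contDiff_infty_iff_deriv]
    exact ⟨fun x => (hder x).differentiableAt, by rw [hderiv]; exact ψ.1.smooth ⊤⟩
  have h0 : ∫ x, ψ.1 x = 0 := by simpa using moment_line ψ 0
  let χ : 𝓢(ℝ, ℂ) :=
    { toFun := f
      smooth' := hsm
      decay' := by
        intro k m
        rcases m with _ | m
        · exact ⟨_, fun x => by
            rw [norm_iteratedFDeriv_zero]; exact pow_mul_norm_integral_Iic_le ψ.1 h0 k x⟩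
        · obtain ⟨C, hC⟩ := ψ.1.decay' k m
          refine ⟨C, fun x => le_trans (le_of_eq ?_) (hC x)⟩
          congr 1
          rw [norm_iteratedFDeriv_eq_norm_iteratedDeriv, norm_iteratedFDeriv_eq_norm_iteratedDeriv,
            iteratedDeriv_succ', hderiv]
          rfl }
  -- The moment of order m of the primitive is a nonzero multiple of the moment of order m + 1 of ψ.
  have hχ : χ ∈ LizorkinLine := by
    intro m
    have h := integral_pow_mul_of_hasDerivAt (m + 1) χ ψ.1 hder
    rw [moment_line ψ] at h
    have h2 : (-((m + 1 : ℕ) : ℂ)) ≠ 0 := neg_ne_zero.mpr (Nat.cast_ne_zero.mpr m.succ_ne_zero)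
    simpa using (mul_eq_zero.mp h.symm).resolve_left h2
  refine ⟨⟨χ, hχ⟩, Subtype.ext (DFunLike.ext _ _ fun x => ?_)⟩
  exact (hder x).deriv

/-! ### Operations on the Lizorkin space of `ℝⁿ` -/

section lizorkin

variable {n : ℕ}

/-- The `k`-th vector of the standard basis. -/
def basisVec (k : Fin n) : E n := EuclideanSpace.single k 1

/-- The `k`-th coordinate, as a continuous linear map with complex values. -/
def coordCLM (k : Fin n) : E n →L[ℝ] ℂ := Complex.ofRealCLM ∘L EuclideanSpace.proj k

@[simp] theorem coordCLM_apply (k : Fin n) (x : E n) : coordCLM k x = ((x k : ℝ) : ℂ) := rfl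

theorem sum_basisVec (x : E n) : ∑ k, x k • basisVec k = x := by
  simpa [basisVec] using (EuclideanSpace.basisFun (Fin n) ℝ).sum_repr x

theorem clm_eq_sum {F : Type*} [NormedAddCommGroup F] [NormedSpace ℝ F] (L : E n →L[ℝ] F)
    (x : E n) : L x = ∑ k, x k • L (basisVec k) := by
  conv_lhs => rw [← sum_basisVec x]
  simp

theorem inner_basisVec (x : E n) (k : Fin n) : inner ℝ x (basisVec k) = x k := by
  simp [basisVec, EuclideanSpace.inner_single_right]

theorem inner_eq_sum (x y : E n) : inner ℝ x y = ∑ k, x k * y k := by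
  simp [PiLp.inner_apply, mul_comm]

theorem hasTemperateGrowth_coord (k : Fin n) :
    Function.HasTemperateGrowth (fun x : E n => ((x k : ℝ) : ℂ)) :=
  (coordCLM k).hasTemperateGrowth

/-! ### Monomials: multiplication by a coordinate and integration by parts -/

theorem monomial_update_succ (m : Fin n → ℕ) (k : Fin n) (x : E n) :
    monomial (Function.update m k (m k + 1)) x = monomial m x * ((x k : ℝ) : ℂ) := by
  unfold monomial
  rw [← Finset.mul_prod_erase _ _ (Finset.mem_univ k),
    ← Finset.mul_prod_erase Finset.univ (fun i => ((x i : ℝ) : ℂ) ^ m i) (Finset.mem_univ k)]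
  have : ∀ i ∈ Finset.univ.erase k, ((x i : ℝ) : ℂ) ^ Function.update m k (m k + 1) i =
      ((x i : ℝ) : ℂ) ^ m i := by
    intro i hi
    rw [Function.update_of_ne (Finset.ne_of_mem_erase hi)]
  rw [Finset.prod_congr rfl this, Function.update_self]
  ring

open scoped Classical in
theorem hasFDerivAt_monomial (m : Fin n → ℕ) (x : E n) :
    HasFDerivAt (monomial m) (∑ i, (∏ j ∈ Finset.univ.erase i, ((x j : ℝ) : ℂ) ^ m j) •
      ((m i : ℂ) * ((x i : ℝ) : ℂ) ^ (m i - 1)) • coordCLM i) x := by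
  unfold monomial
  refine HasFDerivAt.finsetProd fun i _ => ?_
  simpa using ((coordCLM i).hasFDerivAt (x := x)).pow (m i)

/-- The truncated exponent `m k - 1` is harmless at `m k = 0`, where the coefficient vanishes. -/
theorem fderiv_monomial_basisVec (m : Fin n → ℕ) (k : Fin n) (x : E n) :
    fderiv ℝ (monomial m) x (basisVec k) =
      m k * monomial (Function.update m k (m k - 1)) x := by
  classical
  rw [(hasFDerivAt_monomial m x).fderiv]
  simp only [FunLike.coe_sum, Finset.sum_apply, FunLike.coe_smul,
    Pi.smul_apply, coordCLM_apply, smul_eq_mul]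
  rw [Finset.sum_eq_single k]
  · unfold monomial
    rw [← Finset.mul_prod_erase _ _ (Finset.mem_univ k)]
    have : ∀ i ∈ Finset.univ.erase k, ((x i : ℝ) : ℂ) ^ Function.update m k (m k - 1) i =
        ((x i : ℝ) : ℂ) ^ m i := by
      intro i hi
      rw [Function.update_of_ne (Finset.ne_of_mem_erase hi)]
    rw [Finset.prod_congr rfl this, Function.update_self]
    simp [basisVec]
    ring
  · intro i _ hi
    simp [basisVec, hi]
  · simp

theorem differentiable_monomial (m : Fin n → ℕ) : Differentiable ℝ (monomial m) :=
  fun x => (hasFDerivAt_monomial m x).differentiableAt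

/-- Integration by parts against a monomial. -/
theorem integral_monomial_mul_lineDeriv (m : Fin n → ℕ) (k : Fin n) (φ : 𝓢(E n, ℂ)) :
    ∫ x, monomial m x * LineDeriv.lineDerivOp (basisVec k) φ x =
      -(m k : ℂ) * ∫ x, monomial (Function.update m k (m k - 1)) x * φ x := by
  have h := integral_mul_fderiv_eq_neg_fderiv_mul_of_integrable (μ := (volume : Measure (E n)))
    (f := monomial m) (g := φ) (v := basisVec k) ?_ ?_ (integrable_monomial_mul m φ)
    (fun x _ => differentiable_monomial m x) (fun x _ => φ.differentiableAt)
  · simp only [fderiv_monomial_basisVec, mul_assoc] at h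
    rw [integral_const_mul, ← neg_mul] at h
    rw [← h]
    rfl
  · simp only [fderiv_monomial_basisVec, mul_assoc]
    exact (integrable_monomial_mul _ φ).const_mul _
  · exact integrable_monomial_mul m (LineDeriv.lineDerivOp (basisVec k) φ)

theorem moment (φ : Lizorkin n) (m : Fin n → ℕ) : ∫ x, monomial m x * φ.1 x = 0 := φ.2 m

/-- Multiplication by the `k`-th coordinate. -/
def mulCoord (k : Fin n) : Lizorkin n →L[ℂ] Lizorkin n :=
  ((SchwartzMap.smulLeftCLM ℂ (fun x : E n => ((x k : ℝ) : ℂ))).comp (Lizorkin n).subtypeL).codRestrict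
    (Lizorkin n) fun φ m => by
      rw [← moment φ (Function.update m k (m k + 1))]
      refine integral_congr_ae (.of_forall fun x => ?_)
      simp only [monomial_update_succ, ContinuousLinearMap.comp_apply, Submodule.subtypeL_apply,
        SchwartzMap.smulLeftCLM_apply_apply (hasTemperateGrowth_coord k), smul_eq_mul]
      ring

@[simp] theorem mulCoord_apply (k : Fin n) (φ : Lizorkin n) (x : E n) :
    (mulCoord k φ).1 x = (x k : ℝ) * φ.1 x :=
  SchwartzMap.smulLeftCLM_apply_apply (hasTemperateGrowth_coord k) _ _

/-- The partial derivative in the direction of the `k`-th coordinate. -/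
def partialDeriv (k : Fin n) : Lizorkin n →L[ℂ] Lizorkin n :=
  ((LineDeriv.lineDerivOpCLM ℂ 𝓢(E n, ℂ) (basisVec k)).comp (Lizorkin n).subtypeL).codRestrict
    (Lizorkin n) fun φ m => by
      have h := integral_monomial_mul_lineDeriv m k φ.1
      rw [moment φ, mul_zero] at h
      exact h

end lizorkin

/-! ### The Laplace-Beltrami operator in terms of extensions -/

section laplaceBeltrami

variable {n : ℕ}

theorem hasFDerivAt_norm_inv {v : E n} (hv : v ≠ 0) :
    HasFDerivAt (fun v : E n => ‖v‖⁻¹) (-(‖v‖⁻¹ ^ 3) • innerSL ℝ v) v := by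
  have hn : ‖v‖ ≠ 0 := norm_ne_zero_iff.mpr hv
  have h1 : HasFDerivAt (fun v : E n => ‖v‖ ^ 2) (2 • innerSL ℝ v) v :=
    (hasStrictFDerivAt_norm_sq v).hasFDerivAt
  have h2 := h1.sqrt (pow_ne_zero 2 hn)
  simp only [Real.sqrt_sq (norm_nonneg _)] at h2
  replace h2 := (hasDerivAt_inv hn).comp_hasFDerivAt v h2
  have h3 : -(‖v‖ ^ 2)⁻¹ • (1 / (2 * ‖v‖)) • 2 • innerSL ℝ v = -(‖v‖⁻¹ ^ 3) • innerSL ℝ v := by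
    ext x
    simp
    field_simp
  rw [h3] at h2
  exact h2

theorem hasFDerivAt_normalize {v : E n} (hv : v ≠ 0) :
    HasFDerivAt (fun v : E n => ‖v‖⁻¹ • v)
      (‖v‖⁻¹ • ContinuousLinearMap.id ℝ (E n) + (-(‖v‖⁻¹ ^ 3) • innerSL ℝ v).smulRight v) v :=
  (hasFDerivAt_norm_inv hv).fun_smul (hasFDerivAt_id v)

theorem laplacian_eq_sum_basisVec (g : E n → ℂ) (u : E n) :
    Laplacian.laplacian g u = ∑ k, fderiv ℝ (fderiv ℝ g) u (basisVec k) (basisVec k) := by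
  rw [InnerProductSpace.laplacian_eq_iteratedFDeriv_orthonormalBasis g
    (EuclideanSpace.basisFun (Fin n) ℝ)]
  simp [iteratedFDeriv_two_apply, basisVec]

/-- Second-order chain rule for ρ(v) = v/|v| at a unit vector: Dρ(u)e is the tangential part of e,
and the argument of the first-order term is D²ρ(u)(e, e). -/
theorem fderiv_fderiv_comp_normalize {g : E n → ℂ} {u : E n} (hu : ‖u‖ = 1)
    (hg : ContDiffAt ℝ 2 g u) (e : E n) :
    fderiv ℝ (fderiv ℝ fun v : E n => g (‖v‖⁻¹ • v)) u e e =
      fderiv ℝ (fderiv ℝ g) u (e - inner ℝ u e • u) (e - inner ℝ u e • u) +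
        fderiv ℝ g u (-(2 * inner ℝ u e) • e + (3 * inner ℝ u e ^ 2 - ‖e‖ ^ 2) • u) := by
  have hu0 : u ≠ 0 := by rintro rfl; simp at hu
  have hρ0 : ‖u‖⁻¹ • u = u := by simp [hu]
  have hρ := hasFDerivAt_normalize hu0
  have hρc : ContinuousAt (fun v : E n => ‖v‖⁻¹ • v) u := hρ.continuousAt
  have hgd : ∀ᶠ v in nhds u, DifferentiableAt ℝ g v := by
    filter_upwards [hg.eventually (by simp)] with v hv using hv.differentiableAt (by simp)
  have hgd' : ∀ᶠ v in nhds u, DifferentiableAt ℝ g (‖v‖⁻¹ • v) := by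
    refine hρc.eventually (p := fun v => DifferentiableAt ℝ g v) ?_
    simpa only [hρ0] using hgd
  -- This is Dρ(v)e, so a second differentiation in v yields both terms of the chain rule.
  set w : E n → E n := fun v => ‖v‖⁻¹ • e + (-(‖v‖⁻¹ ^ 3) * inner ℝ v e) • v with hw
  have hev : (fun v => fderiv ℝ (fun v : E n => g (‖v‖⁻¹ • v)) v e) =ᶠ[nhds u]
      fun v => fderiv ℝ g (‖v‖⁻¹ • v) (w v) := by
    filter_upwards [hgd', isOpen_ne.mem_nhds hu0] with v hv hv0
    have h := HasFDerivAt.comp (f := fun v : E n => ‖v‖⁻¹ • v) v hv.hasFDerivAt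
      (hasFDerivAt_normalize hv0)
    simp only [Function.comp_def] at h
    rw [h.fderiv]
    simp [hw]
  have hF : ContDiffAt ℝ 2 (fun v : E n => g (‖v‖⁻¹ • v)) u := by
    refine ContDiffAt.comp u (by rwa [hρ0]) ?_
    exact ((contDiffAt_norm ℝ hu0).inv (norm_ne_zero_iff.mpr hu0)).smul contDiffAt_id
  have hdF : DifferentiableAt ℝ (fderiv ℝ fun v : E n => g (‖v‖⁻¹ • v)) u :=
    (hF.fderiv_right (m := 1) (by norm_num)).differentiableAt (by simp)
  have hdg : DifferentiableAt ℝ (fderiv ℝ g) u :=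
    (hg.fderiv_right (m := 1) (by norm_num)).differentiableAt (by simp)
  have h1 : fderiv ℝ (fderiv ℝ fun v : E n => g (‖v‖⁻¹ • v)) u e e =
      fderiv ℝ (fun v => fderiv ℝ (fun v : E n => g (‖v‖⁻¹ • v)) v e) u e := by
    rw [(hdF.hasFDerivAt.clm_apply (hasFDerivAt_const e u)).fderiv]
    simp
  rw [h1, hev.fderiv_eq]
  have hwd : HasFDerivAt w ((-(‖u‖⁻¹ ^ 3) • innerSL ℝ u).smulRight e +
      ((-(‖u‖⁻¹ ^ 3) * inner ℝ u e) • ContinuousLinearMap.id ℝ (E n) +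
        (-(‖u‖⁻¹ ^ 3) • innerSL ℝ e +
          inner ℝ u e • (-((3 : ℝ) * ‖u‖⁻¹ ^ 2) • (-(‖u‖⁻¹ ^ 3) • innerSL ℝ u))).smulRight u)) u := by
    have hA := hasFDerivAt_norm_inv hu0
    have hI : HasFDerivAt (fun v : E n => (inner ℝ v e : ℝ)) (innerSL ℝ e) u := by
      simpa [real_inner_comm] using (innerSL ℝ e).hasFDerivAt (x := u)
    have hB : HasFDerivAt (fun v : E n => -(‖v‖⁻¹ ^ 3))
        (-((3 : ℝ) * ‖u‖⁻¹ ^ 2) • (-(‖u‖⁻¹ ^ 3) • innerSL ℝ u)) u := by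
      have h3 := ((hasDerivAt_pow 3 ‖u‖⁻¹).fun_neg).comp_hasFDerivAt u hA
      simpa [Function.comp_def] using h3
    exact (hA.smul_const e).add ((hB.fun_mul hI).fun_smul (hasFDerivAt_id u))
  have h2 : HasFDerivAt (fun v : E n => fderiv ℝ g (‖v‖⁻¹ • v)) _ u :=
    HasFDerivAt.comp u (by rw [hρ0]; exact hdg.hasFDerivAt) hρ
  rw [(h2.clm_apply hwd).fderiv]
  have hwu : w u = e - inner ℝ u e • u := by
    simp [hw, hu, sub_eq_add_neg]
  have hee : inner ℝ e e = ‖e‖ ^ 2 := real_inner_self_eq_norm_sq e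
  simp only [add_apply, ContinuousLinearMap.comp_apply,
    ContinuousLinearMap.flip_apply, hwu, hρ0]
  rw [add_comm]
  congr 1
  · simp [hu, sub_eq_add_neg]
  · congr 1
    simp [hu]
    module

/-- The classical splitting of the Euclidean Laplacian on the unit sphere into the spherical, the
radial second order and the (n − 1)-fold radial first order parts. It follows by summing the
previous formula over an orthonormal basis with ∑ u_k² = 1. -/
theorem laplacian_comp_normalize {g : E n → ℂ} {u : E n} (hu : ‖u‖ = 1)
    (hg : ContDiffAt ℝ 2 g u) :
    Laplacian.laplacian (fun v : E n => g (‖v‖⁻¹ • v)) u =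
      Laplacian.laplacian g u - fderiv ℝ (fderiv ℝ g) u u u - (n - 1 : ℂ) * fderiv ℝ g u u := by
  have hsq : ∑ k, u k ^ 2 = 1 := by
    rw [← EuclideanSpace.real_norm_sq_eq, hu, one_pow]
  simp only [laplacian_eq_sum_basisVec, fderiv_fderiv_comp_normalize hu hg, inner_basisVec]
  set B := fderiv ℝ (fderiv ℝ g) u
  set L := fderiv ℝ g u
  have hB1 : ∑ k, (u k : ℂ) * B (basisVec k) u = B u u := by
    conv_rhs => rw [clm_eq_sum B u]
    simp
  have hB2 : ∑ k, (u k : ℂ) * B u (basisVec k) = B u u := by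
    conv_rhs => rw [clm_eq_sum (B u) u]
    simp
  have hL : ∑ k, (u k : ℂ) * L (basisVec k) = L u := by
    conv_rhs => rw [clm_eq_sum L u]
    simp
  have hsq' : ∑ k, (u k : ℂ) ^ 2 = 1 := by exact_mod_cast hsq
  have hnorm : ∀ k : Fin n, ‖basisVec k‖ = 1 := fun k => by simp [basisVec]
  calc ∑ k, (B (basisVec k - u k • u) (basisVec k - u k • u) +
          L (-(2 * u k) • basisVec k + (3 * u k ^ 2 - ‖basisVec k‖ ^ 2) • u))
      = ∑ k, (B (basisVec k) (basisVec k) - (u k : ℂ) * B (basisVec k) u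
          - (u k : ℂ) * B u (basisVec k) + (u k : ℂ) ^ 2 * B u u
          - 2 * ((u k : ℂ) * L (basisVec k)) + 3 * ((u k : ℂ) ^ 2 * L u) - L u) := by
        refine Finset.sum_congr rfl fun k _ => ?_
        simp [hnorm]
        ring
    _ = _ := by
        simp only [Finset.sum_sub_distrib, Finset.sum_add_distrib, ← Finset.mul_sum,
          ← Finset.sum_mul, hB1, hB2, hL, hsq']
        simp
        ring

/-- Allows Δ_u to be computed from any smooth function g on ℝⁿ with the right values on the sphere,
homogeneous or not; the radial corrections remove the dependence on the choice of g. -/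
theorem lapU_eq_of_forall {F : Y n → ℂ} {g : E n → ℂ} (y : Y n)
    (h : ∀ u : Sph n, F (u, y.2) = g u) (hg : ContDiffAt ℝ 2 g (y.1 : E n)) :
    lapU F y = Laplacian.laplacian g (y.1 : E n) - fderiv ℝ (fderiv ℝ g) (y.1 : E n) y.1 y.1
      - (n - 1 : ℂ) * fderiv ℝ g (y.1 : E n) y.1 := by
  rw [← laplacian_comp_normalize (mem_sphere_zero_iff_norm.mp y.1.2) hg]
  refine (InnerProductSpace.laplacian_congr_nhds ?_).eq_of_nhds
  filter_upwards [isOpen_ne.mem_nhds (coeY_mem y).1] with v hv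
  have hv' : (v, y.2.1, (y.2.2 : ℝ)) ∈ dom n := ⟨hv, y.2.2.2⟩
  rw [ext_of_mem F hv']
  exact h _

theorem dA_eq_of_forall {F : Y n → ℂ} {g : ℝ → ℂ} {c : ℂ} (y : Y n)
    (h : ∀ a : Set.Ioi (0 : ℝ), F (y.1, y.2.1, a) = g a) (hg : HasDerivAt g c y.2.2) :
    dA F y = c := by
  unfold dA
  refine Eq.trans (Filter.EventuallyEq.deriv_eq ?_) hg.deriv
  filter_upwards [isOpen_Ioi.mem_nhds y.2.2.2] with t ht
  have := ext_coeY F (y.1, y.2.1, ⟨t, ht⟩)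
  rw [← h ⟨t, ht⟩, ← this]
  rfl

end laplaceBeltrami

/-! ### Families of functions dominated by a continuous seminorm -/

section dominated

variable {V ι : Type*} [AddCommGroup V] [Module ℂ V] [TopologicalSpace V]

/-- The family `T v`, `v : V`, of functions is bounded uniformly by a continuous seminorm of `v`. -/
def Dominated (T : V → ι → ℂ) : Prop :=
  ∃ q : Seminorm ℂ V, Continuous q ∧ ∀ v i, ‖T v i‖ ≤ q v

variable {T S : V → ι → ℂ}

theorem Dominated.mono (hS : Dominated S) (h : ∀ v i, ‖T v i‖ ≤ ‖S v i‖) : Dominated T := by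
  obtain ⟨q, hq, hb⟩ := hS
  exact ⟨q, hq, fun v i => (h v i).trans (hb v i)⟩

theorem Dominated.add [IsTopologicalAddGroup V] (hT : Dominated T) (hS : Dominated S) :
    Dominated (fun v i => T v i + S v i) := by
  obtain ⟨q, hq, hb⟩ := hT
  obtain ⟨p, hp, hc⟩ := hS
  exact ⟨q + p, hq.add hp, fun v i => (norm_add_le _ _).trans (add_le_add (hb v i) (hc v i))⟩

theorem Dominated.bounded_mul {c : ι → ℂ} {C : ℝ} (hT : Dominated T)
    (hc : ∀ i, ‖c i‖ ≤ C) : Dominated (fun v i => c i * T v i) := by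
  obtain ⟨q, hq, hb⟩ := hT
  refine ⟨C.toNNReal • q, hq.const_smul C.toNNReal, fun v i => ?_⟩
  rw [norm_mul]
  exact mul_le_mul ((hc i).trans (Real.le_coe_toNNReal C)) (hb v i) (norm_nonneg _) (by positivity)

theorem Dominated.const_mul (c : ℂ) (hT : Dominated T) : Dominated (fun v i => c * T v i) :=
  hT.bounded_mul (c := fun _ => c) fun _ => le_rfl

theorem Dominated.neg (hT : Dominated T) : Dominated (fun v i => -T v i) :=
  hT.mono fun v i => by rw [norm_neg]

theorem Dominated.sub [IsTopologicalAddGroup V] (hT : Dominated T) (hS : Dominated S) :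
    Dominated (fun v i => T v i - S v i) := by
  simpa [sub_eq_add_neg] using hT.add hS.neg

theorem Dominated.zero : Dominated (fun (_ : V) (_ : ι) => (0 : ℂ)) :=
  ⟨0, continuous_const, fun _ _ => by simp⟩

theorem Dominated.sum [IsTopologicalAddGroup V] {κ : Type*} (s : Finset κ) {T : κ → V → ι → ℂ}
    (h : ∀ k ∈ s, Dominated (T k)) : Dominated (fun v i => ∑ k ∈ s, T k v i) := by
  classical
  induction s using Finset.induction_on with
  | empty => simpa using Dominated.zero
  | insert k s hk ih =>
    simp only [Finset.sum_insert hk]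
    exact (h k (by simp)).add (ih fun j hj => h j (by simp [hj]))

theorem Dominated.comp {W : Type*} [AddCommGroup W] [Module ℂ W] [TopologicalSpace W]
    (hT : Dominated T) (L : W →L[ℂ] V) : Dominated (fun w i => T (L w) i) := by
  obtain ⟨q, hq, hb⟩ := hT
  exact ⟨q.comp L.toLinearMap, hq.comp L.continuous, fun w i => hb _ _⟩

theorem Dominated.reindex {κ : Type*} (hT : Dominated T) (f : κ → ι) :
    Dominated (fun v k => T v (f k)) := by
  obtain ⟨q, hq, hb⟩ := hT
  exact ⟨q, hq, fun v k => hb _ _⟩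

/-- Each inductive estimate below passes from φ to the finitely many x_j φ or ∂_j φ; this collects
their seminorms into one. -/
theorem exists_seminorm_eq_sum {κ : Type*} [Fintype κ] {q : Seminorm ℂ V} (hq : Continuous q)
    (L : κ → V →L[ℂ] V) :
    ∃ Q : Seminorm ℂ V, Continuous Q ∧ ∀ v, Q v = ∑ j, q (L j v) := by
  have h : ⇑(∑ j, q.comp (L j).toLinearMap) = fun v => ∑ j, q (L j v) := by
    rw [FunLike.coe_sum]
    ext v
    simp
  refine ⟨∑ j, q.comp (L j).toLinearMap, ?_, fun v => congrFun h v⟩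
  rw [h]
  exact continuous_finsetSum _ fun j _ => hq.comp (L j).continuous

end dominated

/-! ### Integrals against plane waves -/

section wave

variable {n : ℕ}

/-- The integral of `φ` against the plane wave `x ↦ ψ (x · w - s)`. -/
def wave (φ : Lizorkin n) (ψ : LizorkinLine) (w : E n) (s : ℝ) : ℂ :=
  ∫ x, φ.1 x * ψ.1 (inner ℝ x w - s)

theorem exists_norm_le_line (ψ : 𝓢(ℝ, ℂ)) : ∃ C, 0 ≤ C ∧ ∀ t, ‖ψ t‖ ≤ C :=
  ⟨_, apply_nonneg _ _, SchwartzMap.norm_le_seminorm ℂ ψ⟩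

theorem integrable_mul_wave (φ : 𝓢(E n, ℂ)) (ψ : 𝓢(ℝ, ℂ)) (w : E n) (s : ℝ) :
    Integrable (fun x => φ x * ψ (inner ℝ x w - s)) := by
  obtain ⟨C, -, hC⟩ := exists_norm_le_line ψ
  exact φ.integrable.mul_bdd
    (Continuous.aestronglyMeasurable (by fun_prop)) (.of_forall fun x => hC _)

/-- The bound is sup |ψ| times the L¹ norm of φ, and the L¹ norm is a continuous seminorm through
the continuous embedding into L¹. -/
theorem dominated_wave (ψ : LizorkinLine) :
    Dominated (fun (φ : Lizorkin n) (p : E n × ℝ) => wave φ ψ p.1 p.2) := by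
  obtain ⟨C, hC0, hC⟩ := exists_norm_le_line ψ.1
  let T : Lizorkin n →L[ℂ] Lp ℂ 1 (volume : Measure (E n)) :=
    (SchwartzMap.toLpCLM ℂ ℂ 1 volume).comp (Lizorkin n).subtypeL
  refine ⟨C.toNNReal • (normSeminorm ℂ _).comp T.toLinearMap,
    (continuous_norm.comp T.continuous).const_smul C.toNNReal, fun φ p => ?_⟩
  have h1 : ‖T φ‖ = ∫ x, ‖φ.1 x‖ := SchwartzMap.norm_toLp_one
  change _ ≤ (C.toNNReal : ℝ) * ‖T φ‖
  rw [h1, Real.coe_toNNReal C hC0, ← integral_const_mul]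
  refine norm_integral_le_of_norm_le (φ.1.integrable.norm.const_mul C) (.of_forall fun x => ?_)
  rw [norm_mul, mul_comm]
  gcongr
  exact hC _

theorem hasFDerivAt_comp_inner_sub (ψ : LizorkinLine) (x : E n) (p : E n × ℝ) :
    HasFDerivAt (fun p : E n × ℝ => ψ.1 (inner ℝ x p.1 - p.2))
      ((innerSL ℝ x ∘L ContinuousLinearMap.fst ℝ (E n) ℝ -
        ContinuousLinearMap.snd ℝ (E n) ℝ).smulRight ((dLine ψ).1 (inner ℝ x p.1 - p.2))) p := by
  have h1 : HasFDerivAt (fun p : E n × ℝ => inner ℝ x p.1 - p.2)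
      (innerSL ℝ x ∘L ContinuousLinearMap.fst ℝ (E n) ℝ -
        ContinuousLinearMap.snd ℝ (E n) ℝ) p :=
    (innerSL ℝ x ∘L ContinuousLinearMap.fst ℝ (E n) ℝ -
        ContinuousLinearMap.snd ℝ (E n) ℝ).hasFDerivAt
  refine (HasFDerivAt.comp (f := fun p : E n × ℝ => inner ℝ x p.1 - p.2) p
    (hasDerivAt_line ψ (inner ℝ x p.1 - p.2)).hasFDerivAt h1).congr_fderiv ?_
  ext v <;> simp

/-- The derivative of `p ↦ φ x * ψ (x · p.1 - p.2)`. -/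
def waveIntegrand (φ : Lizorkin n) (ψ : LizorkinLine) (p : E n × ℝ) (x : E n) :
    E n × ℝ →L[ℝ] ℂ :=
  (φ.1 x * (dLine ψ).1 (inner ℝ x p.1 - p.2)) •
    (Complex.ofRealCLM ∘L (innerSL ℝ x ∘L ContinuousLinearMap.fst ℝ (E n) ℝ -
      ContinuousLinearMap.snd ℝ (E n) ℝ))

theorem waveIntegrand_apply (φ : Lizorkin n) (ψ : LizorkinLine) (p v : E n × ℝ) (x : E n) :
    waveIntegrand φ ψ p x v = ∑ k, (v.1 k : ℂ) *
      ((mulCoord k φ).1 x * (dLine ψ).1 (inner ℝ x p.1 - p.2)) -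
        (v.2 : ℂ) * (φ.1 x * (dLine ψ).1 (inner ℝ x p.1 - p.2)) := by
  have h : waveIntegrand φ ψ p x v = (φ.1 x * (dLine ψ).1 (inner ℝ x p.1 - p.2)) *
    ((inner ℝ x v.1 - v.2 : ℝ) : ℂ) := rfl
  rw [h, inner_eq_sum x v.1]
  simp only [mulCoord_apply]
  push_cast
  rw [mul_sub, Finset.mul_sum]
  congr 1
  · exact Finset.sum_congr rfl fun k _ => by ring
  · ring

theorem hasFDerivAt_mul_comp_inner_sub (φ : Lizorkin n) (ψ : LizorkinLine) (x : E n)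
    (p : E n × ℝ) :
    HasFDerivAt (fun p : E n × ℝ => φ.1 x * ψ.1 (inner ℝ x p.1 - p.2)) (waveIntegrand φ ψ p x) p := by
  refine ((hasFDerivAt_comp_inner_sub ψ x p).const_mul (φ.1 x)).congr_fderiv ?_
  refine ContinuousLinearMap.ext fun v => ?_
  simp only [waveIntegrand, FunLike.coe_smul, Pi.smul_apply, ContinuousLinearMap.smulRight_apply,
    smul_eq_mul, Complex.real_smul, ContinuousLinearMap.comp_apply, Complex.ofRealCLM_apply]
  ring

theorem continuous_waveIntegrand (φ : Lizorkin n) (ψ : LizorkinLine) (p : E n × ℝ) :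
    Continuous (waveIntegrand φ ψ p) := by
  unfold waveIntegrand
  fun_prop

theorem norm_waveIntegrand_le {C : ℝ} (φ : Lizorkin n) (ψ : LizorkinLine)
    (hC : ∀ t, ‖(dLine ψ).1 t‖ ≤ C) (p : E n × ℝ) (x : E n) :
    ‖waveIntegrand φ ψ p x‖ ≤ (‖x‖ ^ 1 * ‖φ.1 x‖ + ‖φ.1 x‖) * C := by
  have hC0 : 0 ≤ C := (norm_nonneg _).trans (hC 0)
  refine ContinuousLinearMap.opNorm_le_bound _ (by positivity) fun v => ?_
  have h : waveIntegrand φ ψ p x v = (φ.1 x * (dLine ψ).1 (inner ℝ x p.1 - p.2)) *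
    ((inner ℝ x v.1 - v.2 : ℝ) : ℂ) := rfl
  rw [h, norm_mul, norm_mul, Complex.norm_real]
  have h1 : ‖inner ℝ x v.1 - v.2‖ ≤ (‖x‖ + 1) * ‖v‖ := by
    refine (norm_sub_le _ _).trans ?_
    rw [add_mul, one_mul]
    exact add_le_add ((norm_inner_le_norm x v.1).trans (by gcongr; exact norm_fst_le v))
      (norm_snd_le v)
  calc ‖φ.1 x‖ * ‖(dLine ψ).1 (inner ℝ x p.1 - p.2)‖ * ‖inner ℝ x v.1 - v.2‖
      ≤ ‖φ.1 x‖ * C * ((‖x‖ + 1) * ‖v‖) := by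
        gcongr
        exact hC _
    _ = _ := by ring

/-- The total derivative of `wave φ ψ`. -/
def waveDeriv (φ : Lizorkin n) (ψ : LizorkinLine) (p : E n × ℝ) : E n × ℝ →L[ℝ] ℂ :=
  ∑ k, wave (mulCoord k φ) (dLine ψ) p.1 p.2 • (coordCLM k ∘L ContinuousLinearMap.fst ℝ (E n) ℝ) -
    wave φ (dLine ψ) p.1 p.2 • (Complex.ofRealCLM ∘L ContinuousLinearMap.snd ℝ (E n) ℝ)

theorem waveDeriv_apply (φ : Lizorkin n) (ψ : LizorkinLine) (p v : E n × ℝ) :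
    waveDeriv φ ψ p v = ∑ k, (v.1 k : ℂ) * wave (mulCoord k φ) (dLine ψ) p.1 p.2 -
      (v.2 : ℂ) * wave φ (dLine ψ) p.1 p.2 := by
  simp [waveDeriv, mul_comm]

theorem integrable_waveIntegrand (φ : Lizorkin n) (ψ : LizorkinLine) (p : E n × ℝ) :
    Integrable (waveIntegrand φ ψ p) := by
  obtain ⟨C, hC0, hC⟩ := exists_norm_le_line (dLine ψ).1
  exact (((φ.1.integrable_pow_mul volume 1).add φ.1.integrable.norm).mul_const C).mono'
    (continuous_waveIntegrand φ ψ p).aestronglyMeasurable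
    (.of_forall fun x => norm_waveIntegrand_le φ ψ hC p x)

theorem integral_waveIntegrand (φ : Lizorkin n) (ψ : LizorkinLine) (p : E n × ℝ) :
    ∫ x, waveIntegrand φ ψ p x = waveDeriv φ ψ p := by
  refine ContinuousLinearMap.ext fun v => ?_
  rw [ContinuousLinearMap.integral_apply (integrable_waveIntegrand φ ψ p), waveDeriv_apply]
  simp only [waveIntegrand_apply]
  rw [integral_sub (integrable_finsetSum _ fun k _ => (integrable_mul_wave _ _ _ _).const_mul _)
    ((integrable_mul_wave _ _ _ _).const_mul _), integral_finsetSum _ fun k _ =>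
      (integrable_mul_wave _ _ _ _).const_mul _]
  simp only [integral_const_mul, wave]

theorem hasFDerivAt_wave (φ : Lizorkin n) (ψ : LizorkinLine) (p : E n × ℝ) :
    HasFDerivAt (fun p : E n × ℝ => wave φ ψ p.1 p.2) (waveDeriv φ ψ p) p := by
  obtain ⟨C, hC0, hC⟩ := exists_norm_le_line (dLine ψ).1
  rw [← integral_waveIntegrand]
  exact hasFDerivAt_integral_of_dominated_of_fderiv_le (s := Set.univ) Filter.univ_mem
    (.of_forall fun p => (integrable_mul_wave φ.1 ψ.1 p.1 p.2).aestronglyMeasurable)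
    (integrable_mul_wave φ.1 ψ.1 p.1 p.2)
    (continuous_waveIntegrand φ ψ p).aestronglyMeasurable
    (.of_forall fun x p _ => norm_waveIntegrand_le φ ψ hC p x)
    (((φ.1.integrable_pow_mul volume 1).add φ.1.integrable.norm).mul_const C)
    (.of_forall fun x p _ => hasFDerivAt_mul_comp_inner_sub φ ψ x p)

theorem contDiff_wave (φ : Lizorkin n) (ψ : LizorkinLine) :
    ContDiff ℝ ∞ (fun p : E n × ℝ => wave φ ψ p.1 p.2) := by
  rw [contDiff_infty]
  intro m
  induction m generalizing φ ψ with
  | zero =>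
    exact contDiff_zero.mpr (continuous_iff_continuousAt.mpr fun p =>
      (hasFDerivAt_wave φ ψ p).continuousAt)
  | succ m ih =>
    refine contDiff_succ_iff_hasFDerivAt.mpr ⟨_, ?_, hasFDerivAt_wave φ ψ⟩
    unfold waveDeriv
    exact (ContDiff.sum fun k _ => (ih _ _).smul contDiff_const).sub ((ih _ _).smul contDiff_const)

/-- Under the integral x·w = t + s with t = x·w − s, the argument of ψ. This trades radial
derivatives for multiplication of ψ by its variable, and powers of s for powers of w. -/
theorem sum_mul_wave_mulCoord (φ : Lizorkin n) (ψ : LizorkinLine) (w : E n) (s : ℝ) :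
    ∑ k, (w k : ℂ) * wave (mulCoord k φ) ψ w s =
      wave φ (mulLine ψ) w s + s * wave φ ψ w s := by
  unfold wave
  simp only [← integral_const_mul]
  rw [← integral_finsetSum _ fun k _ => (integrable_mul_wave _ _ _ _).const_mul _,
    ← integral_add (integrable_mul_wave _ _ _ _) ((integrable_mul_wave _ _ _ _).const_mul _)]
  refine integral_congr_ae (.of_forall fun x => ?_)
  have h : ∑ k, (w k : ℂ) * (x k : ℂ) = ((inner ℝ x w : ℝ) : ℂ) := by
    rw [inner_eq_sum]; push_cast; exact Finset.sum_congr rfl fun k _ => by ring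
  simp only [mulCoord_apply, mulLine_apply, ← mul_assoc, ← Finset.sum_mul, h]
  push_cast
  ring

/-- The gradient of x ↦ χ(x·w − s) is w χ'(x·w − s), so integration by parts turns a factor w_k into
a derivative of φ. -/
theorem mul_wave_dLine (k : Fin n) (φ : Lizorkin n) (χ : LizorkinLine) (w : E n) (s : ℝ) :
    (w k : ℂ) * wave φ (dLine χ) w s = -wave (partialDeriv k φ) χ w s := by
  have hd : ∀ x : E n, HasFDerivAt (fun x : E n => χ.1 (inner ℝ x w - s))
      ((innerSL ℝ w).smulRight ((dLine χ).1 (inner ℝ x w - s))) x := fun x => by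
    have h1 : HasFDerivAt (fun x : E n => inner ℝ x w - s) (innerSL ℝ w) x := by
      simpa [real_inner_comm] using ((innerSL ℝ w).hasFDerivAt (x := x)).sub_const s
    refine (HasFDerivAt.comp (f := fun x : E n => inner ℝ x w - s) x
      (hasDerivAt_line χ (inner ℝ x w - s)).hasFDerivAt h1).congr_fderiv ?_
    ext v; simp
  have hd' : ∀ x : E n, fderiv ℝ (fun x : E n => χ.1 (inner ℝ x w - s)) x (basisVec k) =
      (w k : ℂ) * (dLine χ).1 (inner ℝ x w - s) := fun x => by
    rw [(hd x).fderiv]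
    simp [inner_basisVec]
  have h := integral_mul_fderiv_eq_neg_fderiv_mul_of_integrable (μ := (volume : Measure (E n)))
    (f := φ.1) (g := fun x : E n => χ.1 (inner ℝ x w - s)) (v := basisVec k)
    (integrable_mul_wave (partialDeriv k φ).1 χ.1 w s) ?_ (integrable_mul_wave φ.1 χ.1 w s)
    (fun x _ => φ.1.differentiableAt) (fun x _ => (hd x).differentiableAt)
  · simp only [hd'] at h
    unfold wave
    rw [← integral_const_mul]
    refine Eq.trans (integral_congr_ae (.of_forall fun x => ?_)) h
    ring
  · simp only [hd']
    convert (integrable_mul_wave φ.1 (dLine χ).1 w s).const_mul (w k : ℂ) using 2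
    ring

/-! ### Behaviour of plane wave integrals at frequency zero and at infinity -/

theorem wave_zero_left (φ : Lizorkin n) (ψ : LizorkinLine) (s : ℝ) : wave φ ψ 0 s = 0 := by
  have h := moment φ 0
  simp only [monomial, Pi.zero_apply, pow_zero, Finset.prod_const_one, one_mul] at h
  simp [wave, integral_mul_const, h]

theorem norm_le_sum_abs (w : E n) : ‖w‖ ≤ ∑ k, |w k| := by
  conv_lhs => rw [← sum_basisVec w]
  refine (norm_sum_le _ _).trans_eq (Finset.sum_congr rfl fun k _ => ?_)
  simp [norm_smul, basisVec]

/-- Plane wave integrals vanish to infinite order at frequency `0`. -/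
theorem exists_norm_wave_le (k : ℕ) (ψ : LizorkinLine) :
    ∃ q : Seminorm ℂ (Lizorkin n), Continuous q ∧
      ∀ φ w s, ‖wave φ ψ w s‖ ≤ q φ * ‖w‖ ^ k := by
  induction k generalizing ψ with
  | zero =>
    obtain ⟨q, hq, h⟩ := dominated_wave (n := n) ψ
    exact ⟨q, hq, fun φ w s => by simpa using h φ (w, s)⟩
  | succ k ih =>
    obtain ⟨q, hq, h⟩ := ih (dLine ψ)
    obtain ⟨Q, hQc, hQ⟩ := exists_seminorm_eq_sum hq mulCoord
    refine ⟨Q, hQc, fun φ w s => ?_⟩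
    -- The mean value inequality on the segment from 0, where the integral vanishes, to w. The
    -- derivative carries a factor w_j and an integral that is already O(|w|^k).
    have hder : ∀ t : ℝ, HasDerivAt (fun t : ℝ => wave φ ψ (t • w) s)
        (∑ j, (w j : ℂ) * wave (mulCoord j φ) (dLine ψ) (t • w) s) t := fun t => by
      have h1 : HasDerivAt (fun t : ℝ => (t • w, s)) (w, (0 : ℝ)) t := by
        have h0 := ((hasDerivAt_id t).smul_const w).prodMk (hasDerivAt_const t s)
        rwa [one_smul] at h0
      have h2 := (hasFDerivAt_wave φ ψ (t • w, s)).comp_hasDerivAt t h1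
      rw [waveDeriv_apply] at h2
      simpa [Function.comp_def] using h2
    have hb : ∀ t ∈ Set.Icc (0 : ℝ) 1,
        ‖∑ j, (w j : ℂ) * wave (mulCoord j φ) (dLine ψ) (t • w) s‖ ≤ Q φ * ‖w‖ ^ (k + 1) := by
      intro t ht
      rw [hQ, Finset.sum_mul]
      refine norm_sum_le_of_le _ fun j _ => ?_
      rw [norm_mul, Complex.norm_real, pow_succ]
      have h3 : ‖t • w‖ ≤ ‖w‖ := by
        rw [norm_smul, Real.norm_of_nonneg ht.1]
        exact mul_le_of_le_one_left (norm_nonneg _) ht.2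
      calc ‖w j‖ * ‖wave (mulCoord j φ) (dLine ψ) (t • w) s‖
          ≤ ‖w‖ * (q (mulCoord j φ) * ‖w‖ ^ k) := by
            gcongr
            · exact PiLp.norm_apply_le w j
            · exact (h _ _ _).trans (by gcongr)
        _ = _ := by ring
    have h4 := Convex.norm_image_sub_le_of_norm_hasDerivWithin_le (x := (0 : ℝ)) (y := 1)
      (fun t _ => (hder t).hasDerivWithinAt) hb (convex_Icc 0 1) (by simp) (by simp)
    simpa [wave_zero_left] using h4

/-- Since ψ is the derivative of a Lizorkin function, each power of |w| can be paid for by one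
integration by parts in x. -/
theorem dominated_norm_pow_mul_wave (k : ℕ) (ψ : LizorkinLine) :
    Dominated (fun (φ : Lizorkin n) (p : E n × ℝ) => ((‖p.1‖ ^ k : ℝ) : ℂ) * wave φ ψ p.1 p.2) := by
  induction k generalizing ψ with
  | zero => simpa using dominated_wave ψ
  | succ k ih =>
    obtain ⟨χ, rfl⟩ := exists_dLine_eq ψ
    obtain ⟨q, hq, hb⟩ := ih χ
    obtain ⟨Q, hQc, hQ⟩ := exists_seminorm_eq_sum hq partialDeriv
    refine ⟨Q, hQc, fun φ p => ?_⟩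
    rw [hQ, norm_mul, Complex.norm_real, Real.norm_of_nonneg (by positivity), pow_succ]
    calc ‖p.1‖ ^ k * ‖p.1‖ * ‖wave φ (dLine χ) p.1 p.2‖
        ≤ ‖p.1‖ ^ k * (∑ j, |p.1 j|) * ‖wave φ (dLine χ) p.1 p.2‖ := by
          gcongr; exact norm_le_sum_abs _
      _ = ∑ j, ‖((‖p.1‖ ^ k : ℝ) : ℂ) * wave (partialDeriv j φ) χ p.1 p.2‖ := by
          rw [Finset.mul_sum, Finset.sum_mul]
          refine Finset.sum_congr rfl fun j _ => ?_
          have h2 := congrArg norm (mul_wave_dLine j φ χ p.1 p.2)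
          rw [norm_neg, norm_mul, Complex.norm_real, Real.norm_eq_abs] at h2
          rw [norm_mul, ← h2, Complex.norm_real, Real.norm_of_nonneg (by positivity)]
          ring
      _ ≤ _ := Finset.sum_le_sum fun j _ => hb _ p

theorem dominated_norm_zpow_mul_wave (k : ℤ) (ψ : LizorkinLine) :
    Dominated (fun (φ : Lizorkin n) (p : E n × ℝ) => ((‖p.1‖ ^ k : ℝ) : ℂ) * wave φ ψ p.1 p.2) := by
  obtain ⟨k, rfl | rfl⟩ := k.eq_nat_or_neg
  · simpa using dominated_norm_pow_mul_wave k ψ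
  · obtain ⟨q, hq, h⟩ := exists_norm_wave_le (n := n) k ψ
    refine ⟨q, hq, fun φ p => ?_⟩
    rw [norm_mul, Complex.norm_real, Real.norm_of_nonneg (by positivity), zpow_neg, zpow_natCast]
    rcases eq_or_ne p.1 0 with h0 | h0
    · rw [h0, wave_zero_left]
      simp
    · rw [inv_mul_le_iff₀ (pow_pos (norm_pos_iff.mpr h0) k), mul_comm]
      exact h φ p.1 p.2

/-- Plane wave integrals decay rapidly in all the parameters. -/
theorem dominated_norm_zpow_mul_pow_mul_wave (k : ℤ) (r : ℕ) (ψ : LizorkinLine) :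
    Dominated (fun (φ : Lizorkin n) (p : E n × ℝ) =>
      ((‖p.1‖ ^ k * p.2 ^ r : ℝ) : ℂ) * wave φ ψ p.1 p.2) := by
  induction r generalizing k ψ with
  | zero => simpa using dominated_norm_zpow_mul_wave k ψ
  | succ r ih =>
    -- The factor s is replaced by s W(φ, ψ) = ∑ w_j W(x_j φ, ψ) − W(φ, tψ). In the sum, |w|^k w_j
    -- is written as |w|^(k+1) times the bounded quotient w_j/|w|; at w = 0 every integral vanishes.
    have h1 : Dominated (fun (φ : Lizorkin n) (p : E n × ℝ) =>
        (∑ j, ((p.1 j / ‖p.1‖ : ℝ) : ℂ) * (((‖p.1‖ ^ (k + 1) * p.2 ^ r : ℝ) : ℂ) *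
          wave (mulCoord j φ) ψ p.1 p.2)) -
        ((‖p.1‖ ^ k * p.2 ^ r : ℝ) : ℂ) * wave φ (mulLine ψ) p.1 p.2) := by
      refine (Dominated.sum _ fun j _ => ?_).sub (ih k (mulLine ψ))
      refine ((ih (k + 1) ψ).comp (mulCoord j)).bounded_mul (C := 1) fun p => ?_
      rw [Complex.norm_real, norm_div, norm_norm]
      exact div_le_one_of_le₀ (PiLp.norm_apply_le p.1 j) (norm_nonneg _)
    refine h1.mono fun φ p => le_of_eq (congrArg norm ?_)
    rcases eq_or_ne p.1 0 with h0 | h0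
    · simp [h0, wave_zero_left]
    · have hn : (‖p.1‖ : ℂ) ≠ 0 := by exact_mod_cast norm_ne_zero_iff.mpr h0
      have h2 : ∀ j, ((p.1 j / ‖p.1‖ : ℝ) : ℂ) * (((‖p.1‖ ^ (k + 1) * p.2 ^ r : ℝ) : ℂ) *
          wave (mulCoord j φ) ψ p.1 p.2) =
          ((‖p.1‖ ^ k * p.2 ^ r : ℝ) : ℂ) * ((p.1 j : ℂ) * wave (mulCoord j φ) ψ p.1 p.2) := by
        intro j
        push_cast
        rw [zpow_add_one₀ hn]
        field_simp
      simp only [h2, ← Finset.mul_sum, sum_mul_wave_mulCoord]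
      push_cast
      ring

end wave

/-! ### Families of functions on `Y n` given by ridgelet transforms -/

section ridge

variable {n : ℕ}

/-- The function `a ^ (-i) b ^ j ∫ φ(x) ψ((x · v - b) / a) dx` of `(v, b, a)`. -/
def ridgeExt (i j : ℕ) (ψ : LizorkinLine) (φ : Lizorkin n) (p : E n × ℝ × ℝ) : ℂ :=
  ((p.2.2⁻¹ : ℝ) : ℂ) ^ i * (p.2.1 : ℂ) ^ j * wave φ ψ (p.2.2⁻¹ • p.1) (p.2.2⁻¹ * p.2.1)

theorem contDiffOn_ridgeExt (i j : ℕ) (ψ : LizorkinLine) (φ : Lizorkin n) :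
    ContDiffOn ℝ ∞ (ridgeExt i j ψ φ) (dom n) := by
  have hα : ContDiffOn ℝ ∞ (fun p : E n × ℝ × ℝ => p.2.2⁻¹) (dom n) :=
    ContDiffOn.inv (by fun_prop) fun p hp => ne_of_gt hp.2
  have hb : ContDiffOn ℝ ∞ (fun p : E n × ℝ × ℝ => p.2.1) (dom n) := by fun_prop
  have h1 : ContDiffOn ℝ ∞ (fun p : E n × ℝ × ℝ => (p.2.2⁻¹ • p.1, p.2.2⁻¹ * p.2.1)) (dom n) :=
    (hα.smul contDiffOn_fst).prodMk (hα.mul hb)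
  have hw := (contDiff_wave φ ψ).comp_contDiffOn h1
  exact (((Complex.ofRealCLM.contDiff.comp_contDiffOn hα).pow i).mul
    ((Complex.ofRealCLM.contDiff.comp_contDiffOn hb).pow j)).mul hw

theorem contDiff_wave_smul (φ : Lizorkin n) (ψ : LizorkinLine) (α s : ℝ) :
    ContDiff ℝ ∞ (fun v : E n => wave φ ψ (α • v) s) :=
  (contDiff_wave φ ψ).comp (f := fun v : E n => (α • v, s)) (by fun_prop)

theorem hasFDerivAt_wave_smul (φ : Lizorkin n) (ψ : LizorkinLine) (α s : ℝ) (v : E n) :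
    HasFDerivAt (fun v : E n => wave φ ψ (α • v) s)
      (∑ k, ((α : ℂ) * wave (mulCoord k φ) (dLine ψ) (α • v) s) • coordCLM k) v := by
  have h1 : HasFDerivAt (fun v : E n => (α • v, s))
      ((α • ContinuousLinearMap.id ℝ (E n)).prod (0 : E n →L[ℝ] ℝ)) v :=
    ((hasFDerivAt_id v).const_smul α).prodMk (hasFDerivAt_const s v)
  refine (HasFDerivAt.comp v (hasFDerivAt_wave φ ψ (α • v, s)) h1).congr_fderiv ?_
  refine ContinuousLinearMap.ext fun x => ?_
  rw [ContinuousLinearMap.comp_apply, waveDeriv_apply]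
  simp
  exact Finset.sum_congr rfl fun k _ => by ring

theorem fderiv_wave_smul (φ : Lizorkin n) (ψ : LizorkinLine) (α s : ℝ) (v : E n) :
    fderiv ℝ (fun v : E n => wave φ ψ (α • v) s) v =
      ∑ k, ((α : ℂ) * wave (mulCoord k φ) (dLine ψ) (α • v) s) • coordCLM k :=
  (hasFDerivAt_wave_smul φ ψ α s v).fderiv

theorem fderiv_fderiv_wave_smul (φ : Lizorkin n) (ψ : LizorkinLine) (α s : ℝ) (v e f : E n) :
    fderiv ℝ (fderiv ℝ (fun v : E n => wave φ ψ (α • v) s)) v e f =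
      ∑ k, (f k : ℂ) * ∑ l, (e l : ℂ) *
        ((α : ℂ) ^ 2 * wave (mulCoord l (mulCoord k φ)) (dLine (dLine ψ)) (α • v) s) := by
  rw [show fderiv ℝ (fun v : E n => wave φ ψ (α • v) s) = _ from
    funext (fderiv_wave_smul φ ψ α s)]
  have h : HasFDerivAt (fun v : E n =>
      ∑ k, ((α : ℂ) * wave (mulCoord k φ) (dLine ψ) (α • v) s) • coordCLM k) _ v :=
    HasFDerivAt.fun_sum fun k _ =>
      ((hasFDerivAt_wave_smul (mulCoord k φ) (dLine ψ) α s v).const_mul (α : ℂ)).smul_const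
        (coordCLM k)
  rw [h.fderiv]
  simp [Finset.mul_sum, Finset.sum_mul]
  exact Finset.sum_congr rfl fun k _ => Finset.sum_congr rfl fun l _ => by ring

theorem sum_basisVec_mul (k : Fin n) (f : Fin n → ℂ) :
    ∑ i, ((basisVec k i : ℝ) : ℂ) * f i = f k := by
  rw [Finset.sum_eq_single k]
  · simp [basisVec]
  · intro i _ hi
    simp [basisVec, hi]
  · simp

/-- The radial second derivative of a plane wave integral. -/
theorem sum_sum_mul_wave (φ : Lizorkin n) (ψ : LizorkinLine) (w : E n) (s : ℝ) :
    ∑ k, (w k : ℂ) * ∑ l, (w l : ℂ) * wave (mulCoord l (mulCoord k φ)) ψ w s =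
      wave φ (mulLine (mulLine ψ)) w s + 2 * s * wave φ (mulLine ψ) w s +
        s ^ 2 * wave φ ψ w s := by
  simp only [sum_mul_wave_mulCoord, mul_add, Finset.sum_add_distrib, mul_left_comm _ (s : ℂ),
    ← Finset.mul_sum]
  ring

theorem wave_sum {κ : Type*} (S : Finset κ) (φ : κ → Lizorkin n) (ψ : LizorkinLine) (w : E n)
    (s : ℝ) : wave (∑ k ∈ S, φ k) ψ w s = ∑ k ∈ S, wave (φ k) ψ w s := by
  unfold wave
  rw [← integral_finsetSum _ fun k _ => integrable_mul_wave (φ k).1 ψ.1 w s]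
  refine integral_congr_ae (.of_forall fun x => ?_)
  simp [Finset.sum_mul]

/-- Multiplication by `|x| ^ 2`. -/
def mulNormSq (n : ℕ) : Lizorkin n →L[ℂ] Lizorkin n := ∑ k, (mulCoord k).comp (mulCoord k)

/-! ### Derivatives of ridgelet transforms in b, a and u -/

theorem smoothY_ridgeExt (i j : ℕ) (ψ : LizorkinLine) (φ : Lizorkin n) :
    SmoothY fun y => ridgeExt i j ψ φ (coeY y) :=
  smoothY_of (contDiffOn_ridgeExt i j ψ φ) fun _ => rfl

theorem dB_ridgeExt (i j : ℕ) (ψ : LizorkinLine) (φ : Lizorkin n) (y : Y n) :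
    dB (fun y => ridgeExt i j ψ φ (coeY y)) y =
      j * ridgeExt i (j - 1) ψ φ (coeY y) - ridgeExt (i + 1) j (dLine ψ) φ (coeY y) := by
  obtain ⟨u, b, a⟩ := y
  unfold dB
  set α : ℝ := (a : ℝ)⁻¹ with hα
  have h1 : HasDerivAt (fun t : ℝ => (α • (u : E n), α * t)) ((0 : E n), α) b := by
    simpa using (hasDerivAt_const b (α • (u : E n))).prodMk ((hasDerivAt_id b).const_mul α)
  have h2 := (hasFDerivAt_wave φ ψ (α • (u : E n), α * b)).comp_hasDerivAt b h1
  rw [waveDeriv_apply] at h2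
  have h3 : HasDerivAt (fun t : ℝ => (t : ℂ) ^ j) ((j : ℂ) * (b : ℂ) ^ (j - 1)) b := by
    have h4 := (Complex.ofRealCLM.hasDerivAt (x := b)).pow j
    simp only [Complex.ofRealCLM_apply, Complex.ofReal_one, mul_one] at h4
    exact h4
  refine ((h3.const_mul ((α : ℂ) ^ i)).mul h2).deriv.trans ?_
  simp only [ridgeExt, coeY, ← hα]
  simp
  ring

/-- The a-derivative of (u/a, b/a) is −a⁻¹ times the vector itself. The resulting Euler derivative ∑
w_k W(x_k φ, ψ') − s W(φ, ψ') is W(φ, tψ'), so no power of b appears. -/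
theorem dA_ridgeExt (i j : ℕ) (ψ : LizorkinLine) (φ : Lizorkin n) (y : Y n) :
    dA (fun y => ridgeExt i j ψ φ (coeY y)) y =
      -(i * ridgeExt (i + 1) j ψ φ (coeY y)) -
        ridgeExt (i + 1) j (mulLine (dLine ψ)) φ (coeY y) := by
  obtain ⟨u, b, a⟩ := y
  have ha : (a : ℝ) ≠ 0 := ne_of_gt a.2
  refine dA_eq_of_forall (g := fun t : ℝ => ridgeExt i j ψ φ ((u : E n), b, t)) _
    (fun _ => rfl) ?_
  set α : ℝ := (a : ℝ)⁻¹ with hα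
  have hi : HasDerivAt (fun t : ℝ => t⁻¹) (-α ^ 2) (a : ℝ) := by
    simpa [hα] using hasDerivAt_inv ha
  have h1 : HasDerivAt (fun t : ℝ => (t⁻¹ • (u : E n), t⁻¹ * b))
      ((-α ^ 2) • (u : E n), -α ^ 2 * b) (a : ℝ) := (hi.smul_const _).prodMk (hi.mul_const b)
  have h2 := (hasFDerivAt_wave φ ψ (α • (u : E n), α * b)).comp_hasDerivAt (a : ℝ) h1
  rw [waveDeriv_apply] at h2
  have h5 : HasDerivAt (fun t : ℝ => ((t⁻¹ : ℝ) : ℂ)) (((-α ^ 2 : ℝ) : ℝ) : ℂ) (a : ℝ) :=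
    hi.ofReal_comp
  have h3 := (h5.pow i).mul_const ((b : ℂ) ^ j)
  have h6 := sum_mul_wave_mulCoord φ (dLine ψ) (α • (u : E n)) (α * b)
  have h7 : ∑ k, (((-α ^ 2) • (u : E n)) k : ℂ) *
      wave (mulCoord k φ) (dLine ψ) (α • (u : E n)) (α * b) =
      -α * ∑ k, ((α • (u : E n)) k : ℂ) *
        wave (mulCoord k φ) (dLine ψ) (α • (u : E n)) (α * b) := by
    rw [Finset.mul_sum]
    refine Finset.sum_congr rfl fun k _ => ?_
    simp
    ring
  simp only [h7, h6] at h2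
  have h8 := h3.mul h2
  refine h8.congr_deriv ?_
  simp only [ridgeExt, coeY, ← hα, Function.comp_apply, Pi.pow_apply]
  clear_value α
  rcases i with _ | i
  · simp
    ring
  · simp
    ring

/-- The Euclidean Laplacian multiplies φ by |x|². The two radial corrections are rewritten through
x·w = t + s with s = b/a, which accounts for the raised powers of b and the factors of the variable
on ψ. -/
theorem lapU_ridgeExt (i j : ℕ) (ψ : LizorkinLine) (φ : Lizorkin n) (y : Y n) :
    lapU (fun y => ridgeExt i j ψ φ (coeY y)) y =
      ridgeExt (i + 2) j (dLine (dLine ψ)) (mulNormSq n φ) (coeY y) -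
      (ridgeExt i j (mulLine (mulLine (dLine (dLine ψ)))) φ (coeY y) +
        2 * ridgeExt (i + 1) (j + 1) (mulLine (dLine (dLine ψ))) φ (coeY y) +
        ridgeExt (i + 2) (j + 2) (dLine (dLine ψ)) φ (coeY y)) -
      (n - 1 : ℂ) * (ridgeExt i j (mulLine (dLine ψ)) φ (coeY y) +
        ridgeExt (i + 1) (j + 1) (dLine ψ) φ (coeY y)) := by
  obtain ⟨u, b, a⟩ := y
  set α : ℝ := (a : ℝ)⁻¹ with hα
  set c : ℂ := (α : ℂ) ^ i * (b : ℂ) ^ j with hc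
  set h : E n → ℂ := fun v => wave φ ψ (α • v) (α * b) with hh
  have hsm : ContDiff ℝ ∞ h := contDiff_wave_smul φ ψ α (α * b)
  have hd1 : ∀ v, DifferentiableAt ℝ h v := fun v => hsm.contDiffAt.differentiableAt (by simp)
  have hd2 : DifferentiableAt ℝ (fderiv ℝ h) u :=
    (hsm.fderiv_right (m := ∞) (by simp)).contDiffAt.differentiableAt (by simp)
  rw [lapU_eq_of_forall (g := fun v => c * h v) (u, b, a) (fun _ => rfl)
    (contDiff_const.mul (hsm.of_le (WithTop.coe_le_coe.2 (le_top : (2 : ℕ∞) ≤ ⊤)))).contDiffAt]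
  have h1 : fderiv ℝ (fun v => c * h v) = fun v => c • fderiv ℝ h v :=
    funext fun v => fderiv_const_mul (hd1 v) c
  have h2 : fderiv ℝ (fun v => c • fderiv ℝ h v) (u : E n) = c • fderiv ℝ (fderiv ℝ h) u :=
    fderiv_fun_const_smul hd2 c
  rw [laplacian_eq_sum_basisVec, h1, h2]
  have e1 : ∀ k, (c • fderiv ℝ (fderiv ℝ h) (u : E n)) (basisVec k) (basisVec k) =
      c * ((α : ℂ) ^ 2 * wave (mulCoord k (mulCoord k φ)) (dLine (dLine ψ))
        (α • (u : E n)) (α * b)) := fun k => by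
    change c * fderiv ℝ (fderiv ℝ h) (u : E n) (basisVec k) (basisVec k) = _
    rw [hh, fderiv_fderiv_wave_smul]
    simp only [sum_basisVec_mul]
  have e2 : (c • fderiv ℝ (fderiv ℝ h) (u : E n)) u u = c * (
      ∑ k, ((α • (u : E n)) k : ℂ) * ∑ l, ((α • (u : E n)) l : ℂ) *
        wave (mulCoord l (mulCoord k φ)) (dLine (dLine ψ)) (α • (u : E n)) (α * b)) := by
    change c * fderiv ℝ (fderiv ℝ h) (u : E n) u u = _
    rw [hh, fderiv_fderiv_wave_smul]
    congr 1
    refine Finset.sum_congr rfl fun k _ => ?_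
    rw [Finset.mul_sum, Finset.mul_sum]
    refine Finset.sum_congr rfl fun l _ => ?_
    simp
    ring
  have e3 : (c • fderiv ℝ h (u : E n)) u = c * ∑ k, ((α • (u : E n)) k : ℂ) *
      wave (mulCoord k φ) (dLine ψ) (α • (u : E n)) (α * b) := by
    change c * fderiv ℝ h (u : E n) u = _
    rw [hh, fderiv_wave_smul]
    congr 1
    simp
    exact Finset.sum_congr rfl fun k _ => by ring
  simp only [e1, ← Finset.mul_sum]
  rw [e2, e3, sum_sum_mul_wave, sum_mul_wave_mulCoord]
  have e4 : mulNormSq n φ = ∑ k, mulCoord k (mulCoord k φ) := by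
    simp [mulNormSq]
  simp only [ridgeExt, coeY, e4, wave_sum, ← hα, hc]
  push_cast
  ring

/-- The operators spanned by `φ ↦ ridgeExt i j ψ (L φ)`. -/
inductive RidgeFamily : (Lizorkin n → Y n → ℂ) → Prop
  | term (i j : ℕ) (ψ : LizorkinLine) (L : Lizorkin n →L[ℂ] Lizorkin n) :
      RidgeFamily fun φ y => ridgeExt i j ψ (L φ) (coeY y)
  | add {T S : Lizorkin n → Y n → ℂ} : RidgeFamily T → RidgeFamily S →
      RidgeFamily fun φ => T φ + S φ
  | smul {T : Lizorkin n → Y n → ℂ} (c : ℂ) : RidgeFamily T → RidgeFamily fun φ => c • T φ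

namespace RidgeFamily

variable {T S : Lizorkin n → Y n → ℂ}

theorem sub (hT : RidgeFamily T) (hS : RidgeFamily S) : RidgeFamily fun φ => T φ - S φ := by
  have h := hT.add (hS.smul (-1))
  simpa [sub_eq_add_neg] using h

theorem smoothY (hT : RidgeFamily T) (φ : Lizorkin n) : SmoothY (T φ) := by
  induction hT with
  | term i j ψ L => exact smoothY_ridgeExt i j ψ (L φ)
  | add _ _ h1 h2 => exact h1.add h2
  | smul c _ h => exact h.smul c

/-- The element of `smoothFun n` given by a member of the family. -/
def smooth (hT : RidgeFamily T) (φ : Lizorkin n) : smoothFun n := ⟨T φ, hT.smoothY φ⟩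

/-- By linearity, stability of the family under an operator need only be checked on the generating
terms. -/
theorem apply_end (D : Module.End ℂ (smoothFun n))
    (h : ∀ (i j : ℕ) (ψ : LizorkinLine) (L : Lizorkin n →L[ℂ] Lizorkin n),
      RidgeFamily fun φ => (D ⟨_, smoothY_ridgeExt i j ψ (L φ)⟩).1)
    (hT : RidgeFamily T) : RidgeFamily fun φ => (D (hT.smooth φ)).1 := by
  induction hT with
  | term i j ψ L => exact h i j ψ L
  | add h1 h2 ih1 ih2 =>
    have e : ∀ φ, (h1.add h2).smooth φ = h1.smooth φ + h2.smooth φ := fun _ => rfl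
    simp only [e, map_add]
    exact ih1.add ih2
  | smul c h1 ih =>
    have e : ∀ φ, (h1.smul c).smooth φ = c • h1.smooth φ := fun _ => rfl
    simp only [e, map_smul]
    exact ih.smul c

theorem opA (hT : RidgeFamily T) : RidgeFamily fun φ => (opA n (hT.smooth φ)).1 := by
  refine hT.apply_end (Ridgelet.opA n) fun i j ψ L => ?_
  have h := ((term (n := n) (i + 1) j ψ L).smul (-(i : ℂ))).sub
    (term (i + 1) j (mulLine (dLine ψ)) L)
  convert h using 1
  ext φ y
  refine (dA_ridgeExt i j ψ (L φ) y).trans ?_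
  simp

theorem opB (hT : RidgeFamily T) : RidgeFamily fun φ => (opB n (hT.smooth φ)).1 := by
  refine hT.apply_end (Ridgelet.opB n) fun i j ψ L => ?_
  have h := ((term (n := n) i (j - 1) ψ L).smul (j : ℂ)).sub (term (i + 1) j (dLine ψ) L)
  convert h using 1
  ext φ y
  exact dB_ridgeExt i j ψ (L φ) y

theorem opL (hT : RidgeFamily T) : RidgeFamily fun φ => (opL n (hT.smooth φ)).1 := by
  refine hT.apply_end (Ridgelet.opL n) fun i j ψ L => ?_
  have h := ((term (n := n) (i + 2) j (dLine (dLine ψ)) ((mulNormSq n).comp L)).sub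
    (((term i j (mulLine (mulLine (dLine (dLine ψ)))) L).add
      ((term (i + 1) (j + 1) (mulLine (dLine (dLine ψ))) L).smul 2)).add
        (term (i + 2) (j + 2) (dLine (dLine ψ)) L))).sub
    (((term i j (mulLine (dLine ψ)) L).add (term (i + 1) (j + 1) (dLine ψ) L)).smul
      (n - 1 : ℂ))
  convert h using 1
  ext φ y
  exact lapU_ridgeExt i j ψ (L φ) y

theorem pow_end {D : Module.End ℂ (smoothFun n)}
    (h : ∀ {T : Lizorkin n → Y n → ℂ} (hT : RidgeFamily T),
      RidgeFamily fun φ => (D (hT.smooth φ)).1)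
    (k : ℕ) (hT : RidgeFamily T) : RidgeFamily fun φ => ((D ^ k) (hT.smooth φ)).1 := by
  induction k with
  | zero => exact hT
  | succ k ih =>
    simp only [pow_succ', Module.End.mul_apply]
    exact h ih

theorem derivY (hT : RidgeFamily T) (i : Idx) : RidgeFamily fun φ => derivY i (hT.smooth φ) :=
  pow_end opA i.l (pow_end opB i.m (pow_end opL i.k hT))

/-- Put w = u/a and s = b/a, so that |w| = 1/a. Then a^(k−i) b^(r+j) equals |w|^(−(k−i+(r+j)))
s^(r+j), which reduces the bound to the one for plane waves. -/
theorem dominated (hT : RidgeFamily T) (k : ℤ) (r : ℕ) :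
    Dominated fun φ (y : Y n) => (((y.2.2 : ℝ) ^ k * y.2.1 ^ r : ℝ) : ℂ) * T φ y := by
  induction hT with
  | term i j ψ L =>
    refine (((dominated_norm_zpow_mul_pow_mul_wave (n := n) (-(k - i + (r + j))) (r + j) ψ).comp
      L).reindex fun y : Y n => ((y.2.2 : ℝ)⁻¹ • (y.1 : E n), (y.2.2 : ℝ)⁻¹ * y.2.1)).mono
      fun φ y => le_of_eq (congrArg norm ?_)
    obtain ⟨u, b, a⟩ := y
    have ha : (0 : ℝ) < a := a.2
    have hac : ((a : ℝ) : ℂ) ≠ 0 := by exact_mod_cast ha.ne'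
    have hu : ‖(a : ℝ)⁻¹ • (u : E n)‖ = (a : ℝ)⁻¹ := by
      rw [norm_smul, mem_sphere_zero_iff_norm.mp u.2, mul_one, Real.norm_of_nonneg (by positivity)]
    simp only [ridgeExt, coeY, hu]
    rw [← mul_assoc]
    congr 1
    push_cast
    rw [inv_zpow', neg_neg, zpow_add₀ hac, zpow_sub₀ hac, ← Nat.cast_add, zpow_natCast,
      zpow_natCast, mul_pow, inv_pow]
    field_simp
    rw [one_div, inv_pow, mul_inv_cancel₀ (pow_ne_zero _ hac), one_mul, pow_add]
  | add _ _ h1 h2 => simpa [mul_add] using h1.add h2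
  | smul c _ h =>
    convert h.const_mul c using 3
    simp
    ring

/-- The weight is compared with (a^s + a^(−s)) (1 + |b|)^r, and (1 + |b|)^r with 2^(r−1) (1 +
|b|^r), a combination of the monomials already treated. -/
theorem dominated_weight (hT : RidgeFamily T) (i : Idx) :
    Dominated fun φ (y : Y n) => (weight i y : ℂ) * T φ y := by
  have h1 : ∀ k : ℤ, Dominated fun φ (y : Y n) =>
      (((y.2.2 : ℝ) ^ k * (1 + |y.2.1|) ^ i.r : ℝ) : ℂ) * T φ y := fun k => by
    have h2 := ((hT.dominated k 0).add ((hT.dominated k i.r).mono (T := fun φ (y : Y n) =>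
      (((y.2.2 : ℝ) ^ k * |y.2.1| ^ i.r : ℝ) : ℂ) * T φ y) fun φ y => le_of_eq ?_)).const_mul
      (2 ^ (i.r - 1) : ℝ)
    · refine h2.mono fun φ y => ?_
      have ha : (0 : ℝ) < y.2.2 := y.2.2.2
      have h3 := add_pow_le (zero_le_one (α := ℝ)) (abs_nonneg y.2.1) i.r
      rw [← add_mul, ← mul_assoc, norm_mul, norm_mul]
      refine mul_le_mul_of_nonneg_right ?_ (norm_nonneg _)
      rw [← Complex.ofReal_add, ← Complex.ofReal_mul, Complex.norm_real, Complex.norm_real,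
        Real.norm_of_nonneg (by positivity), Real.norm_of_nonneg (by positivity)]
      rw [one_pow] at h3
      calc (y.2.2 : ℝ) ^ k * (1 + |y.2.1|) ^ i.r
          ≤ (y.2.2 : ℝ) ^ k * (2 ^ (i.r - 1) * (1 + |y.2.1| ^ i.r)) := by gcongr
        _ = _ := by ring
    · simp
  refine ((h1 i.s).add (h1 (-i.s))).mono fun φ y => ?_
  have ha : (0 : ℝ) < y.2.2 := y.2.2.2
  rw [← add_mul, norm_mul, norm_mul]
  refine mul_le_mul_of_nonneg_right ?_ (norm_nonneg _)
  rw [← Complex.ofReal_add, Complex.norm_real, Complex.norm_real,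
    Real.norm_of_nonneg (weight_nonneg i y), Real.norm_of_nonneg (by positivity), ← add_mul,
    zpow_neg, zpow_natCast]
  unfold weight
  rw [one_div]
  gcongr
  have h4 : (1 + y.2.1 ^ 2) ≤ (1 + |y.2.1|) ^ 2 := by
    have := abs_nonneg y.2.1
    nlinarith [sq_abs y.2.1]
  calc (1 + y.2.1 ^ 2) ^ ((i.r : ℝ) / 2) ≤ ((1 + |y.2.1|) ^ 2) ^ ((i.r : ℝ) / 2) := by gcongr
    _ = (1 + |y.2.1|) ^ i.r := by
      rw [← Real.rpow_natCast_mul (by positivity), ← Real.rpow_natCast]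
      congr 1
      push_cast
      ring

theorem dominated_weighted (hT : RidgeFamily T) (i : Idx) :
    ∃ q : Seminorm ℂ (Lizorkin n), Continuous q ∧ ∀ φ y, weighted i (hT.smooth φ) y ≤ q φ := by
  obtain ⟨q, hq, h⟩ := (hT.derivY i).dominated_weight i
  refine ⟨q, hq, fun φ y => le_trans (le_of_eq ?_) (h φ y)⟩
  rw [norm_mul, Complex.norm_real, Real.norm_of_nonneg (weight_nonneg i y)]
  rfl

end RidgeFamily

/-- The ridgelet transform is a continuous linear operator on the Lizorkin test functions. -/
theorem exists_isRidgeletOperator (η : LizorkinLine) :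
    ∃ T, IsRidgeletOperator n (conjFn fun t => η.1 t) T := by
  have hR : RidgeFamily (n := n) fun φ y => ridgeExt 1 0 η φ (coeY y) :=
    RidgeFamily.term 1 0 η (ContinuousLinearMap.id ℂ _)
  have hmem : ∀ φ, hR.smooth φ ∈ schwartzYSubmodule n := fun φ i => by
    obtain ⟨q, -, h⟩ := hR.dominated_weighted i
    exact ⟨q φ, by rintro _ ⟨y, rfl⟩; exact h φ y⟩
  let T : Lizorkin n →ₗ[ℂ] SchwartzY n :=
    { toFun := fun φ => ⟨hR.smooth φ, hmem φ⟩
      map_add' := fun φ χ => by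
        refine Subtype.ext (Subtype.ext (funext fun y => ?_))
        change ridgeExt 1 0 η (φ + χ) (coeY y) =
          ridgeExt 1 0 η φ (coeY y) + ridgeExt 1 0 η χ (coeY y)
        unfold ridgeExt
        rw [← mul_add]
        congr 1
        unfold wave
        rw [← integral_add (integrable_mul_wave _ _ _ _) (integrable_mul_wave _ _ _ _)]
        refine integral_congr_ae (.of_forall fun x => ?_)
        exact add_mul _ _ _
      map_smul' := fun c φ => by
        refine Subtype.ext (Subtype.ext (funext fun y => ?_))
        change ridgeExt 1 0 η (c • φ) (coeY y) = c * ridgeExt 1 0 η φ (coeY y)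
        unfold ridgeExt
        rw [mul_left_comm]
        congr 1
        unfold wave
        rw [← integral_const_mul]
        refine integral_congr_ae (.of_forall fun x => ?_)
        exact mul_assoc _ _ _ }
  -- Every seminorm of the image is a supremum of quantities bounded by one continuous seminorm of
  -- φ.
  have hTc : Continuous T := by
    refine (withSeminorms_schwartzY n).continuous_of_continuous_comp T fun i => ?_
    obtain ⟨q, hq, h⟩ := hR.dominated_weighted i
    refine Seminorm.continuous_of_le hq fun φ => ?_
    exact Real.iSup_le (h φ) (apply_nonneg q φ)
  have key : ∀ (φ : Lizorkin n) (y : Y n) (x : E n),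
      φ.1 x * conj (ridge (conjFn fun t => η.1 t) y x) =
        (((y.2.2 : ℝ)⁻¹ : ℝ) : ℂ) * (φ.1 x * η.1 (inner ℝ x ((y.2.2 : ℝ)⁻¹ • (y.1 : E n)) -
          (y.2.2 : ℝ)⁻¹ * y.2.1)) := fun φ y x => by
    have h1 : (inner ℝ x (y.1 : E n) - y.2.1) / (y.2.2 : ℝ) =
        inner ℝ x ((y.2.2 : ℝ)⁻¹ • (y.1 : E n)) - (y.2.2 : ℝ)⁻¹ * y.2.1 := by
      rw [inner_smul_right]; ring
    simp only [ridge, conjFn, map_mul, Complex.conj_conj, h1]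
    simp
    ring
  refine ⟨⟨T, hTc⟩, fun φ y => ⟨?_, ?_⟩⟩
  · simp only [key]
    exact (integrable_mul_wave _ _ _ _).const_mul _
  · change ridgeExt 1 0 η φ (coeY y) = _
    unfold ridgelet
    simp only [key, integral_const_mul]
    simp [ridgeExt, wave, coeY]

end ridge

/-! ### Polar coordinates and Green's identity on the sphere -/

section sphere

variable {n : ℕ}

theorem measurePreserving_polar (hn : n ≠ 0) :
    MeasurePreserving (homeomorphUnitSphereProd (E n))
      ((volume : Measure (E n)).comap (↑))
      ((volume : Measure (E n)).toSphere.prod (Measure.volumeIoiPow (n - 1))) := by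
  have : Nonempty (Fin n) := ⟨⟨0, Nat.pos_of_ne_zero hn⟩⟩
  simpa using (volume : Measure (E n)).measurePreserving_homeomorphUnitSphereProd

theorem apply_smul_homeomorph (f : E n → ℂ) (x : ({0}ᶜ : Set (E n))) :
    f (((homeomorphUnitSphereProd (E n) x).2 : ℝ) • ((homeomorphUnitSphereProd (E n) x).1 : E n)) =
      f x := by
  rw [← homeomorphUnitSphereProd_symm_apply_coe, Homeomorph.symm_apply_apply]

theorem integral_polar (hn : n ≠ 0) (f : E n → ℂ) :
    ∫ x, f x = ∫ p : Sph n × Set.Ioi (0 : ℝ), f ((p.2 : ℝ) • (p.1 : E n))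
      ∂((volume : Measure (E n)).toSphere.prod (Measure.volumeIoiPow (n - 1))) := by
  have : Nonempty (Fin n) := ⟨⟨0, Nat.pos_of_ne_zero hn⟩⟩
  rw [← (measurePreserving_polar hn).integral_comp (Homeomorph.measurableEmbedding _)]
  simp only [apply_smul_homeomorph]
  rw [integral_subtype_comap (measurableSet_singleton _).compl f, restrict_compl_singleton]

theorem integrable_polar (hn : n ≠ 0) (f : E n → ℂ) :
    Integrable (fun p : Sph n × Set.Ioi (0 : ℝ) => f ((p.2 : ℝ) • (p.1 : E n)))
      ((volume : Measure (E n)).toSphere.prod (Measure.volumeIoiPow (n - 1))) ↔ Integrable f := by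
  have : Nonempty (Fin n) := ⟨⟨0, Nat.pos_of_ne_zero hn⟩⟩
  rw [← (measurePreserving_polar hn).integrable_comp_emb (Homeomorph.measurableEmbedding _)]
  have h : (fun p : Sph n × Set.Ioi (0 : ℝ) => f ((p.2 : ℝ) • (p.1 : E n))) ∘
      homeomorphUnitSphereProd (E n) = f ∘ Subtype.val := funext (apply_smul_homeomorph f)
  rw [h, ← integrableOn_iff_comap_subtypeVal (measurableSet_singleton _).compl, IntegrableOn,
    restrict_compl_singleton]

/-- A bump function around `1` supported in `(0, 2)`. -/
def cutoffProfile : ContDiffBump (1 : ℝ) := ⟨1 / 4, 1 / 2, by norm_num, by norm_num⟩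

/-- A radial cutoff function supported away from the origin. -/
def radialCutoff (x : E n) : ℝ := ‖x‖ ^ 2 * cutoffProfile (‖x‖ ^ 2)

theorem cutoffProfile_eq_zero {t : ℝ} (ht : 1 / 2 ≤ |t - 1|) : cutoffProfile t = 0 :=
  cutoffProfile.zero_of_le_dist (by rw [Real.dist_eq]; exact ht)

theorem radialCutoff_eventually_eq_zero : ∀ᶠ x in nhds (0 : E n), radialCutoff x = 0 := by
  filter_upwards [Metric.ball_mem_nhds (0 : E n) (show (0 : ℝ) < 1 / 2 by norm_num)] with x hx
  rw [mem_ball_zero_iff] at hx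
  rw [radialCutoff, cutoffProfile_eq_zero, mul_zero]
  have := norm_nonneg x
  rw [abs_of_nonpos (by nlinarith)]
  nlinarith

theorem radialCutoff_eq_zero {x : E n} (hx : x ∉ Metric.closedBall (0 : E n) 2) :
    radialCutoff x = 0 := by
  rw [mem_closedBall_zero_iff, not_le] at hx
  rw [radialCutoff, cutoffProfile_eq_zero, mul_zero]
  rw [abs_of_nonneg (by nlinarith)]
  nlinarith

theorem exists_hasFDerivAt_radialCutoff (x : E n) :
    ∃ c : ℝ, HasFDerivAt (radialCutoff : E n → ℝ) (c • innerSL ℝ x) x := by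
  have h1 : HasFDerivAt (fun v : E n => ‖v‖ ^ 2) (2 • innerSL ℝ x) x :=
    (hasStrictFDerivAt_norm_sq x).hasFDerivAt
  have h2 : Differentiable ℝ fun t : ℝ => t * cutoffProfile t :=
    differentiable_id.mul (cutoffProfile.contDiff.differentiable (n := 1) (by simp))
  have h3 := (h2 (‖x‖ ^ 2)).hasDerivAt.comp_hasFDerivAt x h1
  refine ⟨deriv (fun t : ℝ => t * cutoffProfile t) (‖x‖ ^ 2) * 2, ?_⟩
  refine h3.congr_fderiv ?_
  ext v
  simp
  ring

theorem contDiff_radialCutoff : ContDiff ℝ ∞ (radialCutoff : E n → ℝ) :=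
  (contDiff_norm_sq ℝ).mul (cutoffProfile.contDiff.comp (contDiff_norm_sq ℝ))

theorem integral_fderiv_eq_zero {V : E n → ℂ} (hV : ContDiff ℝ 1 V) (hc : HasCompactSupport V)
    (v : E n) : ∫ x, fderiv ℝ V x v = 0 := by
  have h1 : Integrable fun x => fderiv ℝ V x v :=
    ((hV.continuous_fderiv (by simp)).clm_apply continuous_const).integrable_of_hasCompactSupport
      (hc.fderiv_apply (𝕜 := ℝ) v)
  have h2 := integral_mul_fderiv_eq_neg_fderiv_mul_of_integrable (μ := (volume : Measure (E n)))
    (f := fun _ : E n => (1 : ℂ)) (g := V) (v := v) (by simp) (by simpa using h1)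
    (by simpa using hV.continuous.integrable_of_hasCompactSupport hc)
    (fun x _ => differentiableAt_const _) (fun x _ => hV.contDiffAt.differentiableAt (by simp))
  simpa using h2

theorem fderiv_smul_of_homogeneous {F : Type*} [NormedAddCommGroup F] [NormedSpace ℝ F]
    {G : E n → F} {c r : ℝ} (hr : r ≠ 0) (h : ∀ x ≠ 0, G (r • x) = c • G x)
    {x : E n} (hx : x ≠ 0) (hG : DifferentiableAt ℝ G x) :
    fderiv ℝ G (r • x) = (r⁻¹ * c) • fderiv ℝ G x := by
  have h1 : (fun x => G (r • x)) =ᶠ[nhds x] fun x => c • G x := by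
    filter_upwards [isOpen_ne.mem_nhds hx] with y hy using h y hy
  have h2 := h1.fderiv_eq (𝕜 := ℝ)
  rw [fderiv_comp_smul, fderiv_fun_const_smul hG] at h2
  rw [mul_smul, ← h2, smul_smul, inv_mul_cancel₀ hr, one_smul]

/-- A function that is homogeneous of degree `0` and smooth away from the origin. -/
structure IsZeroHomogeneous (F : E n → ℂ) : Prop where
  contDiffOn : ContDiffOn ℝ ∞ F {0}ᶜ
  smul : ∀ r : ℝ, 0 < r → ∀ x ≠ 0, F (r • x) = F x

namespace IsZeroHomogeneous

variable {F H : E n → ℂ}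

theorem contDiffAt (hF : IsZeroHomogeneous F) {x : E n} (hx : x ≠ 0) : ContDiffAt ℝ ∞ F x :=
  hF.contDiffOn.contDiffAt (isOpen_compl_singleton.mem_nhds hx)

theorem differentiableAt (hF : IsZeroHomogeneous F) {x : E n} (hx : x ≠ 0) :
    DifferentiableAt ℝ F x := (hF.contDiffAt hx).differentiableAt (by simp)

theorem contDiffAt_fderiv (hF : IsZeroHomogeneous F) {x : E n} (hx : x ≠ 0) :
    ContDiffAt ℝ ∞ (fderiv ℝ F) x := (hF.contDiffAt hx).fderiv_right (by simp)

theorem differentiableAt_fderiv (hF : IsZeroHomogeneous F) {x : E n} (hx : x ≠ 0) :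
    DifferentiableAt ℝ (fderiv ℝ F) x := (hF.contDiffAt_fderiv hx).differentiableAt (by simp)

/-- Euler's identity: F is constant along the ray through x. -/
theorem fderiv_self (hF : IsZeroHomogeneous F) {x : E n} (hx : x ≠ 0) : fderiv ℝ F x x = 0 := by
  have h1 : HasDerivAt (fun t : ℝ => t • x) x 1 := by
    simpa using (hasDerivAt_id (1 : ℝ)).smul_const x
  have h2 : HasFDerivAt F (fderiv ℝ F x) ((1 : ℝ) • x) := by
    rw [one_smul]; exact (hF.differentiableAt hx).hasFDerivAt
  have h3 := h2.comp_hasDerivAt 1 h1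
  have h4 : F ∘ (fun t : ℝ => t • x) =ᶠ[nhds 1] fun _ => F x := by
    filter_upwards [lt_mem_nhds (zero_lt_one (α := ℝ))] with t ht using hF.smul t ht x hx
  rw [← h3.deriv, h4.deriv_eq]
  simp

/-- Each derivative lowers the degree of homogeneity by one. -/
theorem laplacian_smul (hF : IsZeroHomogeneous F) {r : ℝ} (hr : 0 < r) {x : E n} (hx : x ≠ 0) :
    Laplacian.laplacian F (r • x) = ((r⁻¹ ^ 2 : ℝ) : ℂ) * Laplacian.laplacian F x := by
  have h1 : ∀ y ≠ 0, fderiv ℝ F (r • y) = r⁻¹ • fderiv ℝ F y := fun y hy => by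
    have := fderiv_smul_of_homogeneous (c := 1) hr.ne' (fun x hx => by
      rw [one_smul]; exact hF.smul r hr x hx) hy (hF.differentiableAt hy)
    simpa using this
  have h2 := fderiv_smul_of_homogeneous hr.ne' h1 hx (hF.differentiableAt_fderiv hx)
  rw [laplacian_eq_sum_basisVec, laplacian_eq_sum_basisVec, h2, Finset.mul_sum]
  refine Finset.sum_congr rfl fun k _ => ?_
  simp [pow_two]

theorem continuousOn_laplacian (hF : IsZeroHomogeneous F) :
    ContinuousOn (Laplacian.laplacian F) {0}ᶜ := by
  intro x hx
  have h1 : ContinuousAt (fderiv ℝ (fderiv ℝ F)) x :=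
    ((hF.contDiffAt_fderiv hx).fderiv_right (m := ∞) (by simp)).continuousAt
  refine ContinuousAt.continuousWithinAt ?_
  rw [show Laplacian.laplacian F = fun u =>
    ∑ k, fderiv ℝ (fderiv ℝ F) u (basisVec k) (basisVec k) from
      funext (laplacian_eq_sum_basisVec F)]
  fun_prop

theorem continuous_laplacian_sphere (hF : IsZeroHomogeneous F) :
    Continuous fun u : Sph n => Laplacian.laplacian F (u : E n) :=
  hF.continuousOn_laplacian.comp_continuous continuous_subtype_val fun u =>
    ne_zero_of_mem_unit_sphere u

theorem continuous_sphere (hF : IsZeroHomogeneous F) : Continuous fun u : Sph n => F (u : E n) :=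
  hF.contDiffOn.continuousOn.comp_continuous continuous_subtype_val fun u =>
    ne_zero_of_mem_unit_sphere u

/-- The divergence of the cut off Wronskian of two homogeneous functions. -/
theorem integral_radialCutoff_mul (hF : IsZeroHomogeneous F) (hH : IsZeroHomogeneous H) :
    ∫ x : E n, (radialCutoff x : ℂ) *
      (Laplacian.laplacian F x * H x - F x * Laplacian.laplacian H x) = 0 := by
  -- The field H∇F − F∇H, whose divergence is H ΔF − F ΔH.
  let A : Fin n → E n → ℂ := fun k x =>
    fderiv ℝ F x (basisVec k) * H x - F x * fderiv ℝ H x (basisVec k)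
  have hA : ∀ k, ∀ x ≠ 0, ContDiffAt ℝ ∞ (A k) x := fun k x hx =>
    (((hF.contDiffAt_fderiv hx).clm_apply contDiffAt_const).mul (hH.contDiffAt hx)).sub
      ((hF.contDiffAt hx).mul ((hH.contDiffAt_fderiv hx).clm_apply contDiffAt_const))
  have hχ : ContDiff ℝ ∞ fun x : E n => (radialCutoff x : ℂ) :=
    Complex.ofRealCLM.contDiff.comp contDiff_radialCutoff
  -- The field may be singular at the origin, but the cutoff vanishes in a neighbourhood of it.
  have hV : ∀ k, ContDiff ℝ ∞ fun x => (radialCutoff x : ℂ) * A k x := fun k =>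
    contDiff_iff_contDiffAt.mpr fun x => by
      rcases eq_or_ne x 0 with rfl | hx
      · refine (contDiffAt_const (c := (0 : ℂ))).congr_of_eventuallyEq ?_
        filter_upwards [radialCutoff_eventually_eq_zero] with x hx
        simp [hx]
      · exact hχ.contDiffAt.mul (hA k x hx)
  have hVc : ∀ k, HasCompactSupport fun x => (radialCutoff x : ℂ) * A k x := fun k =>
    HasCompactSupport.intro (isCompact_closedBall (0 : E n) 2) fun x hx => by
      rw [radialCutoff_eq_zero hx]; simp
  have hint : ∀ k, Integrable fun x =>
      fderiv ℝ (fun x => (radialCutoff x : ℂ) * A k x) x (basisVec k) := fun k =>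
    (((hV k).continuous_fderiv (by simp)).clm_apply
      continuous_const).integrable_of_hasCompactSupport ((hVc k).fderiv_apply (𝕜 := ℝ) _)
  have hsum : ∫ x, ∑ k, fderiv ℝ (fun x => (radialCutoff x : ℂ) * A k x) x (basisVec k) = 0 := by
    rw [integral_finsetSum _ fun k _ => hint k]
    exact Finset.sum_eq_zero fun k _ =>
      integral_fderiv_eq_zero ((hV k).of_le (by exact_mod_cast le_top)) (hVc k) _
  rw [← hsum]
  refine integral_congr_ae (.of_forall fun x => ?_)
  dsimp only
  rcases eq_or_ne x 0 with rfl | hx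
  · have h0 : ∀ k, fderiv ℝ (fun x => (radialCutoff x : ℂ) * A k x) (0 : E n) = 0 := fun k => by
      have : (fun x => (radialCutoff x : ℂ) * A k x) =ᶠ[nhds (0 : E n)] fun _ => (0 : ℂ) := by
        filter_upwards [radialCutoff_eventually_eq_zero] with x hx
        simp [hx]
      rw [this.fderiv_eq]
      simp
    simp [h0, radialCutoff_eventually_eq_zero.self_of_nhds]
  · obtain ⟨c, hc⟩ := exists_hasFDerivAt_radialCutoff x
    have hc' : HasFDerivAt (fun x : E n => (radialCutoff x : ℂ))
        (Complex.ofRealCLM ∘L (c • innerSL ℝ x)) x := Complex.ofRealCLM.hasFDerivAt.comp x hc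
    -- The gradient of the cutoff is c x, so after summation over k the terms with c are radial
    -- derivatives of F and H, which vanish by Euler's identity.
    have hd : ∀ k, fderiv ℝ (fun x => (radialCutoff x : ℂ) * A k x) x (basisVec k) =
        radialCutoff x * (fderiv ℝ (fderiv ℝ F) x (basisVec k) (basisVec k) * H x -
          F x * fderiv ℝ (fderiv ℝ H) x (basisVec k) (basisVec k)) +
        (c : ℂ) * ((x k : ℂ) * fderiv ℝ F x (basisVec k) * H x -
          F x * ((x k : ℂ) * fderiv ℝ H x (basisVec k))) := fun k => by
      have hAk : HasFDerivAt (A k) _ x :=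
        (((hF.differentiableAt_fderiv hx).hasFDerivAt.clm_apply
          (hasFDerivAt_const (basisVec k) x)).fun_mul (hH.differentiableAt hx).hasFDerivAt).fun_sub
        ((hF.differentiableAt hx).hasFDerivAt.fun_mul
          ((hH.differentiableAt_fderiv hx).hasFDerivAt.clm_apply
            (hasFDerivAt_const (basisVec k) x)))
      rw [(hc'.fun_mul hAk).fderiv]
      simp [A, inner_basisVec]
      ring
    have hF0 : ∑ k, (x k : ℂ) * fderiv ℝ F x (basisVec k) = 0 := by
      rw [← hF.fderiv_self hx, clm_eq_sum (fderiv ℝ F x) x]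
      simp
    have hH0 : ∑ k, (x k : ℂ) * fderiv ℝ H x (basisVec k) = 0 := by
      rw [← hH.fderiv_self hx, clm_eq_sum (fderiv ℝ H x) x]
      simp
    simp only [hd, Finset.sum_add_distrib, Finset.sum_sub_distrib, ← Finset.mul_sum,
      ← Finset.sum_mul, hF0, hH0, laplacian_eq_sum_basisVec]
    ring

/-- Green's identity on the sphere. -/
theorem integral_laplacian_mul_eq (hn : n ≠ 0) (hF : IsZeroHomogeneous F)
    (hH : IsZeroHomogeneous H) :
    ∫ u : Sph n, Laplacian.laplacian F (u : E n) * H u ∂(volume : Measure (E n)).toSphere =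
      ∫ u : Sph n, F u * Laplacian.laplacian H (u : E n) ∂(volume : Measure (E n)).toSphere := by
  have hint : ∀ f : Sph n → ℂ, Continuous f →
      Integrable f (volume : Measure (E n)).toSphere := fun f hf =>
    hf.integrable_of_hasCompactSupport (HasCompactSupport.of_compactSpace f)
  rw [← sub_eq_zero, ← integral_sub
    (hint (fun u => Laplacian.laplacian F (u : E n) * H u)
      (hF.continuous_laplacian_sphere.mul hH.continuous_sphere))
    (hint (fun u => F u * Laplacian.laplacian H (u : E n))
      (hF.continuous_sphere.mul hH.continuous_laplacian_sphere))]
  have h0 := integral_radialCutoff_mul hF hH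
  rw [integral_polar hn] at h0
  have hsph : ∀ u : Sph n, ‖(u : E n)‖ = 1 := fun u => mem_sphere_zero_iff_norm.mp u.2
  -- The factor |x|² in the cutoff cancels the degree −2 of the Laplacians, so the integrand splits
  -- into a function on the sphere times a radial bump.
  have h1 : ∀ p : Sph n × Set.Ioi (0 : ℝ), (radialCutoff ((p.2 : ℝ) • (p.1 : E n)) : ℂ) *
      (Laplacian.laplacian F ((p.2 : ℝ) • (p.1 : E n)) * H ((p.2 : ℝ) • (p.1 : E n)) -
        F ((p.2 : ℝ) • (p.1 : E n)) * Laplacian.laplacian H ((p.2 : ℝ) • (p.1 : E n))) =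
      (Laplacian.laplacian F (p.1 : E n) * H p.1 - F p.1 * Laplacian.laplacian H (p.1 : E n)) *
        (cutoffProfile ((p.2 : ℝ) ^ 2) : ℂ) := fun p => by
    have hr : (0 : ℝ) < p.2 := p.2.2
    have hrc : ((p.2 : ℝ) : ℂ) ≠ 0 := by exact_mod_cast hr.ne'
    have hu := ne_zero_of_mem_unit_sphere p.1
    rw [hF.laplacian_smul hr hu, hH.laplacian_smul hr hu, hF.smul _ hr _ hu, hH.smul _ hr _ hu,
      radialCutoff, norm_smul, hsph, mul_one, Real.norm_of_nonneg hr.le]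
    push_cast
    field_simp
  simp only [h1] at h0
  rw [integral_prod_mul (fun u : Sph n =>
    Laplacian.laplacian F (u : E n) * H u - F u * Laplacian.laplacian H (u : E n))
    (fun r : Set.Ioi (0 : ℝ) => (cutoffProfile ((r : ℝ) ^ 2) : ℂ))] at h0
  -- If the radial factor vanished, polar coordinates would give integral zero to the nonnegative,
  -- nonzero bump x ↦ `cutoffProfile (‖x‖ ^ 2)`.
  refine (mul_eq_zero.mp h0).resolve_right fun hzero => ?_
  have h2 : ∫ x : E n, ((cutoffProfile (‖x‖ ^ 2) : ℝ) : ℂ) = 0 := by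
    rw [integral_polar hn]
    have h3 : ∀ p : Sph n × Set.Ioi (0 : ℝ),
        ((cutoffProfile (‖(p.2 : ℝ) • (p.1 : E n)‖ ^ 2) : ℝ) : ℂ) =
          (fun _ : Sph n => (1 : ℂ)) p.1 * ((cutoffProfile ((p.2 : ℝ) ^ 2) : ℝ) : ℂ) := fun p => by
      have hr : (0 : ℝ) < p.2 := p.2.2
      rw [norm_smul, hsph, mul_one, Real.norm_of_nonneg hr.le, one_mul]
    simp only [h3]
    rw [integral_prod_mul (fun _ : Sph n => (1 : ℂ))
      (fun r : Set.Ioi (0 : ℝ) => (cutoffProfile ((r : ℝ) ^ 2) : ℂ)), hzero, mul_zero]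
  rw [integral_complex_ofReal, Complex.ofReal_eq_zero] at h2
  have h4 : 0 < ∫ x : E n, cutoffProfile (‖x‖ ^ 2) := by
    refine Continuous.integral_pos_of_hasCompactSupport_nonneg_nonzero
      (x := basisVec ⟨0, Nat.pos_of_ne_zero hn⟩) (cutoffProfile.continuous.comp (by fun_prop)) ?_
      (fun x => cutoffProfile.nonneg) ?_
    · refine HasCompactSupport.intro (isCompact_closedBall (0 : E n) 2) fun x hx => ?_
      rw [mem_closedBall_zero_iff, not_le] at hx
      apply cutoffProfile_eq_zero
      rw [abs_of_nonneg (by nlinarith)]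
      nlinarith
    · have h5 : cutoffProfile (1 : ℝ) = 1 := cutoffProfile.one_of_mem_closedBall
        (Metric.mem_closedBall_self cutoffProfile.rIn_pos.le)
      simp [basisVec, h5]
  exact h4.ne' h2

end IsZeroHomogeneous

end sphere

/-! ### Integrals of test functions on `Y n` against ridgelets -/

section synthesis

variable {n : ℕ}

instance : IsTopologicalAddGroup (SchwartzY n) := (withSeminorms_schwartzY n).topologicalAddGroup

/-- The product measure `du db da` on `Y n`. -/
def prodMeasure (n : ℕ) : Measure (Y n) :=
  (volume : Measure (E n)).toSphere.prod
    ((volume : Measure ℝ).prod ((volume : Measure ℝ).comap Subtype.val))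

instance : SFinite ((volume : Measure ℝ).comap (Subtype.val : Set.Ioi (0 : ℝ) → ℝ)) := by
  have h : Measure.volumeIoiPow 0 = (volume : Measure ℝ).comap Subtype.val := by
    simp [Measure.volumeIoiPow]
  rw [← h]
  infer_instance

theorem continuous_fn (Φ : SchwartzY n) : Continuous Φ.fn := by
  have h : Φ.fn = fun y => ext Φ.fn (coeY y) := funext fun y => (ext_coeY Φ.fn y).symm
  rw [h]
  exact (ContDiffOn.continuousOn Φ.1.2).comp_continuous (by unfold coeY; fun_prop) coeY_mem

/-- An integrable majorant. -/
def majorant (y : Y n) : ℝ := (1 + y.2.1 ^ 2)⁻¹ * (1 + (y.2.2 : ℝ) ^ 2)⁻¹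

theorem majorant_nonneg (y : Y n) : 0 ≤ majorant y := by unfold majorant; positivity

theorem integrable_majorant : Integrable (majorant : Y n → ℝ) (prodMeasure n) := by
  have h1 : Integrable (fun a : Set.Ioi (0 : ℝ) => (1 + (a : ℝ) ^ 2)⁻¹)
      ((volume : Measure ℝ).comap Subtype.val) :=
    (integrableOn_iff_comap_subtypeVal measurableSet_Ioi).mp integrable_inv_one_add_sq.integrableOn
  have h2 := (integrable_const (μ := (volume : Measure (E n)).toSphere) (1 : ℝ)).mul_prod
    (integrable_inv_one_add_sq.mul_prod h1)
  unfold majorant prodMeasure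
  simpa using h2

/-- The weight a^s + a^(−s) with s = |i| + 2 controls a^i of either sign: its first summand for a ≥
1, its second for a ≤ 1. The extra 2 pays for the factor 1 + a². -/
theorem zpow_mul_one_add_sq_le {a : ℝ} (ha : 0 < a) (i : ℤ) :
    a ^ i * (1 + a ^ 2) ≤ 2 * (a ^ (i.natAbs + 2) + 1 / a ^ (i.natAbs + 2)) := by
  rcases le_total 1 a with h | h
  · have h1 : a ^ i ≤ a ^ i.natAbs := by
      rw [← zpow_natCast]
      exact zpow_le_zpow_right₀ h Int.le_natAbs
    have h2 : 1 + a ^ 2 ≤ 2 * a ^ 2 := by nlinarith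
    have h3 : 0 ≤ 1 / a ^ (i.natAbs + 2) := by positivity
    calc a ^ i * (1 + a ^ 2) ≤ a ^ i.natAbs * (2 * a ^ 2) := by gcongr
      _ = 2 * a ^ (i.natAbs + 2) := by ring
      _ ≤ _ := by linarith
  · have h1 : a ^ i ≤ 1 / a ^ (i.natAbs + 2) := by
      rw [one_div, ← zpow_natCast, ← zpow_neg]
      refine zpow_le_zpow_right_of_le_one₀ ha h ?_
      have : -i ≤ (i.natAbs : ℤ) := by omega
      push_cast at this ⊢
      omega
    have h2 : 1 + a ^ 2 ≤ 2 := by nlinarith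
    have h3 : 0 ≤ a ^ (i.natAbs + 2) := by positivity
    calc a ^ i * (1 + a ^ 2) ≤ 1 / a ^ (i.natAbs + 2) * 2 := by gcongr
      _ ≤ _ := by linarith

/-- The index of the seminorm exceeds |i| and j by 2, which leaves the integrable factor (1 + a²)⁻¹
(1 + b²)⁻¹. -/
theorem norm_fn_mul_le (i : ℤ) (j : ℕ) (Φ : SchwartzY n) (y : Y n) :
    ‖Φ.fn y‖ * ((y.2.2 : ℝ) ^ i * |y.2.1| ^ j) ≤
      2 * seminormY n ⟨0, 0, 0, i.natAbs + 2, j + 2⟩ Φ * majorant y := by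
  set I : Idx := ⟨0, 0, 0, i.natAbs + 2, j + 2⟩ with hI
  have ha : (0 : ℝ) < y.2.2 := y.2.2.2
  have h1 : weight I y * ‖Φ.fn y‖ ≤ seminormY n I Φ := le_ciSup (Φ.2 I) y
  have h2 : (y.2.2 : ℝ) ^ i * |y.2.1| ^ j ≤ 2 * weight I y * majorant y := by
    have h3 := zpow_mul_one_add_sq_le ha i
    have h4 : |y.2.1| ^ j * (1 + y.2.1 ^ 2) ≤ (1 + y.2.1 ^ 2) ^ (((j + 2 : ℕ) : ℝ) / 2) := by
      have h5 : |y.2.1| ^ j ≤ (1 + y.2.1 ^ 2) ^ ((j : ℝ) / 2) := by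
        calc |y.2.1| ^ j = (y.2.1 ^ 2) ^ ((j : ℝ) / 2) := by
              rw [← sq_abs, ← Real.rpow_natCast_mul (abs_nonneg _), ← Real.rpow_natCast]
              congr 1
              push_cast
              ring
          _ ≤ _ := by gcongr; linarith
      have h6 : (1 + y.2.1 ^ 2) ^ (((j + 2 : ℕ) : ℝ) / 2) =
          (1 + y.2.1 ^ 2) ^ ((j : ℝ) / 2) * (1 + y.2.1 ^ 2) := by
        rw [← Real.rpow_add_one (by positivity)]
        congr 1
        push_cast
        ring
      rw [h6]
      gcongr
    have h7 : (y.2.2 : ℝ) ^ i * |y.2.1| ^ j = ((y.2.2 : ℝ) ^ i * (1 + (y.2.2 : ℝ) ^ 2)) *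
        (|y.2.1| ^ j * (1 + y.2.1 ^ 2)) * majorant y := by
      unfold majorant
      have : 1 + y.2.1 ^ 2 ≠ 0 := by positivity
      field_simp
    rw [h7]
    refine mul_le_mul_of_nonneg_right ?_ (majorant_nonneg y)
    exact (mul_le_mul h3 h4 (by positivity) (by positivity)).trans_eq (mul_assoc 2 _ _)
  calc ‖Φ.fn y‖ * ((y.2.2 : ℝ) ^ i * |y.2.1| ^ j)
      ≤ ‖Φ.fn y‖ * (2 * weight I y * majorant y) := by gcongr
    _ = 2 * (weight I y * ‖Φ.fn y‖) * majorant y := by ring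
    _ ≤ _ := by
      have := majorant_nonneg y
      gcongr

/-- The kernel `a ^ i b ^ j (x · u) ^ l P(u) ψ((x · u - b) / a)`. -/
def synKer (i : ℤ) (j l : ℕ) (P : E n → ℂ) (ψ : LizorkinLine) (x : E n) (y : Y n) : ℂ :=
  ((y.2.2 : ℝ) : ℂ) ^ i * (y.2.1 : ℂ) ^ j * ((inner ℝ x (y.1 : E n) : ℝ) : ℂ) ^ l *
    P (y.1 : E n) * ψ.1 ((inner ℝ x (y.1 : E n) - y.2.1) / (y.2.2 : ℝ))

theorem continuous_synKer (i : ℤ) (j l : ℕ) {P : E n → ℂ} (hP : Continuous P) (ψ : LizorkinLine)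
    (x : E n) : Continuous (synKer i j l P ψ x) := by
  have ha : ∀ y : Y n, (((y.2.2 : ℝ) : ℂ)) ≠ 0 := fun y => by
    exact_mod_cast (ne_of_gt y.2.2.2 : (y.2.2 : ℝ) ≠ 0)
  have h1 : Continuous fun y : Y n => ((y.2.2 : ℝ) : ℂ) ^ i :=
    Continuous.zpow₀ (by fun_prop) i fun y => Or.inl (ha y)
  have h2 : Continuous fun y : Y n => (inner ℝ x (y.1 : E n) - y.2.1) / (y.2.2 : ℝ) :=
    Continuous.div (by fun_prop) (by fun_prop) fun y => ne_of_gt y.2.2.2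
  unfold synKer
  have h3 := ψ.1.continuous.comp h2
  simp only [Function.comp_def] at h3
  fun_prop

theorem exists_norm_le_sphere {P : E n → ℂ} (hP : Continuous P) :
    ∃ C, 0 ≤ C ∧ ∀ u : Sph n, ‖P u‖ ≤ C := by
  obtain ⟨C, hC⟩ := (isCompact_sphere (0 : E n) 1).exists_bound_of_continuousOn hP.continuousOn
  exact ⟨max C 0, le_max_right _ _, fun u => (hC u u.2).trans (le_max_left _ _)⟩

theorem exists_norm_synKer_le (i : ℤ) (j l : ℕ) {P : E n → ℂ} (hP : Continuous P)
    (ψ : LizorkinLine) :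
    ∃ C, 0 ≤ C ∧ ∀ Φ : SchwartzY n, ∀ x y, ‖Φ.fn y * synKer i j l P ψ x y‖ ≤
      C * ‖x‖ ^ l * (seminormY n ⟨0, 0, 0, i.natAbs + 2, j + 2⟩ Φ * majorant y) := by
  obtain ⟨C, hC0, hC⟩ := exists_norm_le_sphere hP
  obtain ⟨D, hD0, hD⟩ := exists_norm_le_line ψ.1
  refine ⟨2 * C * D, by positivity, fun Φ x y => ?_⟩
  have ha : (0 : ℝ) < y.2.2 := y.2.2.2
  have hx : |inner ℝ x (y.1 : E n)| ≤ ‖x‖ := by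
    have := abs_real_inner_le_norm x (y.1 : E n)
    rwa [mem_sphere_zero_iff_norm.mp y.1.2, mul_one] at this
  have h1 : ‖synKer i j l P ψ x y‖ ≤
      ((y.2.2 : ℝ) ^ i * |y.2.1| ^ j) * (‖x‖ ^ l * C * D) := by
    unfold synKer
    rw [norm_mul, norm_mul, norm_mul, norm_mul, norm_zpow, norm_pow, norm_pow, Complex.norm_real,
      Complex.norm_real, Complex.norm_real, Real.norm_of_nonneg ha.le, mul_assoc, mul_assoc,
      Real.norm_eq_abs, Real.norm_eq_abs, mul_assoc (‖x‖ ^ l)]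
    gcongr
    · exact hC _
    · exact hD _
  have h2 := norm_fn_mul_le i j Φ y
  rw [norm_mul]
  calc ‖Φ.fn y‖ * ‖synKer i j l P ψ x y‖
      ≤ ‖Φ.fn y‖ * (((y.2.2 : ℝ) ^ i * |y.2.1| ^ j) * (‖x‖ ^ l * C * D)) := by gcongr
    _ = ‖Φ.fn y‖ * ((y.2.2 : ℝ) ^ i * |y.2.1| ^ j) * (‖x‖ ^ l * C * D) := by ring
    _ ≤ 2 * seminormY n ⟨0, 0, 0, i.natAbs + 2, j + 2⟩ Φ * majorant y * (‖x‖ ^ l * C * D) := by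
      gcongr
    _ = _ := by ring

theorem integrable_synKer (i : ℤ) (j l : ℕ) {P : E n → ℂ} (hP : Continuous P)
    (ψ : LizorkinLine) (Φ : SchwartzY n) (x : E n) :
    Integrable (fun y => Φ.fn y * synKer i j l P ψ x y) (prodMeasure n) := by
  obtain ⟨C, -, hC⟩ := exists_norm_synKer_le i j l hP ψ
  exact ((integrable_majorant.const_mul _).const_mul _).mono'
    ((continuous_fn Φ).mul (continuous_synKer i j l hP ψ x)).aestronglyMeasurable
    (.of_forall (hC Φ x))

/-- The integral of a test function against `synKer`. -/
def synInt (i : ℤ) (j l : ℕ) (P : E n → ℂ) (ψ : LizorkinLine) (Φ : SchwartzY n) (x : E n) : ℂ :=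
  ∫ y, Φ.fn y * synKer i j l P ψ x y ∂prodMeasure n

theorem dominated_synInt (i : ℤ) (j : ℕ) {P : E n → ℂ} (hP : Continuous P) (ψ : LizorkinLine) :
    Dominated (synInt (n := n) i j 0 P ψ) := by
  obtain ⟨C, hC0, hC⟩ := exists_norm_synKer_le i j 0 hP ψ
  set I : Idx := ⟨0, 0, 0, i.natAbs + 2, j + 2⟩ with hI
  set M := ∫ y, majorant y ∂prodMeasure n with hM
  have hM0 : 0 ≤ M := integral_nonneg majorant_nonneg
  refine ⟨(C * M).toNNReal • seminormY n I,
    ((withSeminorms_schwartzY n).continuous_seminorm I).const_smul (C * M).toNNReal,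
    fun Φ x => ?_⟩
  change _ ≤ ((C * M).toNNReal : ℝ) * seminormY n I Φ
  rw [Real.coe_toNNReal _ (by positivity)]
  have h1 : C * M * seminormY n I Φ = ∫ y, C * (seminormY n I Φ * majorant y) ∂prodMeasure n := by
    rw [integral_const_mul, integral_const_mul]
    ring
  rw [h1]
  refine norm_integral_le_of_norm_le ((integrable_majorant.const_mul _).const_mul _)
    (.of_forall fun y => ?_)
  simpa using hC Φ x y

/-- With t = (x·u − b)/a, the argument of ψ, one has x·u = a t + b. Factors x·u, which grow with x,
are thus absorbed by powers of a and b, which Φ controls. -/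
theorem synInt_succ_inner (i : ℤ) (j l : ℕ) {P : E n → ℂ} (hP : Continuous P) (ψ : LizorkinLine)
    (Φ : SchwartzY n) (x : E n) :
    synInt i j (l + 1) P ψ Φ x =
      synInt (i + 1) j l P (mulLine ψ) Φ x + synInt i (j + 1) l P ψ Φ x := by
  unfold synInt
  rw [← integral_add (integrable_synKer _ _ _ hP _ _ _) (integrable_synKer _ _ _ hP _ _ _)]
  refine integral_congr_ae (.of_forall fun y => ?_)
  have ha : ((y.2.2 : ℝ) : ℂ) ≠ 0 := by
    exact_mod_cast (ne_of_gt y.2.2.2 : (y.2.2 : ℝ) ≠ 0)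
  simp only [synKer, mulLine_apply, zpow_add_one₀ ha]
  push_cast
  field_simp
  ring

/-- The derivative of `x ↦ Φ y * synKer i j 0 P ψ x y`. -/
def synIntegrand (i : ℤ) (j : ℕ) (P : E n → ℂ) (ψ : LizorkinLine) (Φ : SchwartzY n) (x : E n)
    (y : Y n) : E n →L[ℝ] ℂ :=
  (Φ.fn y * synKer (i - 1) j 0 P (dLine ψ) x y) • (Complex.ofRealCLM ∘L innerSL ℝ (y.1 : E n))

theorem hasFDerivAt_synKer (i : ℤ) (j : ℕ) (P : E n → ℂ) (ψ : LizorkinLine) (Φ : SchwartzY n)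
    (x : E n) (y : Y n) :
    HasFDerivAt (fun x => Φ.fn y * synKer i j 0 P ψ x y) (synIntegrand i j P ψ Φ x y) x := by
  have ha : ((y.2.2 : ℝ) : ℂ) ≠ 0 := by
    exact_mod_cast (ne_of_gt y.2.2.2 : (y.2.2 : ℝ) ≠ 0)
  have h1 : HasFDerivAt (fun x : E n => (inner ℝ x (y.1 : E n) - y.2.1) / (y.2.2 : ℝ))
      ((y.2.2 : ℝ)⁻¹ • innerSL ℝ (y.1 : E n)) x := by
    have h0 : HasFDerivAt (fun x : E n => inner ℝ x (y.1 : E n)) (innerSL ℝ (y.1 : E n)) x := by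
      simpa [real_inner_comm] using (innerSL ℝ (y.1 : E n)).hasFDerivAt (x := x)
    have := (h0.sub_const y.2.1).fun_const_smul (y.2.2 : ℝ)⁻¹
    simpa [div_eq_inv_mul] using this
  have h2 := HasFDerivAt.comp
    (f := fun x : E n => (inner ℝ x (y.1 : E n) - y.2.1) / (y.2.2 : ℝ)) x
    (hasDerivAt_line ψ _).hasFDerivAt h1
  have h3 := h2.const_mul (Φ.fn y * (((y.2.2 : ℝ) : ℂ) ^ i * (y.2.1 : ℂ) ^ j * P (y.1 : E n)))
  have h4 : (fun x => Φ.fn y * synKer i j 0 P ψ x y) = fun x =>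
      (Φ.fn y * (((y.2.2 : ℝ) : ℂ) ^ i * (y.2.1 : ℂ) ^ j * P (y.1 : E n))) *
        ψ.1 ((inner ℝ x (y.1 : E n) - y.2.1) / (y.2.2 : ℝ)) := by
    funext x
    simp only [synKer, pow_zero]
    ring
  rw [h4]
  refine h3.congr_fderiv (ContinuousLinearMap.ext fun v => ?_)
  simp only [synIntegrand, synKer, FunLike.coe_smul, Pi.smul_apply, smul_eq_mul,
    ContinuousLinearMap.comp_apply, Complex.ofRealCLM_apply, zpow_sub_one₀ ha, pow_zero]
  simp
  ring

theorem continuous_synIntegrand (i : ℤ) (j : ℕ) {P : E n → ℂ} (hP : Continuous P)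
    (ψ : LizorkinLine) (Φ : SchwartzY n) (x : E n) : Continuous (synIntegrand i j P ψ Φ x) := by
  have h1 := continuous_synKer (i - 1) j 0 hP (dLine ψ) x
  have h2 := continuous_fn Φ
  unfold synIntegrand
  fun_prop

theorem norm_synIntegrand_le (i : ℤ) (j : ℕ) (P : E n → ℂ) (ψ : LizorkinLine) (Φ : SchwartzY n)
    (x : E n) (y : Y n) :
    ‖synIntegrand i j P ψ Φ x y‖ ≤ ‖Φ.fn y * synKer (i - 1) j 0 P (dLine ψ) x y‖ := by
  refine ContinuousLinearMap.opNorm_le_bound _ (norm_nonneg _) fun v => ?_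
  have h : synIntegrand i j P ψ Φ x y v = (Φ.fn y * synKer (i - 1) j 0 P (dLine ψ) x y) *
    ((inner ℝ (y.1 : E n) v : ℝ) : ℂ) := rfl
  rw [h, norm_mul _ ((inner ℝ (y.1 : E n) v : ℝ) : ℂ), Complex.norm_real]
  gcongr
  have := norm_inner_le_norm (𝕜 := ℝ) (y.1 : E n) v
  rwa [mem_sphere_zero_iff_norm.mp y.1.2, one_mul] at this

/-- The product of a function with the `k`-th coordinate. -/
def mulCoordFun (k : Fin n) (P : E n → ℂ) (u : E n) : ℂ := P u * ((u k : ℝ) : ℂ)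

theorem contDiff_mulCoordFun (k : Fin n) {P : E n → ℂ} (hP : ContDiff ℝ ∞ P) :
    ContDiff ℝ ∞ (mulCoordFun k P) := hP.mul (coordCLM k).contDiff

/-- The total derivative of `synInt i j 0 P ψ Φ`. -/
def synDeriv (i : ℤ) (j : ℕ) (P : E n → ℂ) (ψ : LizorkinLine) (Φ : SchwartzY n) (x : E n) :
    E n →L[ℝ] ℂ :=
  ∑ k, synInt (i - 1) j 0 (mulCoordFun k P) (dLine ψ) Φ x • coordCLM k

theorem synDeriv_apply (i : ℤ) (j : ℕ) (P : E n → ℂ) (ψ : LizorkinLine) (Φ : SchwartzY n)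
    (x v : E n) : synDeriv i j P ψ Φ x v =
      ∑ k, (v k : ℂ) * synInt (i - 1) j 0 (mulCoordFun k P) (dLine ψ) Φ x := by
  simp [synDeriv, mul_comm]

theorem hasFDerivAt_synInt (i : ℤ) (j : ℕ) {P : E n → ℂ} (hP : Continuous P)
    (ψ : LizorkinLine) (Φ : SchwartzY n) (x : E n) :
    HasFDerivAt (synInt i j 0 P ψ Φ) (synDeriv i j P ψ Φ x) x := by
  obtain ⟨C, hC0, hC⟩ := exists_norm_synKer_le (i - 1) j 0 hP (dLine ψ)
  have hb : ∀ x y, ‖synIntegrand i j P ψ Φ x y‖ ≤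
      C * (seminormY n ⟨0, 0, 0, (i - 1).natAbs + 2, j + 2⟩ Φ * majorant y) := fun x y =>
    (norm_synIntegrand_le i j P ψ Φ x y).trans (by simpa using hC Φ x y)
  have hbi : Integrable (fun y : Y n =>
      C * (seminormY n ⟨0, 0, 0, (i - 1).natAbs + 2, j + 2⟩ Φ * majorant y)) (prodMeasure n) :=
    (integrable_majorant.const_mul _).const_mul _
  have hi : Integrable (synIntegrand i j P ψ Φ x) (prodMeasure n) :=
    hbi.mono' (continuous_synIntegrand i j hP ψ Φ x).aestronglyMeasurable (.of_forall (hb x))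
  have hval : ∫ y, synIntegrand i j P ψ Φ x y ∂prodMeasure n = synDeriv i j P ψ Φ x := by
    refine ContinuousLinearMap.ext fun v => ?_
    rw [ContinuousLinearMap.integral_apply hi, synDeriv_apply]
    unfold synInt
    simp only [← integral_const_mul]
    rw [← integral_finsetSum _ fun k _ => (integrable_synKer (i - 1) j 0
      (P := mulCoordFun k P) (hP.mul (coordCLM k).continuous) (dLine ψ) Φ x).const_mul (v k : ℂ)]
    refine integral_congr_ae (.of_forall fun y => ?_)
    have h : synIntegrand i j P ψ Φ x y v = (Φ.fn y * synKer (i - 1) j 0 P (dLine ψ) x y) *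
      ((inner ℝ (y.1 : E n) v : ℝ) : ℂ) := rfl
    dsimp only
    rw [h, inner_eq_sum (y.1 : E n) v]
    push_cast
    rw [Finset.mul_sum]
    refine Finset.sum_congr rfl fun k _ => ?_
    simp only [synKer, mulCoordFun]
    ring
  rw [← hval]
  exact hasFDerivAt_integral_of_dominated_of_fderiv_le (s := Set.univ) Filter.univ_mem
    (.of_forall fun x => (integrable_synKer _ _ _ hP _ _ _).aestronglyMeasurable)
    (integrable_synKer _ _ _ hP _ _ _) (continuous_synIntegrand i j hP ψ Φ x).aestronglyMeasurable
    (.of_forall fun y x _ => hb x y) hbi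
    (.of_forall fun y x _ => hasFDerivAt_synKer i j P ψ Φ x y)

theorem contDiff_synInt (i : ℤ) (j : ℕ) {P : E n → ℂ} (hP : ContDiff ℝ ∞ P)
    (ψ : LizorkinLine) (Φ : SchwartzY n) : ContDiff ℝ ∞ (synInt i j 0 P ψ Φ) := by
  rw [contDiff_infty]
  intro m
  induction m generalizing i P ψ with
  | zero =>
    exact contDiff_zero.mpr (continuous_iff_continuousAt.mpr fun x =>
      (hasFDerivAt_synInt i j hP.continuous ψ Φ x).continuousAt)
  | succ m ih =>
    refine contDiff_succ_iff_hasFDerivAt.mpr ⟨_, ?_, hasFDerivAt_synInt i j hP.continuous ψ Φ⟩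
    unfold synDeriv
    exact ContDiff.sum fun k _ => (ih _ (contDiff_mulCoordFun k hP) _).smul contDiff_const

end synthesis

/-! ### Decay of the synthesis integrals -/

section decay

variable {n : ℕ}

/-! ### The Laplace–Beltrami operator on test functions and its symmetry -/

theorem derivY_opL (i : Idx) (F : smoothFun n) :
    derivY i (opL n F) = derivY ⟨i.l, i.m, i.k + 1, i.s, i.r⟩ F := by
  simp only [derivY, pow_succ, Module.End.mul_apply]

theorem weighted_opL (i : Idx) (F : smoothFun n) (y : Y n) :
    weighted i (opL n F) y = weighted ⟨i.l, i.m, i.k + 1, i.s, i.r⟩ F y := by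
  unfold weighted
  rw [derivY_opL]
  rfl

theorem opL_mem (Φ : SchwartzY n) : opL n Φ.1 ∈ schwartzYSubmodule n := fun i => by
  rw [funext (weighted_opL i Φ.1)]
  exact Φ.2 _

/-- The Laplace-Beltrami operator on the test functions. -/
def lapYLinear (n : ℕ) : SchwartzY n →ₗ[ℂ] SchwartzY n where
  toFun Φ := ⟨opL n Φ.1, opL_mem Φ⟩
  map_add' Φ Θ := Subtype.ext ((opL n).map_add Φ.1 Θ.1)
  map_smul' c Φ := Subtype.ext ((opL n).map_smul c Φ.1)

theorem seminormY_lapYLinear (i : Idx) (Φ : SchwartzY n) :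
    seminormY n i (lapYLinear n Φ) = seminormY n ⟨i.l, i.m, i.k + 1, i.s, i.r⟩ Φ :=
  congrArg iSup (funext fun y => weighted_opL i Φ.1 y)

theorem continuous_lapYLinear : Continuous (lapYLinear n) :=
  (withSeminorms_schwartzY n).continuous_of_continuous_comp (lapYLinear n) fun i =>
    Seminorm.continuous_of_le
      ((withSeminorms_schwartzY n).continuous_seminorm ⟨i.l, i.m, i.k + 1, i.s, i.r⟩)
      fun Φ => (seminormY_lapYLinear i Φ).le

/-- The Laplace-Beltrami operator as a continuous operator on the test functions. -/
def lapY (n : ℕ) : SchwartzY n →L[ℂ] SchwartzY n := ⟨lapYLinear n, continuous_lapYLinear⟩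

theorem ext_smul_left (F : Y n → ℂ) {r : ℝ} (hr : 0 < r) {x : E n} (hx : x ≠ 0) (q : ℝ × ℝ) :
    ext F (r • x, q) = ext F (x, q) := by
  unfold ext
  have h : (r • x, q) ∈ dom n ↔ (x, q) ∈ dom n := by
    simp [dom, hx, hr.ne']
  by_cases hq : (x, q) ∈ dom n
  · rw [dif_pos hq, dif_pos (h.mpr hq)]
    congr 1
    refine Prod.ext (Subtype.ext ?_) rfl
    simp only [proj, norm_smul, Real.norm_of_nonneg hr.le, smul_smul]
    congr 1
    field_simp
  · rw [dif_neg hq, dif_neg (mt h.mp hq)]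

theorem ext_eq_of_forall {F : Y n → ℂ} {g : E n → ℂ} (b : ℝ) (a : Set.Ioi (0 : ℝ))
    (h : ∀ u : Sph n, F (u, b, a) = g u) {v : E n} (hv : v ≠ 0) :
    ext F (v, b, (a : ℝ)) = g (‖v‖⁻¹ • v) := by
  rw [ext_of_mem F (show (v, b, (a : ℝ)) ∈ dom n from ⟨hv, a.2⟩)]
  exact h _

theorem isZeroHomogeneous_ext {F : Y n → ℂ} {b : ℝ} {a : Set.Ioi (0 : ℝ)}
    (h : ContDiffOn ℝ ∞ (fun v : E n => ext F (v, b, (a : ℝ))) {0}ᶜ) :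
    IsZeroHomogeneous fun v : E n => ext F (v, b, (a : ℝ)) :=
  ⟨h, fun _ hr _ hx => ext_smul_left F hr hx _⟩

theorem SmoothY.isZeroHomogeneous {F : Y n → ℂ} (hF : SmoothY F) (b : ℝ) (a : Set.Ioi (0 : ℝ)) :
    IsZeroHomogeneous fun v : E n => ext F (v, b, (a : ℝ)) :=
  isZeroHomogeneous_ext (ContDiffOn.comp hF (f := fun v : E n => (v, b, (a : ℝ)))
    (by fun_prop) fun _ hv => ⟨hv, a.2⟩)

theorem isZeroHomogeneous_ext_of_forall {F : Y n → ℂ} {g : E n → ℂ} {b : ℝ} {a : Set.Ioi (0 : ℝ)}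
    (h : ∀ u : Sph n, F (u, b, a) = g u) (hg : ContDiff ℝ ∞ g) :
    IsZeroHomogeneous fun v : E n => ext F (v, b, (a : ℝ)) := by
  refine isZeroHomogeneous_ext (ContDiffOn.congr (f := fun v : E n => g (‖v‖⁻¹ • v)) ?_
    fun v hv => ext_eq_of_forall b a h hv)
  intro v hv
  have hv0 : v ≠ 0 := hv
  exact (hg.contDiffAt.comp v (((contDiffAt_norm ℝ hv0).inv
    (norm_ne_zero_iff.mpr hv0)).smul contDiffAt_id)).contDiffWithinAt

/-- Symmetry of the Laplace-Beltrami operator on `Y n`. -/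
theorem integral_lapU_mul_eq (hn : n ≠ 0) {F H : Y n → ℂ}
    (hF : ∀ b a, IsZeroHomogeneous fun v : E n => ext F (v, b, ((a : Set.Ioi (0 : ℝ)) : ℝ)))
    (hH : ∀ b a, IsZeroHomogeneous fun v : E n => ext H (v, b, ((a : Set.Ioi (0 : ℝ)) : ℝ)))
    (h1 : Integrable (fun y => lapU F y * H y) (prodMeasure n))
    (h2 : Integrable (fun y => F y * lapU H y) (prodMeasure n)) :
    ∫ y, lapU F y * H y ∂prodMeasure n = ∫ y, F y * lapU H y ∂prodMeasure n := by
  unfold prodMeasure at h1 h2 ⊢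
  rw [integral_prod_symm _ h1, integral_prod_symm _ h2]
  refine integral_congr_ae (.of_forall fun q => ?_)
  have h := IsZeroHomogeneous.integral_laplacian_mul_eq hn (hF q.1 q.2) (hH q.1 q.2)
  have e1 : ∀ (G : Y n → ℂ) (u : Sph n), ext G ((u : E n), q.1, (q.2 : ℝ)) = G (u, q) :=
    fun G u => ext_coeY G (u, q)
  simp only [e1] at h
  exact h

/-! ### The Laplace–Beltrami operator applied to ridgelet kernels -/

section kernel

variable (P : E n → ℂ) (ψ : LizorkinLine) (x : E n) (b a : ℝ)

/-- The function `v ↦ P v * ψ ((x · v - b) / a)`. -/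
def ridgeSlice (v : E n) : ℂ := P v * ψ.1 ((inner ℝ x v - b) / a)

variable {P}

theorem contDiff_ridgeSlice (hP : ContDiff ℝ ∞ P) : ContDiff ℝ ∞ (ridgeSlice P ψ x b a) := by
  have h : ContDiff ℝ ∞ fun v : E n => (inner ℝ x v - b) / a :=
    ((innerSL ℝ x).contDiff.sub contDiff_const).div_const a
  exact hP.mul ((ψ.1.smooth ⊤).comp h)

theorem hasFDerivAt_line_inner (v : E n) :
    HasFDerivAt (fun v : E n => ψ.1 ((inner ℝ x v - b) / a))
      (((a⁻¹ : ℝ) * (dLine ψ).1 ((inner ℝ x v - b) / a)) •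
        (Complex.ofRealCLM ∘L innerSL ℝ x)) v := by
  have h1 : HasFDerivAt (fun v : E n => (inner ℝ x v - b) / a) (a⁻¹ • innerSL ℝ x) v := by
    have := ((innerSL ℝ x).hasFDerivAt (x := v)).sub_const b |>.fun_const_smul a⁻¹
    simpa [div_eq_inv_mul] using this
  have h2 := HasFDerivAt.comp (f := fun v : E n => (inner ℝ x v - b) / a) v
    (hasDerivAt_line ψ _).hasFDerivAt h1
  refine h2.congr_fderiv (ContinuousLinearMap.ext fun e => ?_)
  simp
  ring

theorem fderiv_ridgeSlice (hP : ContDiff ℝ ∞ P) (v : E n) :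
    fderiv ℝ (ridgeSlice P ψ x b a) v =
      (P v * ((a⁻¹ : ℝ) * (dLine ψ).1 ((inner ℝ x v - b) / a))) •
        (Complex.ofRealCLM ∘L innerSL ℝ x) + ψ.1 ((inner ℝ x v - b) / a) • fderiv ℝ P v := by
  have hPd : DifferentiableAt ℝ P v := hP.contDiffAt.differentiableAt (by simp)
  have h := (hPd.hasFDerivAt.fun_mul (hasFDerivAt_line_inner ψ x b a v)).fderiv
  rw [smul_smul] at h
  exact h

theorem fderiv_ridgeSlice_apply (hP : ContDiff ℝ ∞ P) (v e : E n) :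
    fderiv ℝ (ridgeSlice P ψ x b a) v e =
      P v * ((a⁻¹ : ℝ) * (dLine ψ).1 ((inner ℝ x v - b) / a)) * (inner ℝ x e : ℝ) +
        ψ.1 ((inner ℝ x v - b) / a) * fderiv ℝ P v e := by
  rw [fderiv_ridgeSlice ψ x b a hP]
  rfl

theorem fderiv_fderiv_ridgeSlice (hP : ContDiff ℝ ∞ P) (v e : E n) :
    fderiv ℝ (fderiv ℝ (ridgeSlice P ψ x b a)) v e e =
      fderiv ℝ (fderiv ℝ P) v e e * ψ.1 ((inner ℝ x v - b) / a) +
      2 * (a⁻¹ : ℝ) * ((inner ℝ x e : ℝ) * fderiv ℝ P v e) *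
        (dLine ψ).1 ((inner ℝ x v - b) / a) +
      (a⁻¹ : ℝ) ^ 2 * (inner ℝ x e : ℝ) ^ 2 * P v *
        (dLine (dLine ψ)).1 ((inner ℝ x v - b) / a) := by
  have hPd : HasFDerivAt P (fderiv ℝ P v) v :=
    (hP.contDiffAt.differentiableAt (by simp)).hasFDerivAt
  have hPd2 : HasFDerivAt (fderiv ℝ P) (fderiv ℝ (fderiv ℝ P) v) v :=
    ((hP.fderiv_right (m := ∞) (by simp)).contDiffAt.differentiableAt (by simp)).hasFDerivAt
  rw [show fderiv ℝ (ridgeSlice P ψ x b a) = _ from funext (fderiv_ridgeSlice ψ x b a hP)]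
  have h1 := (hPd.fun_mul ((hasFDerivAt_line_inner (dLine ψ) x b a v).const_mul
    ((a⁻¹ : ℝ) : ℂ))).smul_const (Complex.ofRealCLM ∘L innerSL ℝ x)
  have h2 := (hasFDerivAt_line_inner ψ x b a v).fun_smul hPd2
  rw [(h1.fun_add h2).fderiv]
  simp
  ring

/-- The zeroth order coefficient of the Laplace-Beltrami operator applied to a product with `P`. -/
def sphereLap (P : E n → ℂ) (v : E n) : ℂ :=
  ∑ k, fderiv ℝ (fderiv ℝ P) v (basisVec k) (basisVec k) - fderiv ℝ (fderiv ℝ P) v v v -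
    (n - 1 : ℂ) * fderiv ℝ P v v

/-- The radial derivative. -/
def radialDeriv (P : E n → ℂ) (v : E n) : ℂ := fderiv ℝ P v v

/-- The partial derivative. -/
def coordDeriv (k : Fin n) (P : E n → ℂ) (v : E n) : ℂ := fderiv ℝ P v (basisVec k)

theorem contDiff_radialDeriv (hP : ContDiff ℝ ∞ P) : ContDiff ℝ ∞ (radialDeriv P) :=
  (hP.fderiv_right (m := ∞) (by simp)).clm_apply contDiff_id

theorem contDiff_coordDeriv (k : Fin n) (hP : ContDiff ℝ ∞ P) : ContDiff ℝ ∞ (coordDeriv k P) :=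
  (hP.fderiv_right (m := ∞) (by simp)).clm_apply contDiff_const

theorem contDiff_sphereLap (hP : ContDiff ℝ ∞ P) : ContDiff ℝ ∞ (sphereLap P) := by
  have h2 : ContDiff ℝ ∞ (fderiv ℝ (fderiv ℝ P)) :=
    (hP.fderiv_right (m := ∞) (by simp)).fderiv_right (m := ∞) (by simp)
  exact ((ContDiff.sum fun k _ => (h2.clm_apply contDiff_const).clm_apply contDiff_const).sub
    ((h2.clm_apply contDiff_id).clm_apply contDiff_id)).sub
    (contDiff_const.mul (contDiff_radialDeriv hP))

theorem synKer_eq_ridgeSlice (i : ℤ) (j : ℕ) (P : E n → ℂ) (u : Sph n) (b : ℝ)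
    (a : Set.Ioi (0 : ℝ)) : synKer i j 0 P ψ x (u, b, a) =
      ((a : ℝ) : ℂ) ^ i * (b : ℂ) ^ j * ridgeSlice P ψ x b a u := by
  simp only [synKer, ridgeSlice, pow_zero]
  ring

/-- The tangential gradient of u ↦ x·u has squared length |x|² − (x·u)², the coefficient of a⁻² ψ''.
The exponent `i + 2` compensates a⁻². Apart from powers of x·u, all terms other than the one with
|x|² are at most linear in x. -/
theorem lapU_synKer (i : ℤ) (j : ℕ) (hP : ContDiff ℝ ∞ P) (y : Y n) :
    lapU (synKer (i + 2) j 0 P ψ x) y =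
      synKer (i + 2) j 0 (sphereLap P) ψ x y +
      2 * ∑ k, (x k : ℂ) * synKer (i + 1) j 0 (coordDeriv k P) (dLine ψ) x y -
      2 * synKer (i + 1) j 1 (radialDeriv P) (dLine ψ) x y +
      (‖x‖ ^ 2 : ℝ) * synKer i j 0 P (dLine (dLine ψ)) x y -
      synKer i j 2 P (dLine (dLine ψ)) x y -
      (n - 1 : ℂ) * synKer (i + 1) j 1 P (dLine ψ) x y := by
  obtain ⟨u, b, a⟩ := y
  have ha : ((a : ℝ) : ℂ) ≠ 0 := by exact_mod_cast (ne_of_gt a.2 : (a : ℝ) ≠ 0)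
  set c : ℂ := ((a : ℝ) : ℂ) ^ (i + 2) * (b : ℂ) ^ j with hc
  have hsm := contDiff_ridgeSlice ψ x b a hP
  have hsm2 : ContDiff ℝ 2 (ridgeSlice P ψ x b a) :=
    hsm.of_le (WithTop.coe_le_coe.2 (le_top : (2 : ℕ∞) ≤ ⊤))
  have hd1 : ∀ v, DifferentiableAt ℝ (ridgeSlice P ψ x b a) v := fun v =>
    hsm.contDiffAt.differentiableAt (by simp)
  have hd2 : DifferentiableAt ℝ (fderiv ℝ (ridgeSlice P ψ x b a)) u :=
    (hsm.fderiv_right (m := ∞) (by simp)).contDiffAt.differentiableAt (by simp)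
  rw [lapU_eq_of_forall (g := fun v => c * ridgeSlice P ψ x b a v) (u, b, a)
    (fun u => synKer_eq_ridgeSlice ψ x (i + 2) j P u b a) (contDiff_const.mul hsm2).contDiffAt]
  have h1 : fderiv ℝ (fun v => c * ridgeSlice P ψ x b a v) =
      fun v => c • fderiv ℝ (ridgeSlice P ψ x b a) v :=
    funext fun v => fderiv_const_mul (hd1 v) c
  have h2 : fderiv ℝ (fun v => c • fderiv ℝ (ridgeSlice P ψ x b a) v) (u : E n) =
      c • fderiv ℝ (fderiv ℝ (ridgeSlice P ψ x b a)) u := fderiv_fun_const_smul hd2 c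
  rw [laplacian_eq_sum_basisVec, h1, h2]
  have e1 : ∀ v w, (c • fderiv ℝ (fderiv ℝ (ridgeSlice P ψ x b a)) (u : E n)) v w =
      c * fderiv ℝ (fderiv ℝ (ridgeSlice P ψ x b a)) (u : E n) v w := fun _ _ => rfl
  have e2 : ∀ v, (c • fderiv ℝ (ridgeSlice P ψ x b a) (u : E n)) v =
      c * fderiv ℝ (ridgeSlice P ψ x b a) (u : E n) v := fun _ => rfl
  have hx : ∑ k, (x k : ℂ) ^ 2 = ((‖x‖ ^ 2 : ℝ) : ℂ) := by
    rw [EuclideanSpace.real_norm_sq_eq]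
    push_cast
    rfl
  simp only [e1, e2, fderiv_fderiv_ridgeSlice ψ x b a hP, fderiv_ridgeSlice_apply ψ x b a hP,
    inner_basisVec, ← Finset.mul_sum, Finset.sum_add_distrib]
  have e3 : ∑ k, ((a : ℝ)⁻¹ : ℂ) ^ 2 * (x k : ℂ) ^ 2 * P u *
      (dLine (dLine ψ)).1 ((inner ℝ x (u : E n) - b) / a) = ((a : ℝ)⁻¹ : ℂ) ^ 2 *
        (‖x‖ ^ 2 : ℝ) * P u * (dLine (dLine ψ)).1 ((inner ℝ x (u : E n) - b) / a) := by
    rw [← hx, Finset.mul_sum, Finset.sum_mul, Finset.sum_mul]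
  have e4 : ∑ k, (x k : ℂ) * synKer (i + 1) j 0 (coordDeriv k P) (dLine ψ) x (u, b, a) =
      ((a : ℝ) : ℂ) ^ (i + 1) * (b : ℂ) ^ j * (∑ k, (x k : ℂ) * fderiv ℝ P u (basisVec k)) *
        (dLine ψ).1 ((inner ℝ x (u : E n) - b) / a) := by
    simp only [Finset.mul_sum, Finset.sum_mul, synKer, coordDeriv, pow_zero]
    exact Finset.sum_congr rfl fun k _ => by ring
  rw [e4]
  push_cast at e3 ⊢
  rw [e3, ← Finset.sum_mul, ← Finset.sum_mul, ← Finset.mul_sum]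
  have z1 : ((a : ℝ) : ℂ) ^ (i + 2) = ((a : ℝ) : ℂ) ^ i * ((a : ℝ) : ℂ) ^ 2 := by
    rw [zpow_add₀ ha]; norm_cast
  simp only [synKer, sphereLap, radialDeriv, hc, z1, zpow_add_one₀ ha]
  field_simp
  ring

end kernel

theorem integral_add_sub_add_sub_sub {α : Type*} [MeasurableSpace α] {μ : Measure α}
    {f₁ f₂ f₃ f₄ f₅ f₆ : α → ℂ} (h₁ : Integrable f₁ μ) (h₂ : Integrable f₂ μ)
    (h₃ : Integrable f₃ μ) (h₄ : Integrable f₄ μ) (h₅ : Integrable f₅ μ) (h₆ : Integrable f₆ μ) :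
    ∫ y, (f₁ y + f₂ y - f₃ y + f₄ y - f₅ y - f₆ y) ∂μ =
      ∫ y, f₁ y ∂μ + ∫ y, f₂ y ∂μ - ∫ y, f₃ y ∂μ + ∫ y, f₄ y ∂μ - ∫ y, f₅ y ∂μ -
        ∫ y, f₆ y ∂μ := by
  have e := integral_sub' ((((h₁.add h₂).sub h₃).add h₄).sub h₅) h₆
  rw [integral_sub' (((h₁.add h₂).sub h₃).add h₄) h₅, integral_add' ((h₁.add h₂).sub h₃) h₄,
    integral_sub' (h₁.add h₂) h₃, integral_add' h₁ h₂] at e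
  exact e

/-- Green's identity moves Δ_u from the kernel to Φ, and the formula for Δ_u of the kernel is solved
for its |x|² ψ'' term. -/
theorem norm_sq_mul_synInt (hn : n ≠ 0) (i : ℤ) (j : ℕ) {P : E n → ℂ} (hP : ContDiff ℝ ∞ P)
    (ψ : LizorkinLine) (Φ : SchwartzY n) (x : E n) :
    ((‖x‖ ^ 2 : ℝ) : ℂ) * synInt i j 0 P (dLine (dLine ψ)) Φ x =
      synInt (i + 2) j 0 P ψ (lapY n Φ) x - synInt (i + 2) j 0 (sphereLap P) ψ Φ x -
      2 * ∑ k, (x k : ℂ) * synInt (i + 1) j 0 (coordDeriv k P) (dLine ψ) Φ x +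
      2 * synInt (i + 1) j 1 (radialDeriv P) (dLine ψ) Φ x +
      synInt i j 2 P (dLine (dLine ψ)) Φ x +
      (n - 1 : ℂ) * synInt (i + 1) j 1 P (dLine ψ) Φ x := by
  have hI := fun (i : ℤ) (j l : ℕ) (ψ : LizorkinLine) {P : E n → ℂ} (hP : ContDiff ℝ ∞ P) =>
    integrable_synKer i j l hP.continuous ψ Φ x
  have t1 := hI (i + 2) j 0 ψ (contDiff_sphereLap hP)
  have t2 : Integrable (fun y => 2 * ∑ k, (x k : ℂ) *
      (Φ.fn y * synKer (i + 1) j 0 (coordDeriv k P) (dLine ψ) x y)) (prodMeasure n) :=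
    (integrable_finsetSum _ fun k _ =>
      (hI (i + 1) j 0 (dLine ψ) (contDiff_coordDeriv k hP)).const_mul _).const_mul _
  have t3 := (hI (i + 1) j 1 (dLine ψ) (contDiff_radialDeriv hP)).const_mul 2
  have t4 := (hI i j 0 (dLine (dLine ψ)) hP).const_mul ((‖x‖ ^ 2 : ℝ) : ℂ)
  have t5 := hI i j 2 (dLine (dLine ψ)) hP
  have t6 := (hI (i + 1) j 1 (dLine ψ) hP).const_mul (n - 1 : ℂ)
  have hpt : (fun y => Φ.fn y * lapU (synKer (i + 2) j 0 P ψ x) y) = fun y =>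
      Φ.fn y * synKer (i + 2) j 0 (sphereLap P) ψ x y +
      2 * ∑ k, (x k : ℂ) * (Φ.fn y * synKer (i + 1) j 0 (coordDeriv k P) (dLine ψ) x y) -
      2 * (Φ.fn y * synKer (i + 1) j 1 (radialDeriv P) (dLine ψ) x y) +
      ((‖x‖ ^ 2 : ℝ) : ℂ) * (Φ.fn y * synKer i j 0 P (dLine (dLine ψ)) x y) -
      Φ.fn y * synKer i j 2 P (dLine (dLine ψ)) x y -
      (n - 1 : ℂ) * (Φ.fn y * synKer (i + 1) j 1 P (dLine ψ) x y) := by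
    funext y
    rw [lapU_synKer ψ x i j hP y]
    simp only [mul_left_comm _ (Φ.fn y), ← Finset.mul_sum]
    ring
  have hG := integral_lapU_mul_eq hn (F := Φ.fn) (H := synKer (i + 2) j 0 P ψ x)
    (fun b a => SmoothY.isZeroHomogeneous Φ.1.2 b a)
    (fun b a => isZeroHomogeneous_ext_of_forall
      (fun u => synKer_eq_ridgeSlice ψ x (i + 2) j P u b a)
      (contDiff_const.mul (contDiff_ridgeSlice ψ x b a hP)))
    (integrable_synKer (i + 2) j 0 hP.continuous ψ (lapY n Φ) x)
    (by
      rw [hpt]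
      exact ((((t1.add t2).sub t3).add t4).sub t5).sub t6)
  rw [hpt] at hG
  have hL : ∫ y, lapU Φ.fn y * synKer (i + 2) j 0 P ψ x y ∂prodMeasure n =
      synInt (i + 2) j 0 P ψ (lapY n Φ) x := rfl
  have hG := (hL.symm.trans hG).trans (integral_add_sub_add_sub_sub t1 t2 t3 t4 t5 t6)
  simp only [integral_const_mul] at hG
  rw [integral_finsetSum _ fun k _ =>
      (hI (i + 1) j 0 (dLine ψ) (contDiff_coordDeriv k hP)).const_mul _] at hG
  simp only [integral_const_mul] at hG
  unfold synInt at hG ⊢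
  rw [hG]
  ring

/-- The synthesis integrals decay rapidly. -/
theorem dominated_pow_mul_synInt (hn : n ≠ 0) (N : ℕ) (i : ℤ) (j : ℕ) {P : E n → ℂ}
    (hP : ContDiff ℝ ∞ P) (ψ : LizorkinLine) :
    Dominated fun (Φ : SchwartzY n) (x : E n) =>
      (((1 + ‖x‖) ^ N : ℝ) : ℂ) * synInt i j 0 P ψ Φ x := by
  induction N generalizing i j P ψ with
  | zero => simpa using dominated_synInt i j hP.continuous ψ
  | succ N ih =>
    -- The induction hypothesis extends to kernels with powers of x·u by trading them for powers of
    -- a and b.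
    have hl : ∀ (l : ℕ) (i : ℤ) (j : ℕ) {P : E n → ℂ} (_ : ContDiff ℝ ∞ P) (ψ : LizorkinLine),
        Dominated fun (Φ : SchwartzY n) (x : E n) =>
          (((1 + ‖x‖) ^ N : ℝ) : ℂ) * synInt i j l P ψ Φ x := by
      intro l
      induction l with
      | zero => exact fun i j P hP ψ => ih i j hP ψ
      | succ l ihl =>
        intro i j P hP ψ
        simp only [synInt_succ_inner i j l hP.continuous, mul_add]
        exact (ihl _ _ hP _).add (ihl _ _ hP _)
    -- Two primitives are taken so that the profile is a second derivative, as the identity for |x|²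
    -- requires.
    obtain ⟨χ, rfl⟩ := exists_dLine_eq ψ
    obtain ⟨χ, rfl⟩ := exists_dLine_eq χ
    have h1 : ∀ {T : SchwartzY n → E n → ℂ},
        Dominated (fun Φ x => (((1 + ‖x‖) ^ N : ℝ) : ℂ) * T Φ x) →
        Dominated fun Φ x => (((1 + ‖x‖)⁻¹ : ℝ) : ℂ) * ((((1 + ‖x‖) ^ N : ℝ) : ℂ) * T Φ x) :=
      fun h => h.bounded_mul (C := 1) fun x => by
        rw [Complex.norm_real, Real.norm_of_nonneg (by positivity)]
        exact inv_le_one_of_one_le₀ (by linarith [norm_nonneg x])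
    -- The factor (1 + |x|)⁻¹ absorbs the linear growth of x_k. The identity gains |x|² and this
    -- loses one power, so each step gains exactly one.
    have h2 : ∀ (k : Fin n) {T : SchwartzY n → E n → ℂ},
        Dominated (fun Φ x => (((1 + ‖x‖) ^ N : ℝ) : ℂ) * T Φ x) →
        Dominated fun Φ x => ((x k * (1 + ‖x‖)⁻¹ : ℝ) : ℂ) *
          ((((1 + ‖x‖) ^ N : ℝ) : ℂ) * T Φ x) :=
      fun k _ h => h.bounded_mul (C := 1) fun x => by
        rw [Complex.norm_real, ← div_eq_mul_inv, norm_div, Real.norm_of_nonneg (by positivity :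
          (0 : ℝ) ≤ 1 + ‖x‖)]
        exact div_le_one_of_le₀ ((PiLp.norm_apply_le x k).trans (by linarith)) (by positivity)
    have hsq : Dominated fun (Φ : SchwartzY n) (x : E n) =>
        (((1 + ‖x‖)⁻¹ : ℝ) : ℂ) * ((((1 + ‖x‖) ^ N : ℝ) : ℂ) *
          (((‖x‖ ^ 2 : ℝ) : ℂ) * synInt i j 0 P (dLine (dLine χ)) Φ x)) := by
      have h3 := (((((h1 (hl 0 (i + 2) j hP χ)).comp (lapY n)).sub
        (h1 (hl 0 (i + 2) j (contDiff_sphereLap hP) χ))).sub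
        ((Dominated.sum Finset.univ fun k _ =>
          h2 k (hl 0 (i + 1) j (contDiff_coordDeriv k hP) (dLine χ))).const_mul 2)).add
        ((h1 (hl 1 (i + 1) j (contDiff_radialDeriv hP) (dLine χ))).const_mul 2)).add
        (h1 (hl 2 i j hP (dLine (dLine χ)))) |>.add
        ((h1 (hl 1 (i + 1) j hP (dLine χ))).const_mul (n - 1 : ℂ))
      refine h3.mono fun Φ x => le_of_eq (congrArg norm ?_)
      rw [norm_sq_mul_synInt hn i j hP χ Φ x]
      have h4 : ∑ k, ((x k * (1 + ‖x‖)⁻¹ : ℝ) : ℂ) * ((((1 + ‖x‖) ^ N : ℝ) : ℂ) *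
          synInt (i + 1) j 0 (coordDeriv k P) (dLine χ) Φ x) =
          (((1 + ‖x‖)⁻¹ : ℝ) : ℂ) * ((((1 + ‖x‖) ^ N : ℝ) : ℂ) *
            ∑ k, (x k : ℂ) * synInt (i + 1) j 0 (coordDeriv k P) (dLine χ) Φ x) := by
        rw [Finset.mul_sum, Finset.mul_sum]
        refine Finset.sum_congr rfl fun k _ => ?_
        push_cast
        ring
      rw [h4]
      ring
    obtain ⟨q1, hq1, hb1⟩ := h1 (hl 0 i j hP (dLine (dLine χ)))
    obtain ⟨q2, hq2, hb2⟩ := hsq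
    refine ⟨(2 : NNReal) • (q1 + q2), (hq1.add hq2).const_smul (2 : NNReal), fun Φ x => ?_⟩
    change _ ≤ 2 * (q1 Φ + q2 Φ)
    have h5 := hb1 Φ x
    have h6 := hb2 Φ x
    have hpos : (0 : ℝ) < 1 + ‖x‖ := by positivity
    rw [norm_mul, norm_mul, Complex.norm_real, Complex.norm_real,
      Real.norm_of_nonneg (by positivity), Real.norm_of_nonneg (by positivity)] at h5
    rw [norm_mul, norm_mul, norm_mul, Complex.norm_real, Complex.norm_real, Complex.norm_real,
      Real.norm_of_nonneg (by positivity), Real.norm_of_nonneg (by positivity),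
      Real.norm_of_nonneg (by positivity)] at h6
    rw [norm_mul, Complex.norm_real, Real.norm_of_nonneg (by positivity)]
    set S := ‖synInt i j 0 P (dLine (dLine χ)) Φ x‖ with hS
    have hS0 : 0 ≤ S := norm_nonneg _
    have h7 : (1 + ‖x‖) ^ (N + 1) * S =
        (1 + ‖x‖)⁻¹ * ((1 + ‖x‖) ^ N * ((1 + ‖x‖) ^ 2 * S)) := by
      field_simp
      ring
    -- Bounds for the integral and for |x|² times it together control (1 + |x|)² times it.
    have h8 : (1 + ‖x‖) ^ 2 ≤ 2 * (1 + ‖x‖ ^ 2) := by nlinarith [sq_nonneg (1 - ‖x‖)]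
    calc (1 + ‖x‖) ^ (N + 1) * S
        ≤ (1 + ‖x‖)⁻¹ * ((1 + ‖x‖) ^ N * (2 * (1 + ‖x‖ ^ 2) * S)) := by rw [h7]; gcongr
      _ = 2 * ((1 + ‖x‖)⁻¹ * ((1 + ‖x‖) ^ N * S) +
          (1 + ‖x‖)⁻¹ * ((1 + ‖x‖) ^ N * (‖x‖ ^ 2 * S))) := by ring
      _ ≤ _ := by gcongr

end decay

/-! ### The synthesis operator -/

section synthesisOperator

variable {n : ℕ}

/-- One differentiation in x gives integrals of the same family with P multiplied by a coordinate, ψ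
replaced by ψ' and one power of a fewer. Hence decay of all derivatives reduces to decay of the
values. -/
theorem norm_iteratedFDeriv_succ_synInt_le (m : ℕ) (i : ℤ) (j : ℕ) {P : E n → ℂ}
    (hP : ContDiff ℝ ∞ P) (ψ : LizorkinLine) (Φ : SchwartzY n) (x : E n) :
    ‖iteratedFDeriv ℝ (m + 1) (synInt i j 0 P ψ Φ) x‖ ≤
      ∑ k : Fin n, ‖(ContinuousLinearMap.id ℝ ℂ).smulRight (coordCLM k)‖ *
        ‖iteratedFDeriv ℝ m (synInt (i - 1) j 0 (mulCoordFun k P) (dLine ψ) Φ) x‖ := by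
  rw [← norm_iteratedFDeriv_fderiv]
  have h1 : fderiv ℝ (synInt i j 0 P ψ Φ) = fun x => ∑ k,
      ((ContinuousLinearMap.id ℝ ℂ).smulRight (coordCLM k) ∘
        synInt (i - 1) j 0 (mulCoordFun k P) (dLine ψ) Φ) x :=
    funext fun x => (hasFDerivAt_synInt i j hP.continuous ψ Φ x).fderiv
  have hs : ∀ k, ContDiffAt ℝ m (synInt (i - 1) j 0 (mulCoordFun k P) (dLine ψ) Φ) x := fun k =>
    ((contDiff_synInt (i - 1) j (contDiff_mulCoordFun k hP) (dLine ψ) Φ).of_le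
      (by exact_mod_cast le_top)).contDiffAt
  rw [h1, iteratedFDeriv_fun_sum_apply fun k _ =>
    ((ContinuousLinearMap.id ℝ ℂ).smulRight (coordCLM k)).contDiff.contDiffAt.comp x (hs k)]
  refine (norm_sum_le _ _).trans (Finset.sum_le_sum fun k _ => ?_)
  exact ContinuousLinearMap.norm_iteratedFDeriv_comp_left _ (hs k) le_rfl

/-- The Schwartz seminorms of the synthesis integrals are continuous. -/
theorem exists_seminorm_iteratedFDeriv_synInt (hn : n ≠ 0) (N m : ℕ) (i : ℤ) (j : ℕ)
    {P : E n → ℂ} (hP : ContDiff ℝ ∞ P) (ψ : LizorkinLine) :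
    ∃ q : Seminorm ℂ (SchwartzY n), Continuous q ∧
      ∀ Φ x, ‖x‖ ^ N * ‖iteratedFDeriv ℝ m (synInt i j 0 P ψ Φ) x‖ ≤ q Φ := by
  induction m generalizing i P ψ with
  | zero =>
    obtain ⟨q, hq, h⟩ := dominated_pow_mul_synInt hn N i j hP ψ
    refine ⟨q, hq, fun Φ x => le_trans ?_ (h Φ x)⟩
    rw [norm_iteratedFDeriv_zero, norm_mul, Complex.norm_real,
      Real.norm_of_nonneg (by positivity)]
    gcongr
    linarith
  | succ m ih =>
    choose q hq h using fun k : Fin n => ih (i - 1) (contDiff_mulCoordFun k hP) (dLine ψ)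
    set c : Fin n → NNReal := fun k => ‖(ContinuousLinearMap.id ℝ ℂ).smulRight (coordCLM k)‖₊
    have hsum : ⇑(∑ k, c k • q k) = fun Φ => ∑ k, c k * q k Φ := by
      rw [FunLike.coe_sum]
      ext Φ
      rw [Finset.sum_apply]
      rfl
    refine ⟨∑ k, c k • q k, ?_, fun Φ x => ?_⟩
    · rw [hsum]
      exact continuous_finsetSum _ fun k _ => (hq k).const_mul _
    · rw [hsum]
      calc ‖x‖ ^ N * ‖iteratedFDeriv ℝ (m + 1) (synInt i j 0 P ψ Φ) x‖
          ≤ ‖x‖ ^ N * ∑ k : Fin n, c k *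
            ‖iteratedFDeriv ℝ m (synInt (i - 1) j 0 (mulCoordFun k P) (dLine ψ) Φ) x‖ := by
            gcongr
            exact norm_iteratedFDeriv_succ_synInt_le m i j hP ψ Φ x
        _ = ∑ k : Fin n, c k * (‖x‖ ^ N *
            ‖iteratedFDeriv ℝ m (synInt (i - 1) j 0 (mulCoordFun k P) (dLine ψ) Φ) x‖) := by
            rw [Finset.mul_sum]
            exact Finset.sum_congr rfl fun k _ => by ring
        _ ≤ _ := Finset.sum_le_sum fun k _ => by
            gcongr
            exact h k Φ x

/-- The synthesis integrals as Schwartz functions. -/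
def synSchwartz (hn : n ≠ 0) (i : ℤ) (j : ℕ) {P : E n → ℂ} (hP : ContDiff ℝ ∞ P)
    (ψ : LizorkinLine) (Φ : SchwartzY n) : 𝓢(E n, ℂ) where
  toFun := synInt i j 0 P ψ Φ
  smooth' := contDiff_synInt i j hP ψ Φ
  decay' N m := by
    obtain ⟨q, -, h⟩ := exists_seminorm_iteratedFDeriv_synInt hn N m i j hP ψ
    exact ⟨q Φ, h Φ⟩

theorem synSchwartz_apply (hn : n ≠ 0) (i : ℤ) (j : ℕ) {P : E n → ℂ} (hP : ContDiff ℝ ∞ P)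
    (ψ : LizorkinLine) (Φ : SchwartzY n) (x : E n) :
    synSchwartz hn i j hP ψ Φ x = synInt i j 0 P ψ Φ x := rfl

/-- On the sphere ∑ u_k² = 1. One factor u_k is the one produced by ∂_k together with a⁻¹, the other
is put into P, so the integral is a divergence of Schwartz functions. -/
theorem synInt_dLine_eq_sum (hn : n ≠ 0) (i : ℤ) (j : ℕ) {P : E n → ℂ} (hP : ContDiff ℝ ∞ P)
    (χ : LizorkinLine) (Φ : SchwartzY n) (x : E n) :
    synInt i j 0 P (dLine χ) Φ x = ∑ k, LineDeriv.lineDerivOp (basisVec k)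
      (synSchwartz hn (i + 1) j (contDiff_mulCoordFun k hP) χ Φ) x := by
  have h1 : ∀ k, LineDeriv.lineDerivOp (basisVec k)
      (synSchwartz hn (i + 1) j (contDiff_mulCoordFun k hP) χ Φ) x =
      synInt i j 0 (mulCoordFun k (mulCoordFun k P)) (dLine χ) Φ x := fun k => by
    rw [SchwartzMap.lineDerivOp_apply_eq_fderiv]
    change fderiv ℝ (synInt (i + 1) j 0 (mulCoordFun k P) χ Φ) x (basisVec k) = _
    rw [(hasFDerivAt_synInt (i + 1) j (contDiff_mulCoordFun k hP).continuous χ Φ x).fderiv,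
      synDeriv_apply, Finset.sum_eq_single k]
    · simp [basisVec]
    · intro l _ hl
      simp [basisVec, hl]
    · simp
  simp only [h1]
  unfold synInt
  rw [← integral_finsetSum _ fun k _ => integrable_synKer i j 0
    (contDiff_mulCoordFun k (contDiff_mulCoordFun k hP)).continuous (dLine χ) Φ x]
  refine integral_congr_ae (.of_forall fun y => ?_)
  have hu : ∑ k, ((((y.1 : E n) k : ℝ) : ℂ)) ^ 2 = 1 := by
    have h := EuclideanSpace.real_norm_sq_eq (y.1 : E n)
    rw [mem_sphere_zero_iff_norm.mp y.1.2, one_pow] at h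
    exact_mod_cast h.symm
  calc Φ.fn y * synKer i j 0 P (dLine χ) x y
      = (∑ k, ((((y.1 : E n) k : ℝ) : ℂ)) ^ 2) * (Φ.fn y * synKer i j 0 P (dLine χ) x y) := by
        rw [hu, one_mul]
    _ = _ := by
        rw [Finset.sum_mul]
        refine Finset.sum_congr rfl fun k _ => ?_
        simp only [synKer, mulCoordFun]
        ring

/-- Induction on the degree: integrating the divergence by parts lowers the degree of the monomial,
and a coordinate that does not occur in it contributes zero. -/
theorem integral_monomial_mul_synInt (hn : n ≠ 0) (m : Fin n → ℕ) (i : ℤ) (j : ℕ) {P : E n → ℂ}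
    (hP : ContDiff ℝ ∞ P) (ψ : LizorkinLine) (Φ : SchwartzY n) :
    ∫ x, monomial m x * synInt i j 0 P ψ Φ x = 0 := by
  induction hs : ∑ k, m k using Nat.strong_induction_on generalizing m i P ψ with
  | _ s ih =>
    obtain ⟨χ, rfl⟩ := exists_dLine_eq ψ
    simp only [synInt_dLine_eq_sum hn i j hP χ Φ, Finset.mul_sum]
    rw [integral_finsetSum _ fun k _ => integrable_monomial_mul m _]
    refine Finset.sum_eq_zero fun k _ => ?_
    rw [integral_monomial_mul_lineDeriv]
    rcases Nat.eq_zero_or_pos (m k) with h0 | h0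
    · simp [h0]
    · simp only [synSchwartz_apply]
      rw [ih _ ?_ _ _ (contDiff_mulCoordFun k hP) χ rfl, mul_zero]
      rw [← hs]
      refine Finset.sum_lt_sum (fun l _ => ?_) ⟨k, Finset.mem_univ k, ?_⟩
      · by_cases hl : l = k
        · subst hl; simp
        · simp [hl]
      · simp only [Function.update_self]
        omega

/-- The synthesis integrals as a linear operator into the Schwartz functions. -/
def synLinear (hn : n ≠ 0) (i : ℤ) (j : ℕ) {P : E n → ℂ} (hP : ContDiff ℝ ∞ P)
    (ψ : LizorkinLine) : SchwartzY n →ₗ[ℂ] 𝓢(E n, ℂ) where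
  toFun := synSchwartz hn i j hP ψ
  map_add' Φ Θ := by
    ext x
    change synInt i j 0 P ψ (Φ + Θ) x = synInt i j 0 P ψ Φ x + synInt i j 0 P ψ Θ x
    unfold synInt
    rw [← integral_add (integrable_synKer i j 0 hP.continuous ψ Φ x)
      (integrable_synKer i j 0 hP.continuous ψ Θ x)]
    exact integral_congr_ae (.of_forall fun y => add_mul _ _ _)
  map_smul' c Φ := by
    ext x
    change synInt i j 0 P ψ (c • Φ) x = c * synInt i j 0 P ψ Φ x
    unfold synInt
    rw [← integral_const_mul]
    exact integral_congr_ae (.of_forall fun y => mul_assoc _ _ _)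

theorem continuous_synLinear (hn : n ≠ 0) (i : ℤ) (j : ℕ) {P : E n → ℂ} (hP : ContDiff ℝ ∞ P)
    (ψ : LizorkinLine) : Continuous (synLinear hn i j hP ψ) := by
  refine (schwartz_withSeminorms ℂ (E n) ℂ).continuous_of_continuous_comp _ fun p => ?_
  obtain ⟨q, hq, h⟩ := exists_seminorm_iteratedFDeriv_synInt hn p.1 p.2 i j hP ψ
  exact Seminorm.continuous_of_le hq fun Φ =>
    SchwartzMap.seminorm_le_bound ℂ p.1 p.2 _ (apply_nonneg q Φ) (h Φ)

/-- The synthesis integrals as a continuous operator into the Lizorkin test functions. -/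
def synCLM (hn : n ≠ 0) (i : ℤ) (j : ℕ) {P : E n → ℂ} (hP : ContDiff ℝ ∞ P)
    (ψ : LizorkinLine) : SchwartzY n →L[ℂ] Lizorkin n :=
  (⟨synLinear hn i j hP ψ, continuous_synLinear hn i j hP ψ⟩ :
    SchwartzY n →L[ℂ] 𝓢(E n, ℂ)).codRestrict (Lizorkin n) fun Φ m =>
      integral_monomial_mul_synInt hn m i j hP ψ Φ

/-! ### Passage from the standard measure to the product measure -/

theorem stdMeasure_eq : stdMeasure n =
    (prodMeasure n).withDensity fun y => ((Real.toNNReal (1 / (y.2.2 : ℝ) ^ n) : NNReal) : ENNReal) :=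
  rfl

theorem measurable_density :
    Measurable fun y : Y n => Real.toNNReal (1 / (y.2.2 : ℝ) ^ n) := by
  fun_prop

theorem integrable_stdMeasure {f : Y n → ℂ} : Integrable f (stdMeasure n) ↔
    Integrable (fun y => ((1 / (y.2.2 : ℝ) ^ n : ℝ) : ℂ) * f y) (prodMeasure n) := by
  rw [stdMeasure_eq, integrable_withDensity_iff_integrable_smul measurable_density]
  refine integrable_congr (.of_forall fun y => ?_)
  have ha : (0 : ℝ) < y.2.2 := y.2.2.2
  simp only [NNReal.smul_def]
  rw [Real.coe_toNNReal _ (by positivity), Complex.real_smul]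

theorem integral_stdMeasure (f : Y n → ℂ) : ∫ y, f y ∂stdMeasure n =
    ∫ y, ((1 / (y.2.2 : ℝ) ^ n : ℝ) : ℂ) * f y ∂prodMeasure n := by
  rw [stdMeasure_eq, integral_withDensity_eq_integral_smul measurable_density]
  refine integral_congr_ae (.of_forall fun y => ?_)
  have ha : (0 : ℝ) < y.2.2 := y.2.2.2
  simp only [NNReal.smul_def]
  rw [Real.coe_toNNReal _ (by positivity), Complex.real_smul]

/-- The exponent −n − 1 combines a^(−n) from the measure with a⁻¹ from the normalization of the
ridgelet. -/
theorem density_mul_ridge (ψ : LizorkinLine) (Φ : SchwartzY n) (x : E n) (y : Y n) :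
    ((1 / (y.2.2 : ℝ) ^ n : ℝ) : ℂ) * (Φ.fn y * ridge (conjFn fun t => ψ.1 t) y x) =
      Φ.fn y * synKer (-(n : ℤ) - 1) 0 0 (fun _ => 1) (conjLine ψ) x y := by
  have ha : ((y.2.2 : ℝ) : ℂ) ≠ 0 := by
    exact_mod_cast (ne_of_gt y.2.2.2 : (y.2.2 : ℝ) ≠ 0)
  simp only [ridge, conjFn, synKer, conjLine_apply, zpow_sub_one₀ ha, zpow_neg, zpow_natCast]
  push_cast
  ring

/-- The ridgelet synthesis operator is a continuous linear operator into the Lizorkin test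
functions. -/
theorem exists_isSynthesisOperator (hn : n ≠ 0) (ψ : LizorkinLine) :
    ∃ T, IsSynthesisOperator n (conjFn fun t => ψ.1 t) T := by
  refine ⟨synCLM hn (-(n : ℤ) - 1) 0 (P := fun _ => 1) contDiff_const (conjLine ψ),
    fun Φ x => ⟨?_, ?_⟩⟩
  · rw [integrable_stdMeasure]
    simp only [density_mul_ridge]
    exact integrable_synKer _ _ _ continuous_const _ _ _
  · unfold synthesis
    rw [integral_stdMeasure]
    simp only [density_mul_ridge]
    rfl

end synthesisOperator

/-! ### The inversion formula on test functions -/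

section inversion

open scoped FourierTransform

variable {n : ℕ}

/-- The character `t ↦ e ^ (2 π i t)`. -/
def expI (t : ℝ) : ℂ := Complex.exp ((2 * Real.pi * t : ℝ) * Complex.I)

theorem norm_expI (t : ℝ) : ‖expI t‖ = 1 := Complex.norm_exp_ofReal_mul_I _

theorem expI_add (s t : ℝ) : expI (s + t) = expI s * expI t := by
  unfold expI
  rw [← Complex.exp_add]
  congr 1
  push_cast
  ring

theorem conj_expI (t : ℝ) : conj (expI t) = expI (-t) := by
  unfold expI
  rw [← Complex.exp_conj, map_mul, Complex.conj_ofReal, Complex.conj_I]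
  congr 1
  push_cast
  ring

@[fun_prop]
theorem continuous_expI : Continuous expI := by unfold expI; fun_prop

theorem fourier_eq_integral_expI {V : Type*} [NormedAddCommGroup V] [InnerProductSpace ℝ V]
    [FiniteDimensional ℝ V] [MeasurableSpace V] [BorelSpace V] (f : 𝓢(V, ℂ)) (w : V) :
    𝓕 f w = ∫ v, expI (-inner ℝ v w) * f v := by
  rw [SchwartzMap.fourier_coe, Real.fourier_eq']
  refine integral_congr_ae (.of_forall fun v => ?_)
  simp [expI]

theorem eq_integral_expI_fourier {V : Type*} [NormedAddCommGroup V] [InnerProductSpace ℝ V]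
    [FiniteDimensional ℝ V] [MeasurableSpace V] [BorelSpace V] (f : 𝓢(V, ℂ)) (x : V) :
    f x = ∫ w, expI (inner ℝ w x) * 𝓕 f w := by
  have h : f x = 𝓕⁻ (𝓕 f) x := by rw [FourierTransform.fourierInv_fourier_eq]
  conv_lhs => rw [h]
  rw [SchwartzMap.fourierInv_coe, Real.fourierInv_eq']
  refine integral_congr_ae (.of_forall fun v => ?_)
  simp [expI]

/-- The Fourier representation of the integrals of `φ` against plane waves. -/
theorem wave_eq_integral (φ : Lizorkin n) (η : LizorkinLine) (ξ : E n) (s : ℝ) :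
    wave φ η ξ s = ∫ v : ℝ, 𝓕 η.1 v * 𝓕 φ.1 (-v • ξ) * expI (-(v * s)) := by
  have h1 : Integrable (Function.uncurry fun (y : E n) (v : ℝ) =>
      φ.1 y * 𝓕 η.1 v * expI (v * (inner ℝ y ξ - s))) (volume.prod volume) := by
    have h0 : Integrable (fun z : E n × ℝ => φ.1 z.1 * 𝓕 η.1 z.2) (volume.prod volume) :=
      φ.1.integrable.mul_prod (𝓕 η.1).integrable
    exact h0.mul_bdd (c := 1) (Continuous.aestronglyMeasurable (by fun_prop))
      (.of_forall fun z => (norm_expI _).le)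
  have h2 : wave φ η ξ s =
      ∫ y, ∫ v : ℝ, φ.1 y * 𝓕 η.1 v * expI (v * (inner ℝ y ξ - s)) := by
    unfold wave
    refine integral_congr_ae (.of_forall fun y => ?_)
    simp only [mul_assoc, integral_const_mul]
    rw [eq_integral_expI_fourier η.1 (inner ℝ y ξ - s)]
    congr 1
    refine integral_congr_ae (.of_forall fun v => ?_)
    simp [mul_comm]
  rw [h2, integral_integral_swap h1]
  refine integral_congr_ae (.of_forall fun v => ?_)
  dsimp only
  rw [fourier_eq_integral_expI φ.1, ← integral_const_mul, ← integral_mul_const]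
  refine integral_congr_ae (.of_forall fun y => ?_)
  have h3 : expI (v * (inner ℝ y ξ - s)) = expI (-inner ℝ y (-v • ξ)) * expI (-(v * s)) := by
    rw [← expI_add, inner_smul_right]
    congr 1
    ring
  dsimp only
  rw [h3]
  ring

/-- The cross-correlation of the plane wave transform of `φ` with `ψ`. -/
def waveCorr (φ : Lizorkin n) (η ψ : LizorkinLine) (x ξ : E n) : ℂ :=
  ∫ s : ℝ, wave φ η ξ s * conj (ψ.1 (inner ℝ x ξ - s))

theorem integral_conj_mul_expI (ψ : LizorkinLine) (c v : ℝ) :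
    ∫ s : ℝ, conj (ψ.1 (c - s)) * expI (-(v * s)) = conj (𝓕 ψ.1 v) * expI (-(v * c)) := by
  rw [fourier_eq_integral_expI ψ.1, ← integral_conj, ← integral_mul_const,
    ← integral_sub_left_eq_self (fun t : ℝ =>
      conj (expI (-inner ℝ t v) * ψ.1 t) * expI (-(v * c))) volume c]
  refine integral_congr_ae (.of_forall fun s => ?_)
  have h3 : expI (-(v * s)) = conj (expI (-inner ℝ (c - s) v)) * expI (-(v * c)) := by
    rw [conj_expI, ← expI_add]
    congr 1
    simp
    ring
  dsimp only
  rw [h3, map_mul]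
  ring

theorem exists_norm_le_schwartz (φ : 𝓢(E n, ℂ)) : ∃ C, 0 ≤ C ∧ ∀ x, ‖φ x‖ ≤ C :=
  ⟨_, apply_nonneg _ _, SchwartzMap.norm_le_seminorm ℂ φ⟩

theorem ridgelet_conj_eq (η : LizorkinLine) (φ : Lizorkin n) (y : Y n) :
    ridgelet (conjFn fun t => η.1 t) (fun x => φ.1 x) y = (((y.2.2 : ℝ)⁻¹ : ℝ) : ℂ) *
      wave φ η ((y.2.2 : ℝ)⁻¹ • (y.1 : E n)) ((y.2.2 : ℝ)⁻¹ * y.2.1) := by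
  unfold ridgelet wave
  rw [← integral_const_mul]
  refine integral_congr_ae (.of_forall fun x => ?_)
  have h1 : (inner ℝ x (y.1 : E n) - y.2.1) / (y.2.2 : ℝ) =
      inner ℝ x ((y.2.2 : ℝ)⁻¹ • (y.1 : E n)) - (y.2.2 : ℝ)⁻¹ * y.2.1 := by
    rw [inner_smul_right]; ring
  simp only [ridge, conjFn, map_mul, Complex.conj_conj, h1]
  simp
  ring

/-- The Fourier transform of `φ`, translated by `x`. -/
def fourierShift (φ : Lizorkin n) (x ξ : E n) : ℂ := expI (inner ℝ ξ x) * 𝓕 φ.1 ξ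

theorem continuous_fourierShift (φ : Lizorkin n) (x : E n) : Continuous (fourierShift φ x) := by
  unfold fourierShift; fun_prop

theorem integrable_fourierShift (φ : Lizorkin n) (x : E n) : Integrable (fourierShift φ x) :=
  (𝓕 φ.1).integrable.bdd_mul (c := 1) (Continuous.aestronglyMeasurable (by fun_prop))
    (.of_forall fun ξ => (norm_expI _).le)

theorem integral_fourierShift (φ : Lizorkin n) (x : E n) : ∫ ξ, fourierShift φ x ξ = φ.1 x :=
  (eq_integral_expI_fourier φ.1 x).symm

/-- Correlation in s becomes a product on the Fourier side. The phase e^(−2πi v x·ξ) and φ^(−vξ)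
combine into a single function evaluated at −vξ. -/
theorem waveCorr_eq_integral (φ : Lizorkin n) (η ψ : LizorkinLine) (x ξ : E n) :
    waveCorr φ η ψ x ξ =
      ∫ v : ℝ, conj (𝓕 ψ.1 v) * 𝓕 η.1 v * fourierShift φ x (-v • ξ) := by
  obtain ⟨C, -, hC⟩ := exists_norm_le_schwartz (𝓕 φ.1)
  have h1 : Integrable (Function.uncurry fun (s v : ℝ) =>
      conj (ψ.1 (inner ℝ x ξ - s)) * 𝓕 η.1 v * (𝓕 φ.1 (-v • ξ) * expI (-(v * s))))
      (volume.prod volume) := by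
    have hψ : Integrable fun s : ℝ => conj (ψ.1 (inner ℝ x ξ - s)) :=
      ((conjLine ψ).1.integrable.comp_sub_left (inner ℝ x ξ)).congr
        (.of_forall fun s => conjLine_apply ψ _)
    have h0 : Integrable (fun z : ℝ × ℝ => conj (ψ.1 (inner ℝ x ξ - z.1)) * 𝓕 η.1 z.2)
        (volume.prod volume) := hψ.mul_prod (𝓕 η.1).integrable
    refine h0.mul_bdd (c := C) (Continuous.aestronglyMeasurable (by fun_prop))
      (.of_forall fun z => ?_)
    rw [norm_mul, norm_expI, mul_one]
    exact hC _
  have h2 : waveCorr φ η ψ x ξ = ∫ s : ℝ, ∫ v : ℝ,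
      conj (ψ.1 (inner ℝ x ξ - s)) * 𝓕 η.1 v * (𝓕 φ.1 (-v • ξ) * expI (-(v * s))) := by
    unfold waveCorr
    refine integral_congr_ae (.of_forall fun s => ?_)
    dsimp only
    rw [wave_eq_integral, ← integral_mul_const]
    exact integral_congr_ae (.of_forall fun v => by ring)
  rw [h2, integral_integral_swap h1]
  refine integral_congr_ae (.of_forall fun v => ?_)
  have h3 : ∀ s : ℝ,
      conj (ψ.1 (inner ℝ x ξ - s)) * 𝓕 η.1 v * (𝓕 φ.1 (-v • ξ) * expI (-(v * s))) =
      (𝓕 η.1 v * 𝓕 φ.1 (-v • ξ)) * (conj (ψ.1 (inner ℝ x ξ - s)) * expI (-(v * s))) :=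
    fun s => by ring
  simp only [h3, integral_const_mul, integral_conj_mul_expI, fourierShift]
  rw [inner_smul_left, real_inner_comm]
  simp
  ring

/-- The integrand of `K` in the normalization of Mathlib's Fourier transform. -/
def fourierKernel (n : ℕ) (ψ η : LizorkinLine) (v : ℝ) : ℂ :=
  conj (𝓕 ψ.1 v) * 𝓕 η.1 v / ((|v| ^ n : ℝ) : ℂ)

/-! ### The constant of the inversion formula in the two Fourier normalizations -/

theorem hat_two_pi_mul (ψ : LizorkinLine) (v : ℝ) :
    hat (fun t => ψ.1 t) (2 * Real.pi * v) = 𝓕 ψ.1 v := by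
  rw [fourier_eq_integral_expI]
  unfold hat expI
  refine integral_congr_ae (.of_forall fun t => ?_)
  dsimp only
  rw [mul_comm]
  congr 2
  simp
  ring

theorem kernelK_two_pi_mul (ψ η : LizorkinLine) (v : ℝ) :
    kernelK n (fun t => ψ.1 t) (fun t => η.1 t) (2 * Real.pi * v) =
      (((2 * Real.pi) ^ n : ℝ) : ℂ)⁻¹ * fourierKernel n ψ η v := by
  unfold kernelK fourierKernel
  rw [hat_two_pi_mul, hat_two_pi_mul, abs_mul, abs_of_pos Real.two_pi_pos, mul_pow]
  push_cast
  rw [div_eq_mul_inv, div_eq_mul_inv, mul_inv]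
  ring

theorem two_pi_pow_ne_zero : (((2 * Real.pi) ^ n : ℝ) : ℂ) ≠ 0 := by
  exact_mod_cast (pow_pos Real.two_pi_pos n).ne'

theorem integrable_fourierKernel {ψ η : LizorkinLine}
    (h : Integrable (kernelK n (fun t => ψ.1 t) (fun t => η.1 t))) :
    Integrable (fourierKernel n ψ η) := by
  have h1 := (h.comp_mul_left' Real.two_pi_pos.ne').const_mul (((2 * Real.pi) ^ n : ℝ) : ℂ)
  refine h1.congr (.of_forall fun v => ?_)
  dsimp only
  rw [kernelK_two_pi_mul, mul_inv_cancel_left₀ two_pi_pow_ne_zero]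

/-- For ω = 2πv the Jacobian 2π and the factor (2π)^(−n) from |ω|^(−n) cancel the prefactor
(2π)^(n−1). -/
theorem K_eq_integral_fourierKernel (hn : n ≠ 0) (ψ η : LizorkinLine) :
    K n (fun t => ψ.1 t) (fun t => η.1 t) = ∫ v, fourierKernel n ψ η v := by
  have h1 := Measure.integral_comp_mul_left (kernelK n (fun t => ψ.1 t) (fun t => η.1 t))
    (2 * Real.pi)
  simp only [kernelK_two_pi_mul, integral_const_mul] at h1
  rw [abs_of_pos (inv_pos.mpr Real.two_pi_pos), Complex.real_smul] at h1
  have h2 : (((2 * Real.pi) ^ n : ℝ) : ℂ) =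
      (((2 * Real.pi) ^ (n - 1) : ℝ) : ℂ) * ((2 * Real.pi : ℝ) : ℂ) := by
    rw [← Complex.ofReal_mul, ← pow_succ, Nat.sub_add_cancel (Nat.pos_of_ne_zero hn)]
  have h3 : ((2 * Real.pi : ℝ) : ℂ) ≠ 0 := by exact_mod_cast Real.two_pi_pos.ne'
  unfold K
  rw [inv_mul_eq_iff_eq_mul₀ two_pi_pow_ne_zero] at h1
  rw [h1, h2, Complex.ofReal_inv]
  field_simp

theorem fourierKernel_mul_pow (v : ℝ) (ψ η : LizorkinLine) :
    conj (𝓕 ψ.1 v) * 𝓕 η.1 v * (((|v| ^ n)⁻¹ : ℝ) : ℂ) = fourierKernel n ψ η v := by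
  unfold fourierKernel
  rw [Complex.ofReal_inv, div_eq_mul_inv]

theorem abs_inv_pow_finrank (v : ℝ) :
    |((-v) ^ Module.finrank ℝ (E n))⁻¹| = (|v| ^ n)⁻¹ := by
  rw [finrank_euclideanSpace_fin, abs_inv, abs_pow, abs_neg]

/-- For v ≠ 0 the substitution ξ ↦ −vξ costs |v|^(−n). The iterated integral of the absolute value
is then that of the kernel of `K` times the L¹ norm of φ^. -/
theorem integrable_waveCorr_kernel (φ : Lizorkin n) {η ψ : LizorkinLine}
    (h : Integrable (fourierKernel n ψ η)) (x : E n) :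
    Integrable (Function.uncurry fun (v : ℝ) (ξ : E n) =>
      conj (𝓕 ψ.1 v) * 𝓕 η.1 v * fourierShift φ x (-v • ξ)) (volume.prod volume) := by
  have hc := continuous_fourierShift φ x
  have hm : Continuous (Function.uncurry fun (v : ℝ) (ξ : E n) =>
      conj (𝓕 ψ.1 v) * 𝓕 η.1 v * fourierShift φ x (-v • ξ)) := by
    unfold Function.uncurry
    fun_prop
  have hne : ∀ᵐ v : ℝ, v ≠ 0 := Measure.ae_ne volume 0
  refine (integrable_prod_iff hm.aestronglyMeasurable).mpr ⟨?_, ?_⟩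
  · filter_upwards [hne] with v hv
    simp only [Function.uncurry_apply_pair]
    exact ((integrable_comp_smul_iff volume (fourierShift φ x) (neg_ne_zero.mpr hv)).mpr
      (integrable_fourierShift φ x)).const_mul _
  · refine (h.norm.mul_const (∫ ξ, ‖fourierShift φ x ξ‖)).congr ?_
    filter_upwards [hne] with v hv
    simp only [Function.uncurry_apply_pair, norm_mul _ (fourierShift φ x _), integral_const_mul]
    rw [Measure.integral_comp_smul volume (fun ξ => ‖fourierShift φ x ξ‖) (-v),
      abs_inv_pow_finrank, smul_eq_mul, ← mul_assoc, ← fourierKernel_mul_pow v, norm_mul _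
      (((|v| ^ n)⁻¹ : ℝ) : ℂ), Complex.norm_real, Real.norm_of_nonneg (by positivity)]

theorem integrable_waveCorr (φ : Lizorkin n) {η ψ : LizorkinLine}
    (h : Integrable (fourierKernel n ψ η)) (x : E n) : Integrable (waveCorr φ η ψ x) :=
  (integrable_waveCorr_kernel φ h x).integral_prod_right.congr
    (.of_forall fun ξ => (waveCorr_eq_integral φ η ψ x ξ).symm)

/-- Fubini, then scaling in ξ produces the kernel of `K`, and Fourier inversion evaluates the
remaining integral as φ(x). -/
theorem integral_waveCorr (φ : Lizorkin n) {η ψ : LizorkinLine}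
    (h : Integrable (fourierKernel n ψ η)) (x : E n) :
    ∫ ξ, waveCorr φ η ψ x ξ = (∫ v, fourierKernel n ψ η v) * φ.1 x := by
  simp only [waveCorr_eq_integral]
  rw [← integral_integral_swap (integrable_waveCorr_kernel φ h x), ← integral_mul_const]
  refine integral_congr_ae ?_
  filter_upwards [Measure.ae_ne (volume : Measure ℝ) 0] with v hv
  rw [integral_const_mul, Measure.integral_comp_smul volume (fourierShift φ x) (-v),
    abs_inv_pow_finrank, integral_fourierShift, Complex.real_smul, ← fourierKernel_mul_pow v]
  ring

theorem integral_volumeIoiPow (m : ℕ) (f : Set.Ioi (0 : ℝ) → ℂ) :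
    ∫ r, f r ∂Measure.volumeIoiPow m =
      ∫ r : Set.Ioi (0 : ℝ), (((r : ℝ) ^ m : ℝ) : ℂ) * f r ∂(volume.comap Subtype.val) := by
  have h : Measurable fun r : Set.Ioi (0 : ℝ) => Real.toNNReal ((r : ℝ) ^ m) := by fun_prop
  have h1 : Measure.volumeIoiPow m = (volume.comap Subtype.val).withDensity
      fun r : Set.Ioi (0 : ℝ) => ((Real.toNNReal ((r : ℝ) ^ m) : NNReal) : ENNReal) := rfl
  rw [h1, integral_withDensity_eq_integral_smul h]
  refine integral_congr_ae (.of_forall fun r => ?_)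
  have hr : (0 : ℝ) < r := r.2
  simp only [NNReal.smul_def]
  rw [Real.coe_toNNReal _ (by positivity), Complex.real_smul]

/-- The substitution `r = 1 / a`. -/
theorem integral_inv_pow (hn : n ≠ 0) (g : ℝ → ℂ) :
    ∫ a : Set.Ioi (0 : ℝ), ((((a : ℝ) ^ (n + 1))⁻¹ : ℝ) : ℂ) * g (a : ℝ)⁻¹
      ∂((volume : Measure ℝ).comap Subtype.val) =
    ∫ r : Set.Ioi (0 : ℝ), g r ∂Measure.volumeIoiPow (n - 1) := by
  rw [integral_volumeIoiPow (n - 1) fun r => g r,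
    integral_subtype_comap measurableSet_Ioi
      (fun a : ℝ => (((a ^ (n + 1))⁻¹ : ℝ) : ℂ) * g a⁻¹),
    integral_subtype_comap measurableSet_Ioi (fun r : ℝ => ((r ^ (n - 1) : ℝ) : ℂ) * g r),
    ← integral_comp_rpow_Ioi (fun r : ℝ => ((r ^ (n - 1) : ℝ) : ℂ) * g r)
      (by norm_num : (-1 : ℝ) ≠ 0)]
  -- The Jacobian of a ↦ a⁻¹ is a⁻², and a⁻² a^(−(n−1)) = a^(−(n+1)).
  refine setIntegral_congr_fun measurableSet_Ioi fun a ha => ?_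
  have ha : (0 : ℝ) < a := ha
  obtain ⟨m, rfl⟩ := Nat.exists_eq_succ_of_ne_zero hn
  rw [Real.rpow_neg_one, abs_neg, abs_one, one_mul, Complex.real_smul, ← mul_assoc,
    ← Complex.ofReal_mul, show (-1 - 1 : ℝ) = -(2 : ℕ) by norm_num, Real.rpow_neg ha.le,
    Real.rpow_natCast]
  congr 3
  rw [Nat.succ_sub_one, inv_pow, ← mul_inv, ← pow_add]
  congr 2
  omega

/-- Substituting b = a s gives db = a ds, which cancels the a⁻¹ of the ridgelet transform and leaves
a^(−n−1). -/
theorem integral_synKer_snd (φ : Lizorkin n) (η ψ : LizorkinLine) (Φ : SchwartzY n)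
    (hΦ : ∀ y, Φ.fn y = (((y.2.2 : ℝ)⁻¹ : ℝ) : ℂ) *
      wave φ η ((y.2.2 : ℝ)⁻¹ • (y.1 : E n)) ((y.2.2 : ℝ)⁻¹ * y.2.1))
    (x : E n) (u : Sph n) (a : Set.Ioi (0 : ℝ)) :
    ∫ b : ℝ, Φ.fn (u, b, a) *
        synKer (-(n : ℤ) - 1) 0 0 (fun _ => 1) (conjLine ψ) x (u, b, a) =
      ((((a : ℝ) ^ (n + 1))⁻¹ : ℝ) : ℂ) * waveCorr φ η ψ x ((a : ℝ)⁻¹ • (u : E n)) := by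
  have ha : (0 : ℝ) < a := a.2
  have hac : ((a : ℝ) : ℂ) ≠ 0 := by exact_mod_cast ha.ne'
  have h1 : ∀ b : ℝ, Φ.fn (u, b, a) *
      synKer (-(n : ℤ) - 1) 0 0 (fun _ => 1) (conjLine ψ) x (u, b, a) =
      ((((a : ℝ) ^ (n + 1))⁻¹ * (a : ℝ)⁻¹ : ℝ) : ℂ) *
        (fun s : ℝ => wave φ η ((a : ℝ)⁻¹ • (u : E n)) s *
          conj (ψ.1 (inner ℝ x ((a : ℝ)⁻¹ • (u : E n)) - s))) ((a : ℝ)⁻¹ * b) := fun b => by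
    have h2 : (inner ℝ x (u : E n) - b) / (a : ℝ) =
        inner ℝ x ((a : ℝ)⁻¹ • (u : E n)) - (a : ℝ)⁻¹ * b := by
      rw [inner_smul_right]; ring
    rw [hΦ]
    simp only [synKer, conjLine_apply, h2, zpow_sub_one₀ hac, zpow_neg, zpow_natCast, pow_zero]
    push_cast
    rw [pow_succ, mul_inv]
    ring
  simp only [h1]
  rw [integral_const_mul, Measure.integral_comp_mul_left
    (fun s : ℝ => wave φ η ((a : ℝ)⁻¹ • (u : E n)) s *
      conj (ψ.1 (inner ℝ x ((a : ℝ)⁻¹ • (u : E n)) - s))) (a : ℝ)⁻¹, inv_inv, abs_of_pos ha,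
    Complex.real_smul, ← mul_assoc, ← Complex.ofReal_mul, mul_assoc, inv_mul_cancel₀ ha.ne',
    mul_one]
  rfl

/-- After integration over b, the substitution r = 1/a turns a^(−n−1) da into r^(n−1) dr, so the
integral over (u, a) is the integral over ξ = r u in polar coordinates. -/
theorem synInt_eq_integral_waveCorr (hn : n ≠ 0) (φ : Lizorkin n) {η ψ : LizorkinLine}
    (h : Integrable (fourierKernel n ψ η)) (Φ : SchwartzY n)
    (hΦ : ∀ y, Φ.fn y = (((y.2.2 : ℝ)⁻¹ : ℝ) : ℂ) *
      wave φ η ((y.2.2 : ℝ)⁻¹ • (y.1 : E n)) ((y.2.2 : ℝ)⁻¹ * y.2.1)) (x : E n) :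
    synInt (-(n : ℤ) - 1) 0 0 (fun _ => 1) (conjLine ψ) Φ x = ∫ ξ, waveCorr φ η ψ x ξ := by
  have hI := integrable_synKer (-(n : ℤ) - 1) 0 0 (P := fun _ => 1) continuous_const
    (conjLine ψ) Φ x
  unfold synInt
  unfold prodMeasure at hI ⊢
  rw [integral_polar hn, integral_prod _ hI,
    integral_prod _ ((integrable_polar hn _).mpr (integrable_waveCorr φ h x))]
  refine integral_congr_ae ?_
  filter_upwards [hI.prod_right_ae] with u hu
  rw [integral_prod_symm _ hu]
  simp only [integral_synKer_snd φ η ψ Φ hΦ]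
  exact integral_inv_pow hn fun r => waveCorr φ η ψ x (r • (u : E n))

/-- The inversion formula on the Lizorkin test functions. -/
theorem synthesis_comp_ridgelet (hn : n ≠ 0) {ψ η : LizorkinLine}
    (h : Integrable (kernelK n (fun t => ψ.1 t) (fun t => η.1 t)))
    {S : SchwartzY n →L[ℂ] Lizorkin n} (hS : IsSynthesisOperator n (conjFn fun t => ψ.1 t) S)
    {T : Lizorkin n →L[ℂ] SchwartzY n} (hT : IsRidgeletOperator n (conjFn fun t => η.1 t) T)
    (φ : Lizorkin n) : S (T φ) = K n (fun t => ψ.1 t) (fun t => η.1 t) • φ := by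
  refine Subtype.ext (SchwartzMap.ext fun x => ?_)
  change (S (T φ)).1 x = K n (fun t => ψ.1 t) (fun t => η.1 t) * φ.1 x
  rw [(hS (T φ) x).2]
  unfold synthesis
  rw [integral_stdMeasure]
  simp only [density_mul_ridge]
  have hΦ : ∀ y, (T φ).fn y = (((y.2.2 : ℝ)⁻¹ : ℝ) : ℂ) *
      wave φ η ((y.2.2 : ℝ)⁻¹ • (y.1 : E n)) ((y.2.2 : ℝ)⁻¹ * y.2.1) := fun y => by
    rw [(hT φ y).2, ridgelet_conj_eq]
  have h1 := synInt_eq_integral_waveCorr hn φ (integrable_fourierKernel h) (T φ) hΦ x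
  rw [integral_waveCorr φ (integrable_fourierKernel h) x, ← K_eq_integral_fourierKernel hn] at h1
  exact h1

end inversion

end Ridgelet

end

/-! ### The inversion formula for Lizorkin distributions -/

theorem theorem5p4 (n : ℕ) (hn : 2 ≤ n) (ψ η : Ridgelet.LizorkinLine) (hψ : ψ ≠ 0)
    (hη : Ridgelet.IsReconstruction n (fun t => ψ.1 t) (fun t => η.1 t)) :
    Ridgelet.IsSynthesisOperator n (Ridgelet.conjFn fun t => ψ.1 t)
      (Ridgelet.synthesisCLM n (Ridgelet.conjFn fun t => ψ.1 t)) ∧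
    Ridgelet.IsRidgeletOperator n (Ridgelet.conjFn fun t => η.1 t)
      (Ridgelet.ridgeletCLM n (Ridgelet.conjFn fun t => η.1 t)) ∧
    ContinuousLinearMap.id ℂ (Ridgelet.LizorkinDist n) =
      (Ridgelet.K n (fun t => ψ.1 t) (fun t => η.1 t))⁻¹ •
        (Ridgelet.synthesisDist n η ∘L Ridgelet.ridgeletDist n ψ) := by
  have hn0 : n ≠ 0 := by omega
  have hS : Ridgelet.IsSynthesisOperator n (Ridgelet.conjFn fun t => ψ.1 t)
      (Ridgelet.synthesisCLM n (Ridgelet.conjFn fun t => ψ.1 t)) := by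
    unfold Ridgelet.synthesisCLM
    rw [dif_pos (Ridgelet.exists_isSynthesisOperator hn0 ψ)]
    exact (Ridgelet.exists_isSynthesisOperator hn0 ψ).choose_spec
  have hT : Ridgelet.IsRidgeletOperator n (Ridgelet.conjFn fun t => η.1 t)
      (Ridgelet.ridgeletCLM n (Ridgelet.conjFn fun t => η.1 t)) := by
    unfold Ridgelet.ridgeletCLM
    rw [dif_pos (Ridgelet.exists_isRidgeletOperator η)]
    exact (Ridgelet.exists_isRidgeletOperator η).choose_spec
  refine ⟨hS, hT, ContinuousLinearMap.ext fun f => ContinuousLinearMap.ext fun φ => ?_⟩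
  have h : f (Ridgelet.synthesisCLM n (Ridgelet.conjFn fun t => ψ.1 t)
      (Ridgelet.ridgeletCLM n (Ridgelet.conjFn fun t => η.1 t) φ)) =
      Ridgelet.K n (fun t => ψ.1 t) (fun t => η.1 t) * f φ := by
    rw [Ridgelet.synthesis_comp_ridgelet hn0 hη.1 hS hT φ, map_smul, smul_eq_mul]
  -- Unfolding the two transposes reverses the order of composition: on φ the ridgelet transform
  -- acts first and synthesis second.
  change f φ = (Ridgelet.K n (fun t => ψ.1 t) (fun t => η.1 t))⁻¹ *
    f (Ridgelet.synthesisCLM n (Ridgelet.conjFn fun t => ψ.1 t)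
      (Ridgelet.ridgeletCLM n (Ridgelet.conjFn fun t => η.1 t) φ))
  rw [h, inv_mul_cancel_left₀ hη.2]
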